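/- Let $A\in\mathbb{Z}^{d\times n}$ be an integer matrix, with columns $a_1,\dots,a_n$, and let $P=\mathrm{conv}(a_1,\dots,a_n)\subset\mathbb{R}^d$. For a nonempty face $\alpha$ of $P$ (including $P$ itself) let $L_\alpha\subseteq\mathbb{R}^d$ be the linear space parallel to the affine span of $\alpha$, so that $\dim\alpha=\dim L_\alpha$, and let $M_\alpha=L_\alpha\cap\mathbb{Z}^d$. The normalized volume of an $r$-dimensional set is $r!$ times its Lebesgue measure in coordinates given by a basis of the relevant lattice of rank $r$; $\mathrm{Vol}(\alpha)$ is the volume of (a translate into $L_\alpha$ of) $\alpha$, normalized with respect to $M_\alpha$. For faces $\beta\subseteq\alpha$ of $P$, let $A_\alpha/\beta$ be the set of the classes of the vectors $a_i-a_j$ with $a_i\in\alpha$, $a_j\in\beta$ in $\mathbb{R}^d/L_\beta$ (the class does not depend on $j$), and define the subdiagram volume $$\mu(\alpha/\beta)=\mathrm{Vol}\bigl(\mathrm{conv}(A_\alpha/\beta)\setminus\mathrm{conv}((A_\alpha/\beta)\setminus\{0\})\bigr),$$ normalized with respect to the lattice $M_\alpha/M_\beta$. The Euler obstructions of the faces are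 defined recursively by $\mathrm{Eu}(P)=1$ and $$\mathrm{Eu}(\beta)=\sum_{\alpha\supsetneq\beta}(-1)^{\dim\alpha-\dim\beta-1}\,\mu(\alpha/\beta)\,\mathrm{Eu}(\alpha)\qquad(\beta\neq P),$$ the sum being over the faces $\alpha$ of $P$ that properly contain $\beta$. Let $V_j=\sum_{\beta}\mathrm{Vol}(\beta)\,\mathrm{Eu}(\beta)$, the sum being over the $j$-dimensional faces $\beta$ of $P$; these are the Chern–Mather volumes of $A$. **Proposition 4.7.** Let $1\le k\le d-1$, and let $A$ be the matrix whose columns are the $\binom dk$ vectors in $\{0,1\}^d$ with exactly $k$ entries equal to $1$, so that $P=\mathrm{conv}(A)$ is the hypersimplex $\Delta_{d,k}$. Then $$V_0=\binom dk\cdot\min(k,d-k),\qquad V_\ell=\sum_{i=1}^{\min(k,\ell)}\binom{d}{\ell+1}\binom{d-\ell-1}{k-i}\,A(\ell,i-1)\quad\text{for }\ell=1,\dots,d-1,$$ where the Eulerian number $A(n,m)$ is the number of permutations of $n$ letters with exactly $m$ descents. For $\ell=d-1$ this gives $V_{d-1}=A(d-1,k-1)=\mathrm{Vol}(\Delta_{d,k})$.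 -/

import Mathlib

noncomputable section

namespace ChernMather

open MeasureTheory

/-! ### Normalized volume -/

/-- The volume of a set `S` in the real span of the lattice `L`, normalized with respect to `L`:
choose a lattice basis `b` of `L` (of length `r`, say), write the points of `S` in the coordinates
given by `b`, and multiply the Lebesgue measure of the resulting subset of `ℝʳ` by `r!`, so that
a unimodular simplex of `L` has volume `1`.  The value does not depend on the basis.
(If `L` has no such basis, that is, if `L` is not a lattice, the value is `0`.) -/
def normalizedVolume {V : Type*} [AddCommGroup V] [Module ℝ V] (L : Submodule ℤ V) (S : Set V) :
    ℝ :=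
  open Classical in
  if h : ∃ (r : ℕ) (b : Fin r → V),
      LinearIndependent ℝ b ∧ Submodule.span ℤ (Set.range b) = L then
    (h.choose.factorial : ℝ) *
      (volume {c : Fin h.choose → ℝ | ∑ i, c i • h.choose_spec.choose i ∈ S}).toReal
  else 0

/-- The lattice `ℤᵈ` inside `ℝᵈ`. -/
def integerLattice (d : ℕ) : Submodule ℤ (Fin d → ℝ) :=
  Submodule.span ℤ (Set.range (Pi.basisFun ℝ (Fin d)))

/-- The lattice `M_F` of a set `F ⊆ ℝᵈ`: the integer points in the linear space parallel to the
affine span of `F` (equivalently, in the linear span of `F` after a translation that moves a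
point of `F` to the origin). -/
def faceLattice {d : ℕ} (F : Set (Fin d → ℝ)) : Submodule ℤ (Fin d → ℝ) :=
  integerLattice d ⊓ (vectorSpan ℝ F).restrictScalars ℤ

/-- The dimension of (the affine span of) a set in `ℝᵈ`. -/
def dimension {d : ℕ} (F : Set (Fin d → ℝ)) : ℕ :=
  Module.finrank ℝ (vectorSpan ℝ F)

/-- The normalized volume `Vol(F)` of a lattice polytope `F`, of any dimension: translate a point of
`F` to the origin and measure with respect to `M_F`. -/
def vol {d : ℕ} (F : Set (Fin d → ℝ)) : ℝ :=
  open Classical in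
  if h : F.Nonempty then normalizedVolume (faceLattice F) ((fun x => x - h.some) '' F) else 0

/-! ### The polytope of an integer matrix and its faces -/

variable {d : ℕ} {ι : Type} [Fintype ι]

/-- The `i`-th column of the integer matrix `A`, as a point of `ℝᵈ`. -/
def column (A : Matrix (Fin d) ι ℤ) (i : ι) : Fin d → ℝ := fun j => (A j i : ℝ)

/-- The polytope `P = conv(A)`. -/
def polytope (A : Matrix (Fin d) ι ℤ) : Set (Fin d → ℝ) :=
  convexHull ℝ (Set.range (column A))

/-- The nonempty faces of `P = conv(A)`, including `P` itself, ordered by inclusion: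
the subsets of `P` on which some linear functional attains its maximum over `P`. -/
abbrev Face (A : Matrix (Fin d) ι ℤ) : Type :=
  {F : Set (Fin d → ℝ) // F.Nonempty ∧ IsExposed ℝ (polytope A) F}

/-- A polytope has finitely many faces. -/
instance finite_face (A : Matrix (Fin d) ι ℤ) : Finite (Face A) := by
  have hP : IsCompact (polytope A) := (Set.finite_range (column A)).isCompact_convexHull ℝ
  have hconv : Convex ℝ (polytope A) := convex_convexHull ℝ _
  have hsub : ∀ F : Face A, F.1.extremePoints ℝ ⊆ Set.range (column A) := fun F =>
    F.2.2.isExtreme.extremePoints_subset_extremePoints.trans extremePoints_convexHull_subset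
  have hfin : Finite (Set.powerset (Set.range (column A))) :=
    (Set.finite_range (column A)).finite_subsets.to_subtype
  refine Finite.of_injective
    (fun F : Face A => (⟨F.1.extremePoints ℝ, hsub F⟩ : Set.powerset (Set.range (column A)))) ?_
  intro F G h
  have h' : F.1.extremePoints ℝ = G.1.extremePoints ℝ := congrArg Subtype.val h
  apply Subtype.ext
  rw [← closure_convexHull_extremePoints (F.2.2.isCompact hP) (F.2.2.convex hconv), h',
    closure_convexHull_extremePoints (G.2.2.isCompact hP) (G.2.2.convex hconv)]

instance fintypeFace (A : Matrix (Fin d) ι ℤ) : Fintype (Face A) := Fintype.ofFinite _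

/-! ### Subdiagram volumes, Euler obstructions and Chern-Mather volumes -/

/-- The configuration `A_α / β`: the images, in the quotient of `ℝᵈ` by the linear space parallel
to `β`, of the columns of `A` that lie in `α`, after a translation that moves a column of `A`
in `β` to the origin (the image does not depend on which one). -/
def quotientConfiguration (A : Matrix (Fin d) ι ℤ) (α β : Face A) :
    Set ((Fin d → ℝ) ⧸ vectorSpan ℝ β.1) :=
  {q | ∃ i j : ι, column A i ∈ α.1 ∧ column A j ∈ β.1 ∧
    q = (vectorSpan ℝ β.1).mkQ (column A i - column A j)}

/-- The lattice `M_α / M_β`: the image of `M_α` in the quotient of `ℝᵈ` by the linear space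
parallel to `β`. -/
def quotientLattice (A : Matrix (Fin d) ι ℤ) (α β : Face A) :
    Submodule ℤ ((Fin d → ℝ) ⧸ vectorSpan ℝ β.1) :=
  (faceLattice α.1).map ((vectorSpan ℝ β.1).mkQ.restrictScalars ℤ)

/-- The subdiagram volume `μ(α/β)` for faces `β ⊆ α`. -/
def subdiagramVolume (A : Matrix (Fin d) ι ℤ) (α β : Face A) : ℝ :=
  normalizedVolume (quotientLattice A α β)
    (convexHull ℝ (quotientConfiguration A α β) \
      convexHull ℝ (quotientConfiguration A α β \ {0}))

/-- The Euler obstruction `Eu(β)` of a face `β` of `P`: `Eu(P) = 1`, and for `β ≠ P`,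
`Eu(β) = ∑ (-1) ^ (dim α - dim β - 1) * μ(α/β) * Eu(α)`, over all faces `α` of `P` that contain `β`
properly. -/
def eulerObstruction (A : Matrix (Fin d) ι ℤ) : Face A → ℝ :=
  open Classical in
  WellFounded.fix (C := fun _ => ℝ) (wellFounded_gt : WellFounded ((· > ·) : Face A → Face A → Prop))
    fun β Eu =>
      if β.1 = polytope A then 1
      else ∑ α : Face A, if h : β < α then
        (-1 : ℝ) ^ (dimension α.1 - dimension β.1 - 1) * subdiagramVolume A α β * Eu α h
      else 0

open Classical in
/-- The recursion that defines the Euler obstruction. -/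
theorem eulerObstruction_eq (A : Matrix (Fin d) ι ℤ) (β : Face A) :
    eulerObstruction A β =
      if β.1 = polytope A then 1
      else ∑ α : Face A with β < α,
        (-1 : ℝ) ^ (dimension α.1 - dimension β.1 - 1) * subdiagramVolume A α β *
          eulerObstruction A α := by
  unfold eulerObstruction
  rw [WellFounded.fix_eq]
  simp only [Finset.sum_filter, dite_eq_ite]

open Classical in
/-- `V_j`, the sum of the Chern-Mather volumes `Vol(β) * Eu(β)` of the `j`-dimensional faces `β`
of `P = conv(A)`. -/
def chernMatherVolume (A : Matrix (Fin d) ι ℤ) (j : ℕ) : ℝ :=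
  ∑ β : Face A with dimension β.1 = j, vol β.1 * eulerObstruction A β

/-! ### Hypersimplices and Eulerian numbers -/

/-- The matrix whose columns are the vectors in `{0,1}ᵈ` with exactly `k` entries equal to `1`.
Its polytope is the hypersimplex `Δ_{d,k}`. -/
def hypersimplexMatrix (d k : ℕ) : Matrix (Fin d) {s : Finset (Fin d) // s.card = k} ℤ :=
  fun j s => if j ∈ s.1 then 1 else 0

/-- The Eulerian number `A(n, m)`: the number of permutations `σ` of `n` letters with exactly
`m` descents, that is, positions `i` with `σ(i) > σ(i+1)`. -/
def eulerianNumber (n m : ℕ) : ℕ :=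
  Fintype.card {σ : Equiv.Perm (Fin n) //
    Fintype.card {i : Fin n // ∃ h : i.1 + 1 < n, σ ⟨i.1 + 1, h⟩ < σ i} = m}

end ChernMather

end

namespace ChernMather

open MeasureTheory

/-! ### Normalized volume in an arbitrary lattice basis -/

/-! The nonempty faces of the hypersimplex are indexed by pairs `L ⊆ U`: the coordinates are fixed
to `1` on `L`, to `0` outside `U`, and are free on `U \ L`. Either `L = U` has `k` elements (a
vertex), or `L.card < k < U.card`, and then the face is a smaller hypersimplex of dimension `(U \
L).card - 1` (`faceOfIndex_bijective`). Three computations give the formula.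

Volumes. Projecting away one free coordinate turns a face of dimension `ℓ ≥ 1` into the slice `m ≤ ∑
xᵢ ≤ m + 1` of the unit cube of dimension `ℓ`, where `m = k - L.card - 1`. The normalized volume of
the slice is an Eulerian number (`volume_cube_slice`): the integer part of `∑ xᵢ` counts the
descents of the partial sums modulo `1`, taking partial sums modulo `1` preserves the volume, and
the cube is cut by the order of the coordinates into `n!` congruent pieces, one for each
permutation.

Euler obstructions off the vertices. Along a face that is not a vertex, the tangent cone of any
larger face is, modulo the smaller one, an orthant spanned by a lattice basis contained in the
configuration. So all `μ` equal `1` (`subdiagramVolume_eq_one`), and the recursion collapses to an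
alternating sum over pairs of subsets; hence `Eu = 1`.

Euler obstructions at the vertices. For a vertex `S` and the face `(S \ A, S ∪ B)`, the subdiagram
part is a pyramid over a product of simplices of dimensions `A.card - 1` and `B.card - 1`, so `μ` is
a binomial coefficient (`subdiagramVolume_vertex`). The alternating sum of these over nonempty `A ⊆
S` and `B ⊆ Sᶜ` is `min k (d - k)`, by finite differences (`sum_powerset_powerset_choose`).

It remains to count the pairs `(L, U)` of each dimension. -/

/-- Relabelling the coordinates preserves Lebesgue measure. -/
theorem volume_preimage_comp_equiv {ι κ : Type*} [Fintype ι] [Fintype κ] (e : κ ≃ ι)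
    (S : Set (κ → ℝ)) : volume {c : ι → ℝ | (fun j => c (e j)) ∈ S} = volume S := by
  have h := volume_measurePreserving_piCongrLeft (fun _ : κ => ℝ) e.symm
  rw [← h.measure_preimage_equiv S]
  congr 1
  ext c
  have : (MeasurableEquiv.piCongrLeft (fun _ : κ => ℝ) e.symm) c = fun j => c (e j) := by
    ext j
    have := Equiv.piCongrLeft_apply_apply (fun _ : κ => ℝ) e.symm c (e j)
    simpa [MeasurableEquiv.coe_piCongrLeft] using this
  simp only [Set.mem_ofPred_eq, Set.mem_preimage, this]

/-- The change of basis between two bases of one lattice is an integer matrix with integer inverse,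
so its determinant is `±1` and Lebesgue measure is preserved. -/
theorem volume_coordinates_eq {V : Type*} [AddCommGroup V] [Module ℝ V] {ι κ : Type*}
    [Fintype ι] [Fintype κ] {b : ι → V} {b' : κ → V} (hb : LinearIndependent ℝ b)
    (hb' : LinearIndependent ℝ b')
    (h : Submodule.span ℤ (Set.range b) = Submodule.span ℤ (Set.range b')) (S : Set V) :
    Fintype.card ι = Fintype.card κ ∧
      volume {c : ι → ℝ | ∑ i, c i • b i ∈ S} = volume {c : κ → ℝ | ∑ i, c i • b' i ∈ S} := by
  classical
  have hinj : Function.Injective fun r : ℤ => r • (1 : ℝ) := fun x y hxy => by simpa using hxy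
  let B := Module.Basis.span (hb.restrict_scalars hinj)
  let B' := (Module.Basis.span (hb'.restrict_scalars hinj)).map (LinearEquiv.ofEq _ _ h.symm)
  let e : κ ≃ ι := B'.indexEquiv B
  refine ⟨(Fintype.card_congr e).symm, ?_⟩
  let C := B'.reindex e
  have hC : ∀ j, ((C (e j) : Submodule.span ℤ (Set.range b)) : V) = b' j := fun j => by
    simp [C, B', Module.Basis.span_apply]
  have hB : ∀ j, ((B j : Submodule.span ℤ (Set.range b)) : V) = b j := fun j => by
    simp [B, Module.Basis.span_apply]
  let M : Matrix ι ι ℤ := B.toMatrix C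
  have hM : ∀ j, b' j = ∑ i, (M i (e j) : ℝ) • b i := fun j => by
    have h1 := congrArg (Subtype.val) (B.sum_toMatrix_smul_self C (e j))
    rw [hC] at h1
    rw [← h1, AddSubmonoidClass.coe_finsetSum]
    refine Finset.sum_congr rfl fun i _ => ?_
    rw [Submodule.coe_smul, hB, Int.cast_smul_eq_zsmul]
  let MR : Matrix ι ι ℝ := M.map (Int.castRingHom ℝ)
  have hdet : |MR.det| = 1 := by
    have h1 : IsUnit M.det := by
      rw [← Matrix.isUnit_iff_isUnit_det]
      exact ⟨⟨M, C.toMatrix B, B.toMatrix_mul_toMatrix_flip C, C.toMatrix_mul_toMatrix_flip B⟩, rfl⟩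
    have h2 : MR.det = (M.det : ℝ) := by
      simp only [MR]
      rw [← RingHom.mapMatrix_apply, ← RingHom.map_det]
      rfl
    rw [h2, ← Int.cast_abs, Int.isUnit_iff_abs_eq.1 h1, Int.cast_one]
  have hdet0 : LinearMap.det (Matrix.toLin' MR) ≠ 0 := by
    rw [LinearMap.det_toLin']
    intro h0
    simp [h0] at hdet
  have h3 := Measure.addHaar_preimage_linearMap (volume : Measure (ι → ℝ)) hdet0
    {c : ι → ℝ | ∑ i, c i • b i ∈ S}
  rw [LinearMap.det_toLin', abs_inv, hdet, inv_one, ENNReal.ofReal_one, one_mul] at h3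
  rw [← h3, ← volume_preimage_comp_equiv e {c : κ → ℝ | ∑ i, c i • b' i ∈ S}]
  congr 1
  ext c
  simp only [Set.mem_preimage, Set.mem_ofPred_eq, Matrix.toLin'_apply]
  have : ∑ i, (MR.mulVec c) i • b i = ∑ j, c (e j) • b' j := by
    simp only [hM, Finset.smul_sum, Matrix.mulVec, dotProduct, Finset.sum_smul, smul_smul]
    rw [Finset.sum_comm, ← e.sum_comp]
    refine Finset.sum_congr rfl fun i _ => Finset.sum_congr rfl fun j _ => ?_
    rw [mul_comm]
    rfl
  rw [this]

/-- This removes the choice of basis from the definition and permits any finite index type; every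
volume below is computed through it. -/
theorem normalizedVolume_eq {V : Type*} [AddCommGroup V] [Module ℝ V] {ι : Type*} [Fintype ι]
    {b : ι → V} (hb : LinearIndependent ℝ b) {L : Submodule ℤ V}
    (hL : Submodule.span ℤ (Set.range b) = L) (S : Set V) :
    normalizedVolume L S =
      ((Fintype.card ι).factorial : ℝ) * (volume {c : ι → ℝ | ∑ i, c i • b i ∈ S}).toReal := by
  have h : ∃ (r : ℕ) (b : Fin r → V),
      LinearIndependent ℝ b ∧ Submodule.span ℤ (Set.range b) = L := by
    refine ⟨Fintype.card ι, b ∘ (Fintype.equivFin ι).symm, hb.comp _ (Equiv.injective _), ?_⟩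
    rw [EquivLike.range_comp, hL]
  unfold normalizedVolume
  rw [dif_pos h]
  have hs := h.choose_spec.choose_spec
  obtain ⟨h1, h2⟩ := volume_coordinates_eq hb hs.1 (hL.trans hs.2.symm) S
  rw [h2, h1, Fintype.card_fin]

/-! ### Volumes of slices of the cube -/

/-- A level set of a nonzero functional is empty or a proper affine subspace. This is what makes
strict and weak inequalities interchangeable in the volume computations. -/
theorem volume_linear_level_eq_zero {ι : Type*} [Fintype ι] (f : (ι → ℝ) →ₗ[ℝ] ℝ) (hf : f ≠ 0)
    (c : ℝ) : volume {x : ι → ℝ | f x = c} = 0 := by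
  by_cases hne : ∃ p, f p = c
  · obtain ⟨p, hp⟩ := hne
    have h : {x : ι → ℝ | f x = c} = AffineSubspace.mk' p (LinearMap.ker f) := by
      ext x
      simp [AffineSubspace.mem_mk', hp, sub_eq_zero]
    rw [h]
    refine Measure.addHaar_affineSubspace _ _ fun htop => hf ?_
    have := congrArg AffineSubspace.direction htop
    rwa [AffineSubspace.direction_mk', AffineSubspace.direction_top, LinearMap.ker_eq_top] at this
  · push Not at hne
    simp [hne]

/-- The half-open unit cube. -/
def cube (n : ℕ) : Set (Fin n → ℝ) := Set.univ.pi fun _ => Set.Ico 0 1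

theorem mem_cube {n : ℕ} {x : Fin n → ℝ} : x ∈ cube n ↔ ∀ i, 0 ≤ x i ∧ x i < 1 := by
  simp [cube, Set.mem_pi]

theorem measurableSet_cube (n : ℕ) : MeasurableSet (cube n) :=
  MeasurableSet.univ_pi fun _ => measurableSet_Ico

theorem volume_cube (n : ℕ) : volume (cube n) = 1 := by
  simp [cube, volume_pi_pi]

/-! ### Decomposition of the cube by the order of the coordinates. -/

/-- The points of the cube whose coordinates are in the same relative order as the values of
`σ`. -/
def orderRegion {n : ℕ} (σ : Equiv.Perm (Fin n)) : Set (Fin n → ℝ) :=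
  {y | y ∈ cube n ∧ ∀ i j, σ i < σ j → y i < y j}

theorem measurableSet_orderRegion {n : ℕ} (σ : Equiv.Perm (Fin n)) :
    MeasurableSet (orderRegion σ) := by
  have : orderRegion σ = cube n ∩ ⋂ i, ⋂ j, {y | σ i < σ j → y i < y j} := by
    ext y; simp [orderRegion]
  rw [this]
  refine (measurableSet_cube n).inter (MeasurableSet.iInter fun i => MeasurableSet.iInter fun j => ?_)
  by_cases h : σ i < σ j
  · simp only [h, true_imp_iff]
    exact measurableSet_lt (measurable_pi_apply i) (measurable_pi_apply j)
  · simp [h]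

theorem volume_orderRegion_eq {n : ℕ} (σ : Equiv.Perm (Fin n)) :
    volume (orderRegion σ) = volume (orderRegion (1 : Equiv.Perm (Fin n))) := by
  rw [← volume_preimage_comp_equiv σ.symm (orderRegion (1 : Equiv.Perm (Fin n)))]
  congr 1
  ext y
  simp only [orderRegion, mem_cube, Set.mem_ofPred_eq, Equiv.Perm.coe_one, id]
  refine and_congr ⟨fun h i => h _, fun h i => by simpa using h (σ i)⟩
    ⟨fun h i j hij => h _ _ (by simpa using hij), fun h i j hij => by simpa using h (σ i) (σ j) hij⟩

theorem lt_iff_of_mem_orderRegion {n : ℕ} {σ : Equiv.Perm (Fin n)} {y : Fin n → ℝ}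
    (hy : y ∈ orderRegion σ) (i j : Fin n) : y i < y j ↔ σ i < σ j := by
  refine ⟨fun h => ?_, hy.2 i j⟩
  by_contra hcon
  rcases (not_lt.1 hcon).lt_or_eq with h1 | h1
  · exact absurd (hy.2 _ _ h1) h.not_gt
  · rw [σ.injective h1] at h
    exact lt_irrefl _ h

/-- The only order automorphism of `Fin n` is the identity, so the relative order of the values
determines the permutation. -/
theorem eq_of_lt_iff_lt {n : ℕ} {σ τ : Equiv.Perm (Fin n)} (h : ∀ i j, σ i < σ j ↔ τ i < τ j) :
    σ = τ := by
  have hm : StrictMono (σ.symm.trans τ) := fun i j hij => by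
    simpa using (h (σ.symm i) (σ.symm j)).1 (by simpa using hij)
  have := Subsingleton.elim (hm.orderIsoOfSurjective _ (Equiv.surjective _)) (OrderIso.refl (Fin n))
  ext i
  have h2 := congrArg (fun f : Fin n ≃o Fin n => f (σ i)) this
  simp at h2
  exact congrArg Fin.val h2.symm

theorem pairwise_disjoint_orderRegion (n : ℕ) :
    Pairwise (Function.onFun Disjoint (orderRegion (n := n))) := fun _ _ hne =>
  Set.disjoint_left.2 fun _ hσ hτ => hne <| eq_of_lt_iff_lt fun i j =>
    (lt_iff_of_mem_orderRegion hσ i j).symm.trans (lt_iff_of_mem_orderRegion hτ i j)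

theorem exists_mem_orderRegion {n : ℕ} {y : Fin n → ℝ} (hy : y ∈ cube n)
    (hinj : Function.Injective y) : ∃ σ, y ∈ orderRegion σ := by
  have hm : StrictMono (y ∘ Tuple.sort y) :=
    (Tuple.monotone_sort y).strictMono_of_injective (hinj.comp (Equiv.injective _))
  refine ⟨(Tuple.sort y).symm, hy, fun i j hij => ?_⟩
  simpa using hm hij

theorem ae_injective (n : ℕ) : ∀ᵐ y : Fin n → ℝ, Function.Injective y := by
  have h : ∀ i j : Fin n, i ≠ j → ∀ᵐ y : Fin n → ℝ, y i ≠ y j := fun i j hij => by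
    have h0 := volume_linear_level_eq_zero
      (LinearMap.proj (R := ℝ) (φ := fun _ : Fin n => ℝ) i -
        LinearMap.proj (R := ℝ) (φ := fun _ : Fin n => ℝ) j) (fun h => by
        have := LinearMap.congr_fun h (Pi.single i (1 : ℝ))
        simp [Pi.single_eq_of_ne hij.symm] at this) 0
    rw [ae_iff]
    simpa [sub_eq_zero] using h0
  have h2 : ∀ᵐ y : Fin n → ℝ, ∀ i j : Fin n, i ≠ j → y i ≠ y j := by
    simp only [ae_all_iff]
    exact h
  filter_upwards [h2] with y hy i j hij
  by_contra hne
  exact hy i j hne hij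

/-- Up to the null set of points with a repeated coordinate, the cube is the disjoint union of the
congruent order regions; a set that is a union of regions is measured by counting them. -/
theorem volume_cube_inter_eq_sum {n : ℕ} (S : Set (Fin n → ℝ)) (Q : Finset (Equiv.Perm (Fin n)))
    (h : ∀ σ, ∀ y ∈ orderRegion σ, (y ∈ S ↔ σ ∈ Q)) :
    volume (S ∩ cube n) = Q.card * volume (orderRegion (1 : Equiv.Perm (Fin n))) := by
  have h1 : (S ∩ cube n : Set (Fin n → ℝ)) =ᵐ[volume] (⋃ σ ∈ Q, orderRegion σ : Set _) := by
    filter_upwards [ae_injective n] with y hy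
    apply propext
    change y ∈ S ∩ cube n ↔ y ∈ ⋃ σ ∈ Q, orderRegion σ
    simp only [Set.mem_iUnion, Set.mem_inter_iff, exists_prop]
    constructor
    · rintro ⟨hS, hc⟩
      obtain ⟨σ, hσ⟩ := exists_mem_orderRegion hc hy
      exact ⟨σ, (h σ y hσ).1 hS, hσ⟩
    · rintro ⟨σ, hQ, hσ⟩
      exact ⟨(h σ y hσ).2 hQ, hσ.1⟩
  rw [measure_congr h1, measure_biUnion_finset
    (fun σ _ τ _ hne => pairwise_disjoint_orderRegion n hne)
    (fun σ _ => measurableSet_orderRegion σ), Finset.sum_congr rfl fun σ _ =>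
      volume_orderRegion_eq σ, Finset.sum_const, nsmul_eq_mul]

/-- The `n!` regions have equal volume and fill a cube of volume `1`. -/
theorem volume_orderRegion_one (n : ℕ) :
    volume (orderRegion (1 : Equiv.Perm (Fin n))) = (n.factorial : ENNReal)⁻¹ := by
  have h := volume_cube_inter_eq_sum (n := n) Set.univ Finset.univ (by simp)
  rw [Set.univ_inter, volume_cube, Finset.card_univ, Fintype.card_perm, Fintype.card_fin] at h
  exact ENNReal.eq_inv_of_mul_eq_one_left (by rw [mul_comm]; exact h.symm)

/-! ### Partial sums -/

/-- The matrix of partial sums. -/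
noncomputable def partialSumMatrix (n : ℕ) : Matrix (Fin n) (Fin n) ℝ := fun i j => if j ≤ i then 1 else 0

theorem det_partialSumMatrix (n : ℕ) : (partialSumMatrix n).det = 1 := by
  rw [Matrix.det_of_isLowerTriangular]
  · simp [partialSumMatrix]
  · intro i j hij
    simp only [OrderDual.toDual_lt_toDual] at hij
    simp [partialSumMatrix, hij]

/-- The linear automorphism that takes a vector to its partial sums. -/
noncomputable def partialSums (n : ℕ) : (Fin n → ℝ) ≃ₗ[ℝ] (Fin n → ℝ) :=
  LinearEquiv.ofIsUnitDet (f := Matrix.toLin' (partialSumMatrix n))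
    (v := Pi.basisFun ℝ (Fin n)) (v' := Pi.basisFun ℝ (Fin n)) (by
      rw [← Matrix.toLin_eq_toLin', LinearMap.toMatrix_toLin, det_partialSumMatrix]
      exact isUnit_one)

theorem partialSums_apply {n : ℕ} (x : Fin n → ℝ) (i : Fin n) :
    partialSums n x i = ∑ j with j ≤ i, x j := by
  simp [partialSums, LinearEquiv.ofIsUnitDet_apply, Matrix.mulVec, dotProduct, partialSumMatrix,
    Finset.sum_filter]

theorem volume_preimage_partialSums {n : ℕ} (S : Set (Fin n → ℝ)) :
    volume (partialSums n ⁻¹' S) = volume S := by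
  have hd : LinearMap.det (Matrix.toLin' (partialSumMatrix n)) = 1 := by
    rw [LinearMap.det_toLin', det_partialSumMatrix]
  have := Measure.addHaar_preimage_linearMap (volume : Measure (Fin n → ℝ))
    (f := Matrix.toLin' (partialSumMatrix n)) (by rw [hd]; exact one_ne_zero) S
  rw [hd, inv_one, abs_one, ENNReal.ofReal_one, one_mul] at this
  exact this

/-! ### Slices of the cube and Eulerian numbers -/

open Classical in
/-- The number of descents of a finite sequence. -/
noncomputable def descents {n : ℕ} {α : Type*} [LT α] (y : Fin n → α) : ℕ :=
  (Finset.univ.filter fun i : Fin n => ∃ h : i.1 + 1 < n, y ⟨i.1 + 1, h⟩ < y i).card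

open Classical in
theorem eulerianNumber_eq (n m : ℕ) :
    eulerianNumber n m =
      (Finset.univ.filter fun σ : Equiv.Perm (Fin n) => descents σ = m).card := by
  have h : ∀ σ : Equiv.Perm (Fin n),
      Fintype.card {i : Fin n // ∃ h : i.1 + 1 < n, σ ⟨i.1 + 1, h⟩ < σ i} = descents σ :=
    fun σ => by
      rw [Fintype.card_subtype]
      unfold descents
      congr!
  unfold eulerianNumber
  rw [Fintype.card_subtype]
  congr 1
  ext σ
  simp only [Finset.mem_filter, Finset.mem_univ, true_and, h]

open Classical in
theorem descents_eq_card_range {n : ℕ} {α : Type*} [LT α] (Y : ℕ → α) :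
    descents (fun i : Fin n => Y i) =
      ((Finset.range (n - 1)).filter fun i => Y (i + 1) < Y i).card := by
  unfold descents
  rw [← Finset.card_map Fin.valEmbedding]
  congr 1
  ext i
  simp only [Finset.mem_map, Finset.mem_filter, Finset.mem_univ, true_and, Finset.mem_range,
    Fin.valEmbedding_apply]
  constructor
  · rintro ⟨j, ⟨h1, h2⟩, rfl⟩
    exact ⟨by omega, h2⟩
  · rintro ⟨h1, h2⟩
    exact ⟨⟨i, by omega⟩, ⟨by simp only; omega, h2⟩, rfl⟩

/-- On the circle, a step of length less than `1` passes an integer exactly when the fractional part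
drops. -/
theorem floor_add_eq_ite {s t : ℝ} (ht : 0 ≤ t) (ht1 : t < 1) [Decidable (Int.fract (s + t) < Int.fract s)] :
    ⌊s + t⌋ = ⌊s⌋ + if Int.fract (s + t) < Int.fract s then 1 else 0 := by
  have h1 := Int.floor_add_fract s
  have h2 := Int.floor_add_fract (s + t)
  have h3 := Int.fract_nonneg s
  have h4 := Int.fract_lt_one s
  have h5 := Int.fract_nonneg (s + t)
  have h6 := Int.fract_lt_one (s + t)
  split_ifs with h
  · have hlt : (⌊s⌋ : ℝ) < ⌊s + t⌋ := by linarith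
    have hlt2 : (⌊s + t⌋ : ℝ) < ((⌊s⌋ + 2 : ℤ) : ℝ) := by push_cast; linarith
    have := Int.cast_lt.1 hlt
    have := Int.cast_lt.1 hlt2
    omega
  · rw [not_lt] at h
    have hlt : (⌊s + t⌋ : ℝ) < ((⌊s⌋ + 1 : ℤ) : ℝ) := by push_cast; linarith
    have := Int.cast_lt.1 hlt
    have : ⌊s⌋ ≤ ⌊s + t⌋ := Int.floor_le_floor (by linarith)
    omega

-- Induction with `floor_add_eq_ite`: each passage of an integer by the running sum is one descent
-- of its fractional part. The first term lies in `[0, 1)` and contributes nothing.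
open Classical in
theorem floor_sum_range_eq {f : ℕ → ℝ} (h0 : ∀ i, 0 ≤ f i) (h1 : ∀ i, f i < 1) (m : ℕ) :
    ⌊∑ i ∈ Finset.range (m + 1), f i⌋ =
      (((Finset.range m).filter fun i => Int.fract (∑ i ∈ Finset.range (i + 1 + 1), f i) <
        Int.fract (∑ i ∈ Finset.range (i + 1), f i)).card : ℤ) := by
  induction m with
  | zero => simp [Int.floor_eq_zero_iff, h0, h1]
  | succ m ih =>
    rw [Finset.sum_range_succ, floor_add_eq_ite (h0 _) (h1 _), ih, ← Finset.sum_range_succ,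
      Finset.card_filter, Finset.card_filter]
    push_cast
    exact (Finset.sum_range_succ _ m).symm

theorem floor_sum_eq_descents {m : ℕ} {x : Fin (m + 1) → ℝ} (hx : x ∈ cube (m + 1)) :
    ⌊∑ i, x i⌋ = (descents fun i => Int.fract (partialSums (m + 1) x i) : ℤ) := by
  classical
  rw [mem_cube] at hx
  -- Extension by zero to all of `ℕ` makes the induction on the number of terms available.
  let f : ℕ → ℝ := fun i => if h : i < m + 1 then x ⟨i, h⟩ else 0
  have hf0 : ∀ i, 0 ≤ f i := fun i => by
    simp only [f]; split_ifs
    exacts [(hx _).1, le_rfl]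
  have hf1 : ∀ i, f i < 1 := fun i => by
    simp only [f]; split_ifs
    exacts [(hx _).2, one_pos]
  have hfx : ∀ i : Fin (m + 1), f i = x i := fun i => dif_pos i.2
  have hsum : ∑ i, x i = ∑ i ∈ Finset.range (m + 1), f i := by
    rw [Finset.sum_range]
    exact Finset.sum_congr rfl fun i _ => (hfx i).symm
  have hps : ∀ i : Fin (m + 1), partialSums (m + 1) x i = ∑ j ∈ Finset.range (i + 1), f j :=
    fun i => by
      rw [partialSums_apply]
      refine Finset.sum_bij (fun j _ => j.1) ?_ ?_ ?_ ?_
      · intro j hj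
        have : j ≤ i := by simpa using hj
        have : j.1 ≤ i.1 := this
        simp; omega
      · intro a _ b _ h
        exact Fin.ext h
      · intro b hb
        have hb' := Finset.mem_range.1 hb
        refine ⟨⟨b, by omega⟩, ?_, rfl⟩
        simp only [Finset.mem_filter, Finset.mem_univ, true_and, Fin.le_def]
        omega
      · intro j _
        exact (hfx j).symm
  simp only [hps]
  rw [hsum, floor_sum_range_eq hf0 hf1 m,
    descents_eq_card_range (fun i => Int.fract (∑ j ∈ Finset.range (i + 1), f j))]
  rfl

theorem measurable_descents {n : ℕ} : Measurable fun y : Fin n → ℝ => descents y := by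
  classical
  unfold descents
  simp only [Finset.card_filter]
  refine Finset.measurable_sum _ fun i _ => ?_
  by_cases h : i.1 + 1 < n
  · simp only [h, exists_true_left]
    exact Measurable.ite (measurableSet_lt (measurable_pi_apply _) (measurable_pi_apply _))
      measurable_const measurable_const
  · simp [h]

/-- The basis of `ℤⁿ` that consists of the partial sums of the standard basis. -/
noncomputable def partialSumsBasis (n : ℕ) : Module.Basis (Fin n) ℝ (Fin n → ℝ) :=
  (Pi.basisFun ℝ (Fin n)).map (partialSums n)

/-- The partial sum matrix is integral and unitriangular: each entry is recovered from its partial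
sum by subtracting the earlier entries. -/
theorem span_partialSumsBasis (n : ℕ) :
    Submodule.span ℤ (Set.range (partialSumsBasis n)) =
      Submodule.span ℤ (Set.range (Pi.basisFun ℝ (Fin n))) := by
  ext v
  rw [Module.Basis.mem_span_iff_repr_mem, Module.Basis.mem_span_iff_repr_mem]
  obtain ⟨x, rfl⟩ := (partialSums n).surjective v
  have h1 : ∀ i, (partialSumsBasis n).repr (partialSums n x) i = x i := fun i => by
    simp [partialSumsBasis]
  simp only [h1, Pi.basisFun_repr, partialSums_apply]
  change (∀ i, x i ∈ (algebraMap ℤ ℝ).range) ↔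
    ∀ i, ∑ j with j ≤ i, x j ∈ (algebraMap ℤ ℝ).range
  refine ⟨fun h i => sum_mem fun j _ => h j, fun h i => ?_⟩
  induction i using WellFoundedLT.induction with
  | ind i ih =>
    have h2 : x i = ∑ j with j ≤ i, x j - ∑ j with j < i, x j := by
      have : (Finset.univ.filter fun j => j ≤ i) =
          insert i (Finset.univ.filter fun j => j < i) := by
        ext j; simp [le_iff_eq_or_lt]
      rw [this, Finset.sum_insert (by simp)]
      ring
    rw [h2]
    exact sub_mem (h i) (sum_mem fun j hj => ih j (by simpa using hj))

/-- The cube and its image under partial sums are fundamental domains of the same lattice `ℤⁿ`, and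
a set invariant under the lattice meets any two fundamental domains in the same volume. -/
theorem volume_inter_partialSums_cube {n : ℕ} {E : Set (Fin n → ℝ)} (hE : MeasurableSet E)
    (hinv : ∀ z ∈ Submodule.span ℤ (Set.range (Pi.basisFun ℝ (Fin n))), ∀ s, z + s ∈ E ↔ s ∈ E) :
    volume (E ∩ partialSums n '' cube n) = volume (E ∩ cube n) := by
  have h1 := ZSpan.isAddFundamentalDomain' (partialSumsBasis n) (volume : Measure (Fin n → ℝ))
  have h2 := ZSpan.isAddFundamentalDomain' (Pi.basisFun ℝ (Fin n)) (volume : Measure (Fin n → ℝ))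
  rw [span_partialSumsBasis] at h1
  have : Countable (Submodule.span ℤ (Set.range (Pi.basisFun ℝ (Fin n)))).toAddSubgroup :=
    inferInstanceAs (Countable (Submodule.span ℤ (Set.range (Pi.basisFun ℝ (Fin n)))))
  have h3 := h1.measure_set_eq h2 hE (fun g => by
    ext s
    exact hinv g.1 g.2 s)
  have h4 : ZSpan.fundamentalDomain (Pi.basisFun ℝ (Fin n)) = cube n :=
    ZSpan.fundamentalDomain_pi_basisFun
  have h5 : ZSpan.fundamentalDomain (partialSumsBasis n) = partialSums n '' cube n := by
    rw [← h4, ZSpan.map_fundamentalDomain]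
    rfl
  rwa [h4, h5] at h3

theorem volume_floor_sum_eq (n m : ℕ) :
    volume ({x : Fin (n + 1) → ℝ | ⌊∑ i, x i⌋ = (m : ℤ)} ∩ cube (n + 1)) =
      eulerianNumber (n + 1) m * ((n + 1).factorial : ENNReal)⁻¹ := by
  classical
  -- `E` depends only on fractional parts, so it is invariant under `ℤⁿ⁺¹`. The slice is the
  -- preimage of its part in the image of the cube, and that part may be traded for the part in the
  -- cube itself, where taking fractional parts does nothing.
  let E : Set (Fin (n + 1) → ℝ) := {s | descents (fun i => Int.fract (s i)) = m}
  have hE : MeasurableSet E := by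
    have : Measurable fun s : Fin (n + 1) → ℝ => descents (fun i => Int.fract (s i)) :=
      measurable_descents.comp (measurable_pi_lambda _ fun i =>
        measurable_fract.comp (measurable_pi_apply i))
    exact this (measurableSet_singleton m)
  have h1 : ({x : Fin (n + 1) → ℝ | ⌊∑ i, x i⌋ = (m : ℤ)} ∩ cube (n + 1) : Set _) =
      partialSums (n + 1) ⁻¹' (E ∩ partialSums (n + 1) '' cube (n + 1)) := by
    ext x
    simp only [Set.mem_inter_iff, Set.mem_preimage,
      (partialSums (n + 1)).injective.mem_set_image]
    refine and_congr_left fun hx => ?_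
    simp only [Set.mem_ofPred_eq, E, floor_sum_eq_descents hx, Nat.cast_inj]
  have h2 : E ∩ cube (n + 1) = {y | descents y = m} ∩ cube (n + 1) := by
    ext s
    refine and_congr_left fun hs => ?_
    rw [mem_cube] at hs
    have : (fun i => Int.fract (s i)) = s := by
      ext i
      exact Int.fract_eq_self.2 (hs i)
    simp only [E, Set.mem_ofPred_eq, this]
  rw [h1, volume_preimage_partialSums, volume_inter_partialSums_cube hE, h2,
    volume_cube_inter_eq_sum _ (Finset.univ.filter fun σ : Equiv.Perm (Fin (n + 1)) =>
      descents σ = m), volume_orderRegion_one, eulerianNumber_eq]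
  · intro σ y hy
    simp only [Finset.mem_filter, Finset.mem_univ, true_and, Set.mem_ofPred_eq]
    have : descents y = descents σ := by
      unfold descents
      exact congrArg Finset.card (by ext; simp [lt_iff_of_mem_orderRegion hy])
    rw [this]
  · intro z hz s
    rw [Module.Basis.mem_span_iff_repr_mem] at hz
    have : (fun i => Int.fract ((z + s) i)) = fun i => Int.fract (s i) := by
      ext i
      obtain ⟨k, hk⟩ := hz i
      simp only [Pi.basisFun_repr] at hk
      rw [Pi.add_apply, ← hk]
      exact Int.fract_intCast_add k (s i)
    simp only [E, Set.mem_ofPred_eq, this]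

/-- The volume of the slice `m ≤ ∑ xᵢ ≤ m + 1` of the unit cube. -/
theorem volume_cube_slice {ι : Type*} [Fintype ι] (hι : 0 < Fintype.card ι) (m : ℕ) :
    volume {x : ι → ℝ | (∀ i, 0 ≤ x i ∧ x i ≤ 1) ∧ (m : ℝ) ≤ ∑ i, x i ∧ ∑ i, x i ≤ m + 1} =
      eulerianNumber (Fintype.card ι) m * ((Fintype.card ι).factorial : ENNReal)⁻¹ := by
  obtain ⟨n, hn⟩ := Nat.exists_eq_succ_of_ne_zero hι.ne'
  have e : ι ≃ Fin (n + 1) := Fintype.equivFinOfCardEq hn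
  rw [hn, ← Nat.add_one, ← volume_floor_sum_eq, ← volume_preimage_comp_equiv e]
  refine measure_congr ?_
  -- The closed slice and the half-open one differ only where some coordinate is `1` or the sum is
  -- `m + 1`, a null set.
  have h1 : ∀ᵐ x : Fin (n + 1) → ℝ, ∀ i, x i ≠ 1 := by
    rw [ae_all_iff]
    intro i
    have := volume_linear_level_eq_zero (LinearMap.proj (R := ℝ) (φ := fun _ : Fin (n + 1) => ℝ) i)
      (fun h => by simpa using LinearMap.congr_fun h (Pi.single i (1 : ℝ))) 1
    rw [ae_iff]
    simpa using this
  have h2 : ∀ᵐ x : Fin (n + 1) → ℝ, ∑ i, x i ≠ m + 1 := by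
    have := volume_linear_level_eq_zero
      (∑ i, LinearMap.proj (R := ℝ) (φ := fun _ : Fin (n + 1) => ℝ) i)
      (fun h => by simpa using LinearMap.congr_fun h (Pi.single 0 (1 : ℝ))) (m + 1)
    rw [ae_iff]
    simpa using this
  have h3 : ({x : Fin (n + 1) → ℝ | (fun j => x (e j)) ∈ {x : ι → ℝ |
      (∀ i, 0 ≤ x i ∧ x i ≤ 1) ∧ (m : ℝ) ≤ ∑ i, x i ∧ ∑ i, x i ≤ m + 1}} : Set _) =ᵐ[volume]
      ({x : Fin (n + 1) → ℝ | ⌊∑ i, x i⌋ = (m : ℤ)} ∩ cube (n + 1) : Set _) := by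
    filter_upwards [h1, h2] with x hx1 hx2
    apply propext
    change (((∀ i, 0 ≤ x (e i) ∧ x (e i) ≤ 1) ∧ (m : ℝ) ≤ ∑ i, x (e i) ∧ ∑ i, x (e i) ≤ m + 1) ↔
      (⌊∑ i, x i⌋ = (m : ℤ) ∧ x ∈ cube (n + 1)))
    rw [e.sum_comp, mem_cube, Int.floor_eq_iff, and_comm]
    refine and_congr (and_congr Iff.rfl ?_) ?_
    · simp only [Int.cast_natCast]
      exact ⟨fun h => lt_of_le_of_ne h hx2, le_of_lt⟩
    · exact ⟨fun h i => ⟨by simpa using (h (e.symm i)).1,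
        lt_of_le_of_ne (by simpa using (h (e.symm i)).2) (hx1 i)⟩,
        fun h i => ⟨(h _).1, (h _).2.le⟩⟩
  exact h3

/-! ### Simplices and pyramids over products of simplices -/

theorem partialSums_succ {n : ℕ} (x : Fin (n + 1) → ℝ) (i : Fin n) :
    partialSums (n + 1) x i.succ = partialSums (n + 1) x i.castSucc + x i.succ := by
  have h : (Finset.univ.filter fun j : Fin (n + 1) => j ≤ i.succ) =
      insert i.succ (Finset.univ.filter fun j => j ≤ i.castSucc) := by
    ext j
    simp only [Finset.mem_filter, Finset.mem_univ, true_and, Finset.mem_insert, Fin.le_def,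
      Fin.ext_iff, Fin.val_succ, Fin.val_castSucc]
    omega
  rw [partialSums_apply, h, Finset.sum_insert (by simp [Fin.le_def]), partialSums_apply, add_comm]

/-- Partial sums preserve volume and carry the simplex, up to a null set, to the region of
increasing coordinates, which is one of the `n!` congruent pieces of the cube. -/
theorem volume_simplex_fin (n : ℕ) :
    volume {x : Fin n → ℝ | (∀ i, 0 ≤ x i) ∧ ∑ i, x i < 1} = (n.factorial : ENNReal)⁻¹ := by
  rcases n with _ | n
  · have : {x : Fin 0 → ℝ | (∀ i, 0 ≤ x i) ∧ ∑ i, x i < 1} = cube 0 := by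
      ext; simp [mem_cube]
    rw [this, volume_cube]; simp
  rw [← volume_orderRegion_one, ← volume_preimage_partialSums (orderRegion 1)]
  have hinj : ∀ᵐ x : Fin (n + 1) → ℝ, Function.Injective (partialSums (n + 1) x) := by
    rw [ae_iff]
    have := ae_injective (n + 1)
    rw [ae_iff] at this
    rwa [← volume_preimage_partialSums] at this
  have h0 : ∀ x : Fin (n + 1) → ℝ, partialSums (n + 1) x 0 = x 0 := fun x => by
    simp [partialSums_apply, Finset.filter_eq']
  have hl : ∀ x : Fin (n + 1) → ℝ, partialSums (n + 1) x (Fin.last n) = ∑ i, x i := fun x => by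
    simp [partialSums_apply, Fin.le_last]
  have h3 : ({x : Fin (n + 1) → ℝ | (∀ i, 0 ≤ x i) ∧ ∑ i, x i < 1} : Set _) =ᵐ[volume]
      (partialSums (n + 1) ⁻¹' orderRegion 1 : Set _) := by
    filter_upwards [hinj] with x hx
    apply propext
    change ((∀ i, 0 ≤ x i) ∧ ∑ i, x i < 1) ↔ (partialSums (n + 1) x ∈ cube (n + 1) ∧
      ∀ i j, i < j → partialSums (n + 1) x i < partialSums (n + 1) x j)
    rw [mem_cube]
    constructor
    · rintro ⟨hx0, hx1⟩
      have hm : Monotone (partialSums (n + 1) x) := Fin.monotone_iff_le_succ.2 fun i => by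
        rw [partialSums_succ]
        linarith [hx0 i.succ]
      refine ⟨fun i => ⟨?_, ?_⟩, fun i j hij => hm.strictMono_of_injective hx hij⟩
      · exact (hx0 0).trans ((h0 x).symm.le.trans (hm (Fin.zero_le i)))
      · exact (hm (Fin.le_last i)).trans_lt ((hl x).trans_lt hx1)
    · rintro ⟨hc, hm⟩
      refine ⟨fun i => ?_, hl x ▸ (hc _).2⟩
      refine Fin.cases ?_ (fun i => ?_) i
      · exact (h0 x) ▸ (hc 0).1
      · have := hm _ _ (Fin.castSucc_lt_succ (i := i))
        rw [partialSums_succ] at this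
        linarith
  exact measure_congr h3

theorem volume_simplex (ι : Type*) [Fintype ι] :
    volume {x : ι → ℝ | (∀ i, 0 ≤ x i) ∧ ∑ i, x i < 1} =
      ((Fintype.card ι).factorial : ENNReal)⁻¹ := by
  have e := Fintype.equivFin ι
  rw [← volume_simplex_fin, ← volume_preimage_comp_equiv e]
  congr 1
  ext x
  simp only [Set.mem_ofPred_eq, e.sum_comp, e.forall_congr_left, Equiv.apply_symm_apply]

theorem volume_sum_level_eq_zero (ι : Type*) [Fintype ι] [Nonempty ι] (t : ℝ) :
    volume {x : ι → ℝ | ∑ i, x i = t} = 0 := by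
  classical
  have := volume_linear_level_eq_zero
    (∑ i, LinearMap.proj (R := ℝ) (φ := fun _ : ι => ℝ) i)
    (fun h => by
      simpa using LinearMap.congr_fun h (Pi.single (Classical.arbitrary ι) (1 : ℝ))) t
  simpa using this

theorem volume_simplex_le (ι : Type*) [Fintype ι] {t : ℝ} (ht : 0 < t) :
    volume {x : ι → ℝ | (∀ i, 0 ≤ x i) ∧ ∑ i, x i ≤ t} =
      ENNReal.ofReal (t ^ Fintype.card ι / (Fintype.card ι).factorial) := by
  have h1 : volume {x : ι → ℝ | (∀ i, 0 ≤ x i) ∧ ∑ i, x i ≤ 1} =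
      ((Fintype.card ι).factorial : ENNReal)⁻¹ := by
    rw [← volume_simplex]
    rcases isEmpty_or_nonempty ι with h | h
    · simp
    have hne : ∀ᵐ x : ι → ℝ, ∑ i, x i ≠ 1 := by
      rw [ae_iff]
      simpa using volume_sum_level_eq_zero ι 1
    have h3 : ({x : ι → ℝ | (∀ i, 0 ≤ x i) ∧ ∑ i, x i ≤ 1} : Set _) =ᵐ[volume]
        ({x : ι → ℝ | (∀ i, 0 ≤ x i) ∧ ∑ i, x i < 1} : Set _) := by
      filter_upwards [hne] with x hx
      exact propext (and_congr_right fun _ => ⟨fun h => lt_of_le_of_ne h hx, le_of_lt⟩)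
    exact measure_congr h3
  -- The simplex of size `t` is the dilate by `t` of the unit simplex, hence the factor `t ^
  -- Fintype.card ι`.
  have h2 := Measure.addHaar_preimage_smul (volume : Measure (ι → ℝ)) (inv_ne_zero ht.ne')
    {x : ι → ℝ | (∀ i, 0 ≤ x i) ∧ ∑ i, x i ≤ 1}
  have h4 : (fun x : ι → ℝ => t⁻¹ • x) ⁻¹' {x : ι → ℝ | (∀ i, 0 ≤ x i) ∧ ∑ i, x i ≤ 1} =
      {x : ι → ℝ | (∀ i, 0 ≤ x i) ∧ ∑ i, x i ≤ t} := by
    ext x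
    simp only [Set.mem_preimage, Set.mem_ofPred_eq, Pi.smul_apply, smul_eq_mul, ← Finset.mul_sum]
    refine and_congr (forall_congr' fun i => ?_) ?_
    · rw [mul_nonneg_iff_of_pos_left (inv_pos.2 ht)]
    · rw [inv_mul_le_iff₀ ht, mul_one]
  rw [h4, h1, Module.finrank_fintype_fun_eq_card, inv_pow, inv_inv, abs_of_pos (pow_pos ht _)] at h2
  rw [h2, div_eq_mul_inv, ENNReal.ofReal_mul (by positivity), ENNReal.ofReal_inv_of_pos
    (by positivity), ENNReal.ofReal_natCast]

theorem lintegral_Ioc_mul_pow {c m : ℝ} (hc : 0 ≤ c) (hm : 0 ≤ m) (n : ℕ) :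
    ∫⁻ t in Set.Ioc 0 m, ENNReal.ofReal (c * t ^ n) =
      ENNReal.ofReal (c * (m ^ (n + 1) / (n + 1))) := by
  rw [← ofReal_integral_eq_lintegral_ofReal]
  · rw [← intervalIntegral.integral_of_le hm, intervalIntegral.integral_const_mul, integral_pow]
    simp
  · exact ((continuous_const.mul (continuous_pow n)).integrableOn_Ioc)
  · filter_upwards [ae_restrict_mem measurableSet_Ioc] with t ht
    exact mul_nonneg hc (pow_nonneg ht.1.le _)

theorem measurableSet_simplex (ι : Type*) [Fintype ι] :
    MeasurableSet {y : ι → ℝ | (∀ i, 0 ≤ y i) ∧ ∑ i, y i < 1} :=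
  (isClosed_Ici (a := (0 : ι → ℝ))).measurableSet.inter
    (measurableSet_lt (Finset.measurable_sum _ fun i _ => measurable_pi_apply i) measurable_const)

/-- The distribution of the coordinate sum over the unit simplex. -/
theorem map_sum_volume_simplex (ι : Type*) [Fintype ι] {q : ℕ} (hq : Fintype.card ι = q + 1) :
    (volume.restrict {y : ι → ℝ | (∀ i, 0 ≤ y i) ∧ ∑ i, y i < 1}).map (fun y => ∑ i, y i) =
      (volume.restrict (Set.Ioc (0 : ℝ) 1)).withDensity fun t =>
        ENNReal.ofReal ((q.factorial : ℝ)⁻¹ * t ^ q) := by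
  have hfac : ∀ m : ℝ, (q.factorial : ℝ)⁻¹ * (m ^ (q + 1) / (q + 1)) =
      m ^ (q + 1) / (q + 1).factorial := fun m => by
    rw [Nat.factorial_succ]; push_cast; field_simp
  have hmeas : Measurable fun y : ι → ℝ => ∑ i, y i :=
    Finset.measurable_sum _ fun i _ => measurable_pi_apply i
  have hvol := volume_simplex ι
  have hfin : IsFiniteMeasure
      ((volume.restrict {y : ι → ℝ | (∀ i, 0 ≤ y i) ∧ ∑ i, y i < 1}).map (fun y => ∑ i, y i)) := by
    refine ⟨?_⟩
    rw [Measure.map_apply hmeas MeasurableSet.univ, Set.preimage_univ,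
      Measure.restrict_apply_univ, hvol]
    exact ENNReal.inv_lt_top.2 (by exact_mod_cast Nat.factorial_pos _)
  -- Finite measures on the line are compared on half-lines. The preimage of `Iic a` is null for `a
  -- ≤ 0`, a dilated simplex for `0 < a < 1`, and the whole unit simplex for `a ≥ 1`.
  refine Measure.ext_of_Iic _ _ fun a => ?_
  rw [Measure.map_apply hmeas measurableSet_Iic, Measure.restrict_apply (hmeas measurableSet_Iic),
    withDensity_apply _ measurableSet_Iic, Measure.restrict_restrict measurableSet_Iic]
  have hpos : ∀ y : ι → ℝ, (∀ i, 0 ≤ y i) → 0 ≤ ∑ i, y i := fun y hy =>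
    Finset.sum_nonneg fun i _ => hy i
  rcases le_or_gt a 0 with ha | ha
  · have h1 : Set.Iic a ∩ Set.Ioc 0 1 = ∅ := by
      ext t; simp only [Set.mem_inter_iff, Set.mem_Iic, Set.mem_Ioc, Set.mem_empty_iff_false]
      constructor
      · rintro ⟨h1, h2, h3⟩; linarith
      · exact False.elim
    rw [h1, Measure.restrict_empty, lintegral_zero_measure]
    have : Nonempty ι := Fintype.card_pos_iff.1 (by omega)
    refine measure_mono_null ?_ (volume_sum_level_eq_zero ι 0)
    rintro y ⟨h1, h2, -⟩
    exact le_antisymm (le_trans h1 ha) (hpos y h2)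
  rcases lt_or_ge a 1 with ha1 | ha1
  · have h1 : Set.Iic a ∩ Set.Ioc 0 1 = Set.Ioc 0 a := by
      ext t; simp only [Set.mem_inter_iff, Set.mem_Iic, Set.mem_Ioc]
      constructor
      · rintro ⟨h1, h2, h3⟩; exact ⟨h2, h1⟩
      · rintro ⟨h1, h2⟩; exact ⟨h2, h1, by linarith⟩
    rw [h1, lintegral_Ioc_mul_pow (by positivity) ha.le, hfac, ← hq, ← volume_simplex_le ι ha]
    congr 1
    ext y
    constructor
    · rintro ⟨h1, h2, -⟩
      exact ⟨h2, h1⟩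
    · rintro ⟨h1, h2⟩
      exact ⟨h2, h1, lt_of_le_of_lt h2 ha1⟩
  · have h1 : Set.Iic a ∩ Set.Ioc 0 1 = Set.Ioc 0 1 :=
      Set.inter_eq_right.2 fun t ht => ht.2.trans ha1
    have h2 : (fun y : ι → ℝ => ∑ i, y i) ⁻¹' Set.Iic a ∩
        {y : ι → ℝ | (∀ i, 0 ≤ y i) ∧ ∑ i, y i < 1} =
        {y : ι → ℝ | (∀ i, 0 ≤ y i) ∧ ∑ i, y i < 1} :=
      Set.inter_eq_right.2 fun t ht => (ht.2.le.trans ha1)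
    rw [h1, h2, hvol, lintegral_Ioc_mul_pow (by positivity) zero_le_one, hfac, one_pow, one_div,
      ENNReal.ofReal_inv_of_pos (by positivity), ENNReal.ofReal_natCast, hq]

/-- Fubini: over a point `y` with coordinate sum `s`, the section is a simplex of size `s`, of
volume `s ^ p / p!`. The sum has density `s ^ q / q!` on the unit simplex, so the volume is the
integral of `s ^ (p + q) / (p! q!)` over `(0, 1]`. -/
theorem volume_pyramid_prod (α β : Type*) [Fintype α] [Fintype β] {p q : ℕ}
    (hp : Fintype.card α = p) (hq : Fintype.card β = q + 1) :
    volume {z : (α → ℝ) × (β → ℝ) | ((∀ i, 0 ≤ z.1 i) ∧ ∀ j, 0 ≤ z.2 j) ∧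
      ∑ i, z.1 i ≤ ∑ j, z.2 j ∧ ∑ j, z.2 j < 1} =
      ENNReal.ofReal ((p.factorial : ℝ)⁻¹ * (q.factorial : ℝ)⁻¹ * (1 / (p + q + 1))) := by
  have hsα : Measurable fun y : α → ℝ => ∑ i, y i :=
    Finset.measurable_sum _ fun i _ => measurable_pi_apply i
  have hsβ : Measurable fun y : β → ℝ => ∑ i, y i :=
    Finset.measurable_sum _ fun i _ => measurable_pi_apply i
  have hS : MeasurableSet {z : (α → ℝ) × (β → ℝ) | ((∀ i, 0 ≤ z.1 i) ∧ ∀ j, 0 ≤ z.2 j) ∧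
      ∑ i, z.1 i ≤ ∑ j, z.2 j ∧ ∑ j, z.2 j < 1} :=
    ((measurable_fst (isClosed_Ici (a := (0 : α → ℝ))).measurableSet).inter
      (measurable_snd (isClosed_Ici (a := (0 : β → ℝ))).measurableSet)).inter
      ((measurableSet_le (hsα.comp measurable_fst) (hsβ.comp measurable_snd)).inter
        (measurableSet_lt (hsβ.comp measurable_snd) measurable_const))
  have : Nonempty β := Fintype.card_pos_iff.1 (by omega)
  -- `volume_simplex_le` requires a positive size, so the null set of sum zero is discarded.
  have hne : ∀ᵐ y : β → ℝ, ∑ i, y i ≠ 0 := by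
    rw [ae_iff]
    simpa using volume_sum_level_eq_zero β 0
  have hg : Measurable fun t : ℝ => ENNReal.ofReal (t ^ p / p.factorial) :=
    ENNReal.measurable_ofReal.comp ((measurable_id.pow_const p).div_const _)
  have hh : Measurable fun t : ℝ => ENNReal.ofReal ((q.factorial : ℝ)⁻¹ * t ^ q) :=
    ENNReal.measurable_ofReal.comp ((measurable_id.pow_const q).const_mul _)
  rw [Measure.volume_eq_prod, Measure.prod_apply_symm hS]
  have h1 : ∀ᵐ y : β → ℝ, volume ((fun x => (x, y)) ⁻¹'
      {z : (α → ℝ) × (β → ℝ) | ((∀ i, 0 ≤ z.1 i) ∧ ∀ j, 0 ≤ z.2 j) ∧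
        ∑ i, z.1 i ≤ ∑ j, z.2 j ∧ ∑ j, z.2 j < 1}) =
      Set.indicator {y : β → ℝ | (∀ i, 0 ≤ y i) ∧ ∑ i, y i < 1}
        (fun y => ENNReal.ofReal ((∑ i, y i) ^ p / p.factorial)) y := by
    filter_upwards [hne] with y hy
    by_cases hY : y ∈ {y : β → ℝ | (∀ i, 0 ≤ y i) ∧ ∑ i, y i < 1}
    · rw [Set.indicator_of_mem hY, ← hp, ← volume_simplex_le α
        (lt_of_le_of_ne (Finset.sum_nonneg fun i _ => hY.1 i) hy.symm)]
      congr 1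
      ext x
      exact ⟨fun h => ⟨h.1.1, h.2.1⟩, fun h => ⟨⟨h.1, hY.1⟩, h.2, hY.2⟩⟩
    · rw [Set.indicator_of_notMem hY]
      convert measure_empty (μ := (volume : Measure (α → ℝ)))
      ext x
      simp only [Set.mem_empty_iff_false, iff_false]
      exact fun h => hY ⟨h.1.2, h.2.2⟩
  rw [lintegral_congr_ae h1, lintegral_indicator (measurableSet_simplex β),
    ← lintegral_map (f := fun t : ℝ => ENNReal.ofReal (t ^ p / p.factorial)) hg hsβ,
    map_sum_volume_simplex β hq, lintegral_withDensity_eq_lintegral_mul _ hh hg]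
  have h2 : ∀ t ∈ Set.Ioc (0 : ℝ) 1, ((fun t : ℝ => ENNReal.ofReal ((q.factorial : ℝ)⁻¹ * t ^ q)) *
      fun t => ENNReal.ofReal (t ^ p / p.factorial)) t =
      ENNReal.ofReal ((p.factorial : ℝ)⁻¹ * (q.factorial : ℝ)⁻¹ * t ^ (p + q)) := by
    intro t ht
    have := ht.1.le
    rw [Pi.mul_apply, ← ENNReal.ofReal_mul (by positivity)]
    congr 1
    field_simp
    ring
  rw [setLIntegral_congr_fun measurableSet_Ioc h2,
    lintegral_Ioc_mul_pow (by positivity) zero_le_one]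
  push_cast
  simp

/-- The normalized volume of a pyramid over a product of simplices. -/
theorem volume_pyramid {ι : Type*} [Fintype ι] [DecidableEq ι] (A : Finset ι) {q : ℕ}
    (hq : Aᶜ.card = q + 1) :
    ((Fintype.card ι).factorial : ℝ) * (volume {c : ι → ℝ | (∀ i, 0 ≤ c i) ∧
      ∑ i ∈ A, c i ≤ ∑ i ∈ Aᶜ, c i ∧ ∑ i ∈ Aᶜ, c i < 1}).toReal = ((A.card + q).choose q : ℝ) := by
  let _ : Fintype {i // i ∈ A} := Subtype.fintype fun i => i ∈ A
  have h1 := (volume_preserving_piEquivPiSubtypeProd (fun _ : ι => ℝ) (· ∈ A)).measure_preimage_equiv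
    {z : ({i // i ∈ A} → ℝ) × ({i // i ∉ A} → ℝ) | ((∀ i, 0 ≤ z.1 i) ∧ ∀ j, 0 ≤ z.2 j) ∧
      ∑ i, z.1 i ≤ ∑ j, z.2 j ∧ ∑ j, z.2 j < 1}
  replace h1 := h1.trans (volume_pyramid_prod {i // i ∈ A} {i // i ∉ A} (p := A.card) (q := q)
    (by simp) (by rw [Fintype.card_subtype_compl, ← hq, Finset.card_compl]; simp))
  have h2 : (MeasurableEquiv.piEquivPiSubtypeProd (fun _ : ι => ℝ) (· ∈ A)) ⁻¹'
      {z : ({i // i ∈ A} → ℝ) × ({i // i ∉ A} → ℝ) | ((∀ i, 0 ≤ z.1 i) ∧ ∀ j, 0 ≤ z.2 j) ∧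
      ∑ i, z.1 i ≤ ∑ j, z.2 j ∧ ∑ j, z.2 j < 1} = {c : ι → ℝ | (∀ i, 0 ≤ c i) ∧
      ∑ i ∈ A, c i ≤ ∑ i ∈ Aᶜ, c i ∧ ∑ i ∈ Aᶜ, c i < 1} := by
    ext c
    have hA : ∑ i : {i // i ∈ A}, c i = ∑ i ∈ A, c i := (Finset.sum_subtype A (by simp) c).symm
    have hB : ∑ i : {i // i ∉ A}, c i = ∑ i ∈ Aᶜ, c i :=
      (Finset.sum_subtype Aᶜ (by simp) c).symm
    change (((∀ i : {i // i ∈ A}, 0 ≤ c i) ∧ ∀ i : {i // i ∉ A}, 0 ≤ c i) ∧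
      ∑ i : {i // i ∈ A}, c i ≤ ∑ i : {i // i ∉ A}, c i ∧ ∑ i : {i // i ∉ A}, c i < 1) ↔
      ((∀ i, 0 ≤ c i) ∧ ∑ i ∈ A, c i ≤ ∑ i ∈ Aᶜ, c i ∧ ∑ i ∈ Aᶜ, c i < 1)
    rw [hA, hB]
    refine and_congr_left fun _ => ⟨fun h i => ?_, fun h => ⟨fun i => h i, fun i => h i⟩⟩
    by_cases hi : i ∈ A
    exacts [h.1 ⟨i, hi⟩, h.2 ⟨i, hi⟩]
  rw [h2] at h1
  have hcard : Fintype.card ι = A.card + q + 1 := by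
    have := A.card_add_card_compl
    omega
  rw [h1, ENNReal.toReal_ofReal (by positivity), hcard, Nat.factorial_succ,
    ← Nat.add_choose_mul_factorial_mul_factorial A.card q]
  push_cast
  have : (A.card.factorial : ℝ) ≠ 0 := by positivity
  have : (q.factorial : ℝ) ≠ 0 := by positivity
  field_simp

/-! ### An alternating sum of binomial coefficients -/

/-- Differencing lowers the lower index of a binomial coefficient, and `a.choose (a - n) = a.choose
n`. For `n > a` the iterated difference has passed through a constant and vanishes, as does the
right side. -/
theorem fwdDiff_iter_choose_self (a n : ℕ) :
    (fwdDiff (1 : ℕ))^[n] (fun x ↦ (x.choose a : ℤ)) a = (a.choose n : ℤ) := by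
  rcases le_or_gt n a with h | h
  · obtain ⟨j, rfl⟩ := Nat.exists_eq_add_of_le h
    rw [fwdDiff_iter_choose, Nat.choose_symm_add]
  · obtain ⟨j, rfl⟩ := Nat.exists_eq_add_of_lt h
    rw [show a + j + 1 = (j + 1) + a by ring, Function.iterate_add_apply]
    have h1 := fwdDiff_iter_choose 0 a
    simp only [add_zero] at h1
    rw [h1, Nat.choose_eq_zero_of_lt (by omega), Function.iterate_succ_apply]
    simp only [Nat.choose_zero_right]
    rw [fwdDiff_const]
    have : (fun _ : ℕ => (0 : ℤ)) = (0 : ℤ) • fun _ => 0 := by funext; simp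
    rw [this, fwdDiff_iter_const_smul, zero_smul]
    rfl

/-- This is the expansion of the iterated difference above into shifts, with the sign `(-1) ^ n`
moved to the other side. -/
theorem sum_neg_one_pow_mul_choose_mul_choose (n a : ℕ) :
    ∑ b ∈ Finset.range (n + 1), (-1 : ℤ) ^ b * n.choose b * (a + b).choose a =
      (-1) ^ n * a.choose n := by
  rw [← fwdDiff_iter_choose_self, fwdDiff_iter_eq_sum_shift, Finset.mul_sum]
  refine Finset.sum_congr rfl fun b hb => ?_
  have : (-1 : ℤ) ^ n = (-1) ^ (n - b) * (-1) ^ b := by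
    rw [← pow_add, Nat.sub_add_cancel (Nat.lt_succ_iff.1 (Finset.mem_range.1 hb))]
  have h1 : ((-1 : ℤ) ^ (n - b)) * (-1) ^ (n - b) = 1 := by
    rw [← mul_pow]; simp
  simp only [smul_eq_mul, mul_one, this]
  linear_combination (-(-1 : ℤ) ^ b * n.choose b * (a + b).choose a) * h1

/-- By Pascal's rule, raising `n` by one adds `(-1) ^ n * a.choose n`. Hence the sum is the
alternating sum of row `a` of Pascal's triangle up to column `n - 1`; for `a < n` the row is
complete, and its sum vanishes unless `a = 0`. -/
theorem sum_neg_one_pow_mul_choose_succ_mul_choose {n a : ℕ} (h : a < n) :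
    ∑ b ∈ Finset.range n, (-1 : ℤ) ^ b * n.choose (b + 1) * (a + b).choose a =
      if a = 0 then 1 else 0 := by
  have key : ∀ n : ℕ, ∑ b ∈ Finset.range n, (-1 : ℤ) ^ b * n.choose (b + 1) * (a + b).choose a =
      ∑ m ∈ Finset.range n, (-1 : ℤ) ^ m * a.choose m := fun n => by
    induction n with
    | zero => simp
    | succ n ih =>
      rw [Finset.sum_range_succ (fun m => (-1 : ℤ) ^ m * (a.choose m : ℤ)), ← ih,
        ← sum_neg_one_pow_mul_choose_mul_choose]
      have h2 : ∑ b ∈ Finset.range n, (-1 : ℤ) ^ b * n.choose (b + 1) * (a + b).choose a =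
          ∑ b ∈ Finset.range (n + 1), (-1 : ℤ) ^ b * n.choose (b + 1) * (a + b).choose a := by
        rw [Finset.sum_range_succ]; simp
      rw [h2, ← Finset.sum_add_distrib]
      refine Finset.sum_congr rfl fun b _ => ?_
      rw [Nat.choose_succ_succ]
      push_cast
      ring
  rw [key, ← Int.alternating_sum_range_choose]
  refine (Finset.sum_subset (Finset.range_mono h) fun m _ hm => ?_).symm
  rw [Nat.choose_eq_zero_of_lt (by simpa using hm)]
  simp

/-- By symmetry `k ≤ n`. Then every `a < k` is less than `n`, so the inner sum kills all `a > 0`,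
and `a = 0` contributes `k.choose 1`. -/
theorem sum_sum_choose_eq_min (k n : ℕ) :
    ∑ a ∈ Finset.range k, ∑ b ∈ Finset.range n,
      (-1 : ℤ) ^ (a + b) * k.choose (a + 1) * n.choose (b + 1) * (a + b).choose a = (min k n : ℕ) := by
  wlog h : k ≤ n generalizing k n
  · rw [min_comm, ← this n k (by omega), Finset.sum_comm]
    refine Finset.sum_congr rfl fun a _ => Finset.sum_congr rfl fun b _ => ?_
    rw [add_comm b a, Nat.choose_symm_add]
    ring
  rw [min_eq_left h]
  have h1 : ∀ a ∈ Finset.range k, ∑ b ∈ Finset.range n,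
      (-1 : ℤ) ^ (a + b) * k.choose (a + 1) * n.choose (b + 1) * (a + b).choose a =
      if a = 0 then (k : ℤ) else 0 := fun a ha => by
    have h2 := sum_neg_one_pow_mul_choose_succ_mul_choose (n := n) (a := a)
      ((Finset.mem_range.1 ha).trans_le h)
    have h3 : ∑ b ∈ Finset.range n,
        (-1 : ℤ) ^ (a + b) * k.choose (a + 1) * n.choose (b + 1) * (a + b).choose a =
        ((-1) ^ a * k.choose (a + 1)) * ∑ b ∈ Finset.range n,
          (-1 : ℤ) ^ b * n.choose (b + 1) * (a + b).choose a := by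
      rw [Finset.mul_sum]
      refine Finset.sum_congr rfl fun b _ => ?_
      rw [pow_add]; ring
    rw [h3, h2]
    split_ifs with h0
    · simp [h0]
    · simp
  rw [Finset.sum_congr rfl h1]
  rcases k with _ | k <;> simp

/-- The sum over pairs of nonempty subsets that computes the Euler obstruction of a vertex. -/
theorem sum_powerset_powerset_choose {α : Type*} [DecidableEq α] (S T : Finset α) :
    ∑ A ∈ S.powerset with A.Nonempty, ∑ B ∈ T.powerset with B.Nonempty,
      (-1 : ℝ) ^ (A.card + B.card - 2) * ((A.card - 1 + (B.card - 1)).choose (A.card - 1) : ℝ) =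
      (min S.card T.card : ℕ) := by
  have h1 : ∀ (S : Finset α) (f : ℕ → ℝ), ∑ A ∈ S.powerset with A.Nonempty, f (A.card - 1) =
      ∑ a ∈ Finset.range S.card, (S.card.choose (a + 1) : ℝ) * f a := fun S f => by
    have h2 := Finset.sum_powerset_apply_card (fun m => if m = 0 then 0 else f (m - 1)) (x := S)
    rw [Finset.sum_range_succ'] at h2
    simp only [Nat.add_eq_zero_iff, one_ne_zero, and_false, if_false, Nat.add_sub_cancel,
      nsmul_eq_mul, if_true, mul_zero, add_zero] at h2
    rw [← h2, Finset.sum_filter]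
    refine Finset.sum_congr rfl fun A _ => ?_
    by_cases hA : A.Nonempty
    · simp [hA, hA.ne_empty]
    · simp [Finset.not_nonempty_iff_eq_empty.1 hA]
  have h3 : ∀ A ∈ S.powerset.filter (·.Nonempty), ∑ B ∈ T.powerset with B.Nonempty,
      (-1 : ℝ) ^ (A.card + B.card - 2) * ((A.card - 1 + (B.card - 1)).choose (A.card - 1) : ℝ) =
      (fun a => ∑ b ∈ Finset.range T.card, (T.card.choose (b + 1) : ℝ) *
        ((-1 : ℝ) ^ (a + b) * ((a + b).choose a : ℝ))) (A.card - 1) := fun A hA => by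
    have hA' : 0 < A.card := Finset.card_pos.2 (Finset.mem_filter.1 hA).2
    beta_reduce
    rw [← h1 T (fun b => (-1 : ℝ) ^ (A.card - 1 + b) * ((A.card - 1 + b).choose (A.card - 1) : ℝ))]
    refine Finset.sum_congr rfl fun B hB => ?_
    have hB' : 0 < B.card := Finset.card_pos.2 (Finset.mem_filter.1 hB).2
    rw [show A.card + B.card - 2 = A.card - 1 + (B.card - 1) by omega]
  rw [Finset.sum_congr rfl h3, h1 S (fun a => ∑ b ∈ Finset.range T.card,
    (T.card.choose (b + 1) : ℝ) * ((-1 : ℝ) ^ (a + b) * ((a + b).choose a : ℝ)))]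
  have h4 := sum_sum_choose_eq_min S.card T.card
  have h5 := congrArg (Int.cast (R := ℝ)) h4
  push_cast at h5 ⊢
  rw [← h5]
  refine Finset.sum_congr rfl fun a _ => ?_
  rw [Finset.mul_sum]
  refine Finset.sum_congr rfl fun b _ => ?_
  ring

/-! ### The hypersimplex and its faces -/

/-- The indicator vector of a finite set. -/
noncomputable def indicatorVector {d : ℕ} (s : Finset (Fin d)) : Fin d → ℝ := fun j => if j ∈ s then 1 else 0

theorem column_hypersimplexMatrix {d k : ℕ} (s : {s : Finset (Fin d) // s.card = k}) :
    column (hypersimplexMatrix d k) s = indicatorVector s.1 := by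
  ext j
  simp [column, hypersimplexMatrix, indicatorVector]

theorem sum_indicatorVector {d : ℕ} (s : Finset (Fin d)) : ∑ i, indicatorVector s i = s.card := by
  simp [indicatorVector]

theorem indicatorVector_nonneg {d : ℕ} (s : Finset (Fin d)) (i : Fin d) :
    0 ≤ indicatorVector s i := by
  unfold indicatorVector; split_ifs <;> simp

theorem indicatorVector_le_one {d : ℕ} (s : Finset (Fin d)) (i : Fin d) :
    indicatorVector s i ≤ 1 := by
  unfold indicatorVector; split_ifs <;> simp

/-- The coordinate sum is an integer, so a fractional coordinate forces a second one. Mass can then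
be moved between the two in both directions, which exhibits the point as a midpoint. -/
theorem eq_one_or_eq_zero_of_mem_extremePoints {d k : ℕ} {x : Fin d → ℝ}
    (hx : x ∈ Set.extremePoints ℝ {x : Fin d → ℝ | (∀ i, 0 ≤ x i ∧ x i ≤ 1) ∧ ∑ i, x i = k})
    (i : Fin d) : x i = 0 ∨ x i = 1 := by
  obtain ⟨⟨hx1, hx2⟩, hext⟩ := hx
  by_contra hi
  push Not at hi
  have hj : ∃ j, j ≠ i ∧ x j ≠ 0 ∧ x j ≠ 1 := by
    by_contra hcon
    push Not at hcon
    have hz : ∀ j, j ≠ i → ∃ z : ℤ, x j = z := fun j hj => by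
      by_cases h0 : x j = 0
      · exact ⟨0, by simp [h0]⟩
      · exact ⟨1, by simp [hcon j hj h0]⟩
    have hs : ∑ j ∈ Finset.univ.erase i, x j ∈ (Int.castRingHom ℝ).range :=
      sum_mem fun j hj => by
        obtain ⟨z, hz⟩ := hz j (Finset.ne_of_mem_erase hj)
        exact ⟨z, hz.symm⟩
    obtain ⟨z, hz⟩ := hs
    rw [← Finset.add_sum_erase _ _ (Finset.mem_univ i), ← hz] at hx2
    have h1 : x i = ((k - z : ℤ) : ℝ) := by
      simp only [eq_intCast] at hx2
      push_cast
      linarith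
    have h2 := lt_of_le_of_ne (hx1 i).1 (Ne.symm hi.1)
    have h3 := lt_of_le_of_ne (hx1 i).2 hi.2
    rw [h1] at h2 h3
    have h2' : (0 : ℤ) < k - z := by exact_mod_cast h2
    have h3' : (k - z : ℤ) < 1 := by exact_mod_cast h3
    omega
  obtain ⟨j, hji, hj0, hj1⟩ := hj
  have a1 := lt_of_le_of_ne (hx1 i).1 (Ne.symm hi.1)
  have a2 := lt_of_le_of_ne (hx1 i).2 hi.2
  have a3 := lt_of_le_of_ne (hx1 j).1 (Ne.symm hj0)
  have a4 := lt_of_le_of_ne (hx1 j).2 hj1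
  -- `e` is the smallest of the four distances from `x i` and `x j` to `0` and `1`, so neither
  -- coordinate leaves the unit interval.
  obtain ⟨e, he, he1, he2, he3, he4⟩ : ∃ e : ℝ, 0 < e ∧ e ≤ x i ∧ e ≤ 1 - x i ∧ e ≤ x j ∧
      e ≤ 1 - x j :=
    ⟨min (min (x i) (1 - x i)) (min (x j) (1 - x j)),
      lt_min (lt_min a1 (by linarith)) (lt_min a3 (by linarith)),
      (min_le_left _ _).trans (min_le_left _ _), (min_le_left _ _).trans (min_le_right _ _),
      (min_le_right _ _).trans (min_le_left _ _), (min_le_right _ _).trans (min_le_right _ _)⟩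
  have key : ∀ r : ℝ, |r| = e →
      x + r • (Pi.single i 1 - Pi.single j 1 : Fin d → ℝ) ∈
        {x : Fin d → ℝ | (∀ i, 0 ≤ x i ∧ x i ≤ 1) ∧ ∑ i, x i = k} := by
    intro r hr
    have hr1 := neg_abs_le r
    have hr2 := le_abs_self r
    rw [hr] at hr1 hr2
    refine ⟨fun l => ?_, ?_⟩
    · simp only [Pi.add_apply, Pi.smul_apply, Pi.sub_apply, smul_eq_mul, Pi.single_apply]
      have := hx1 l
      split_ifs with h1 h2 h2
      · exact absurd (h2.symm.trans h1) hji
      · subst h1; constructor <;> linarith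
      · subst h2; constructor <;> linarith
      · simpa using this
    · simp [Finset.sum_add_distrib, ← Finset.mul_sum, hx2]
  have := hext (key e (abs_of_pos he)) (key (-e) (by rw [abs_neg, abs_of_pos he]))
    ⟨1 / 2, 1 / 2, by norm_num, by norm_num, by norm_num, by
      ext l; simp; ring⟩
  have h5 := congrFun this i
  simp [hji.symm] at h5
  exact he.ne' h5

/-- Krein–Milman: the slice is compact and convex and its extreme points are `0/1` vectors of sum
`k`, that is, columns; the hull of the columns is already closed. -/
theorem polytope_hypersimplexMatrix (d k : ℕ) :
    polytope (hypersimplexMatrix d k) =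
      {x : Fin d → ℝ | (∀ i, 0 ≤ x i ∧ x i ≤ 1) ∧ ∑ i, x i = k} := by
  have hconv : Convex ℝ {x : Fin d → ℝ | (∀ i, 0 ≤ x i ∧ x i ≤ 1) ∧ ∑ i, x i = k} := by
    intro x hx y hy a b ha hb hab
    refine ⟨fun i => ⟨?_, ?_⟩, ?_⟩
    · exact add_nonneg (mul_nonneg ha (hx.1 i).1) (mul_nonneg hb (hy.1 i).1)
    · have h1 := mul_le_mul_of_nonneg_left (hx.1 i).2 ha
      have h2 := mul_le_mul_of_nonneg_left (hy.1 i).2 hb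
      simp only [Pi.add_apply, Pi.smul_apply, smul_eq_mul]
      linarith
    · simp only [Pi.add_apply, Pi.smul_apply, smul_eq_mul, Finset.sum_add_distrib,
        ← Finset.mul_sum, hx.2, hy.2, ← add_mul, hab, one_mul]
  have hcomp : IsCompact {x : Fin d → ℝ | (∀ i, 0 ≤ x i ∧ x i ≤ 1) ∧ ∑ i, x i = k} := by
    refine (isCompact_Icc (a := (0 : Fin d → ℝ)) (b := 1)).of_isClosed_subset ?_ ?_
    · have : {x : Fin d → ℝ | (∀ i, 0 ≤ x i ∧ x i ≤ 1) ∧ ∑ i, x i = k} =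
          Set.Icc 0 1 ∩ {x : Fin d → ℝ | ∑ i, x i = k} := by
        ext x; simp [Pi.le_def, forall_and]
      rw [this]
      exact isClosed_Icc.inter (isClosed_eq (by fun_prop) continuous_const)
    · rintro x ⟨hx, -⟩
      exact ⟨fun i => (hx i).1, fun i => (hx i).2⟩
  apply Set.Subset.antisymm
  · refine convexHull_min ?_ hconv
    rintro _ ⟨s, rfl⟩
    rw [column_hypersimplexMatrix]
    exact ⟨fun i => ⟨indicatorVector_nonneg _ _, indicatorVector_le_one _ _⟩,
      by rw [sum_indicatorVector, s.2]⟩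
  · rw [← closure_convexHull_extremePoints hcomp hconv]
    have hP : IsClosed (polytope (hypersimplexMatrix d k)) :=
      ((Set.finite_range _).isCompact_convexHull ℝ).isClosed
    refine closure_minimal (convexHull_mono fun x hx => ?_) hP
    have h01 := eq_one_or_eq_zero_of_mem_extremePoints hx
    have hxs : x = indicatorVector (Finset.univ.filter fun i => x i = 1) := by
      ext i
      rcases h01 i with h | h <;> simp [indicatorVector, h]
    have hcard : (Finset.univ.filter fun i => x i = 1).card = k := by
      have := hx.1.2
      rw [hxs, sum_indicatorVector] at this
      exact_mod_cast this
    exact ⟨⟨_, hcard⟩, by rw [column_hypersimplexMatrix]; exact hxs.symm⟩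

/-- The points of the hypersimplex whose coordinates are `1` on `L` and `0` outside `U`. -/
def hypersimplexFace (d k : ℕ) (L U : Finset (Fin d)) : Set (Fin d → ℝ) :=
  {x | x ∈ polytope (hypersimplexMatrix d k) ∧ (∀ i ∈ L, x i = 1) ∧ ∀ i, i ∉ U → x i = 0}

theorem mem_hypersimplexFace {d k : ℕ} {L U : Finset (Fin d)} {x : Fin d → ℝ} :
    x ∈ hypersimplexFace d k L U ↔ ((∀ i, 0 ≤ x i ∧ x i ≤ 1) ∧ ∑ i, x i = k) ∧
      (∀ i ∈ L, x i = 1) ∧ ∀ i, i ∉ U → x i = 0 := by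
  rw [hypersimplexFace, polytope_hypersimplexMatrix]
  rfl

theorem indicatorVector_mem_hypersimplexFace {d k : ℕ} {L U s : Finset (Fin d)} (hs : s.card = k) :
    indicatorVector s ∈ hypersimplexFace d k L U ↔ L ⊆ s ∧ s ⊆ U := by
  rw [mem_hypersimplexFace, sum_indicatorVector, hs]
  have h1 : ∀ i, indicatorVector s i = 1 ↔ i ∈ s := fun i => by simp [indicatorVector]
  have h2 : ∀ i, indicatorVector s i = 0 ↔ i ∉ s := fun i => by simp [indicatorVector]
  simp only [h1, h2, indicatorVector_nonneg, indicatorVector_le_one, true_and, implies_true,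
    not_imp_not]
  rfl

/-- The pairs of sets that index the nonempty faces of the hypersimplex: the vertices
correspond to the pairs with `L = U`. -/
def IsFaceIndex {d : ℕ} (k : ℕ) (L U : Finset (Fin d)) : Prop :=
  L ⊆ U ∧ (L = U ∧ L.card = k ∨ L.card < k ∧ k < U.card)

theorem IsFaceIndex.card_le {d k : ℕ} {L U : Finset (Fin d)} (h : IsFaceIndex k L U) :
    L.card ≤ k := by
  rcases h.2 with h | h <;> omega

theorem IsFaceIndex.le_card {d k : ℕ} {L U : Finset (Fin d)} (h : IsFaceIndex k L U) :
    k ≤ U.card := by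
  rcases h.2 with h | h
  · rw [← h.1]; omega
  · omega

/-- Inclusion is tested on vertices. The cardinality conditions provide a `k`-set between `L` and
`U` that avoids a given element outside `L`, and one that contains a given element of `U`. In
particular a face determines its index. -/
theorem IsFaceIndex.hypersimplexFace_subset_iff {d k : ℕ} {L U L' U' : Finset (Fin d)}
    (h : IsFaceIndex k L U) :
    hypersimplexFace d k L U ⊆ hypersimplexFace d k L' U' ↔ L' ⊆ L ∧ U ⊆ U' := by
  constructor
  · intro hsub
    have key : ∀ s : Finset (Fin d), L ⊆ s → s ⊆ U → s.card = k → L' ⊆ s ∧ s ⊆ U' :=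
      fun s h1 h2 h3 => (indicatorVector_mem_hypersimplexFace h3).1
        (hsub ((indicatorVector_mem_hypersimplexFace h3).2 ⟨h1, h2⟩))
    constructor
    · intro i hi
      by_contra hiL
      have hcard : k ≤ (U.erase i).card := by
        rcases h.2 with h' | h'
        · rw [Finset.erase_eq_of_notMem (h'.1 ▸ hiL)]; exact h.le_card
        · have := Finset.pred_card_le_card_erase (s := U) (a := i)
          omega
      obtain ⟨s, h1, h2, h3⟩ := Finset.exists_subsuperset_card_eq
        (Finset.subset_erase.2 ⟨h.1, hiL⟩) h.card_le hcard
      exact Finset.notMem_erase i U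
        (h2 ((key s h1 (h2.trans (Finset.erase_subset _ _)) h3).1 hi))
    · intro i hi
      have hcard : (insert i L).card ≤ k := by
        rcases h.2 with h' | h'
        · rw [Finset.insert_eq_of_mem (h'.1 ▸ hi)]; exact h.card_le
        · have := Finset.card_insert_le i L
          omega
      obtain ⟨s, h1, h2, h3⟩ := Finset.exists_subsuperset_card_eq
        (Finset.insert_subset hi h.1) hcard h.le_card
      exact (key s ((Finset.subset_insert _ _).trans h1) h2 h3).2 (h1 (Finset.mem_insert_self _ _))
  · rintro ⟨hL, hU⟩ x hx
    exact ⟨hx.1, fun i hi => hx.2.1 i (hL hi), fun i hi => hx.2.2 i fun h => hi (hU h)⟩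

/-- If only `k` coordinates may be nonzero and each is at most `1`, the sum `k` forces them all to
be `1`. Degenerate pairs are thereby replaced by vertex indices. -/
theorem hypersimplexFace_eq_of_card_eq {d k : ℕ} {L U : Finset (Fin d)} (hLU : L ⊆ U)
    (hU : U.card = k) : hypersimplexFace d k L U = hypersimplexFace d k U U := by
  ext x
  simp only [mem_hypersimplexFace]
  refine and_congr_right fun hx => ⟨fun h => ⟨?_, h.2⟩, fun h => ⟨fun i hi => h.1 i (hLU hi), h.2⟩⟩
  have h1 : ∑ i ∈ U, x i = ∑ i ∈ U, (1 : ℝ) := by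
    rw [Finset.sum_const, nsmul_one, hU, ← hx.2]
    exact Finset.sum_subset (Finset.subset_univ _) fun i _ hi => h.2 i hi
  exact (Finset.sum_eq_sum_iff_of_le fun i _ => (hx.1 i).2).1 h1

theorem isExposed_hypersimplexFace {d k : ℕ} {L U : Finset (Fin d)} (h : L ⊆ U) (hL : L.card ≤ k)
    (hU : k ≤ U.card) :
    (hypersimplexFace d k L U).Nonempty ∧
      IsExposed ℝ (polytope (hypersimplexMatrix d k)) (hypersimplexFace d k L U) := by
  obtain ⟨s, h1, h2, h3⟩ := Finset.exists_subsuperset_card_eq h hL hU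
  have hs := (indicatorVector_mem_hypersimplexFace h3).2 ⟨h1, h2⟩
  refine ⟨⟨_, hs⟩, fun _ => ?_⟩
  -- This functional is at most `L.card` on the polytope, with equality exactly when the coordinates
  -- are `1` on `L` and `0` outside `U`.
  let l : StrongDual ℝ (Fin d → ℝ) :=
    ∑ i ∈ L, ContinuousLinearMap.proj (R := ℝ) (φ := fun _ : Fin d => ℝ) i -
      ∑ i ∈ Uᶜ, ContinuousLinearMap.proj (R := ℝ) (φ := fun _ : Fin d => ℝ) i
  have hl : ∀ x, l x = ∑ i ∈ L, x i - ∑ i ∈ Uᶜ, x i := fun x => by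
    simp [l]
  have hface : ∀ x ∈ hypersimplexFace d k L U, l x = L.card := fun x hx => by
    rw [hl, Finset.sum_congr rfl hx.2.1,
      Finset.sum_eq_zero fun i hi => hx.2.2 i (Finset.mem_compl.1 hi)]
    simp
  have hle : ∀ x ∈ polytope (hypersimplexMatrix d k), l x ≤ L.card := fun x hx => by
    rw [polytope_hypersimplexMatrix] at hx
    have a1 : ∑ i ∈ L, x i ≤ ∑ i ∈ L, (1 : ℝ) := Finset.sum_le_sum fun i _ => (hx.1 i).2
    have a2 : 0 ≤ ∑ i ∈ Uᶜ, x i := Finset.sum_nonneg fun i _ => (hx.1 i).1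
    simp at a1
    rw [hl]; linarith
  refine ⟨l, ?_⟩
  ext x
  constructor
  · intro hx
    exact ⟨hx.1, fun y hy => (hle y hy).trans (hface x hx).ge⟩
  · rintro ⟨hx, hmax⟩
    have h4 := (hmax _ hs.1)
    rw [hface _ hs, hl] at h4
    have hx' := hx
    rw [polytope_hypersimplexMatrix] at hx'
    have a1 : ∑ i ∈ L, x i ≤ ∑ i ∈ L, (1 : ℝ) := Finset.sum_le_sum fun i _ => (hx'.1 i).2
    have a2 : 0 ≤ ∑ i ∈ Uᶜ, x i := Finset.sum_nonneg fun i _ => (hx'.1 i).1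
    have a3 : ∑ i ∈ L, (1 : ℝ) = L.card := by simp
    have a4 : ∑ i ∈ L, x i = ∑ i ∈ L, (1 : ℝ) := by linarith
    have a5 : ∑ i ∈ Uᶜ, x i = 0 := by linarith
    refine ⟨hx, (Finset.sum_eq_sum_iff_of_le fun i _ => (hx'.1 i).2).1 a4, fun i hi => ?_⟩
    exact (Finset.sum_eq_zero_iff_of_nonneg fun i _ => (hx'.1 i).1).1 a5 i (Finset.mem_compl.2 hi)

/-- The threshold `c` is the `k`-th largest value of `w`, counted with multiplicity: the largest
value that at least `k` entries reach. -/
theorem exists_threshold {d k : ℕ} (hk : 1 ≤ k) (hkd : k ≤ d) (w : Fin d → ℝ) :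
    ∃ c, (Finset.univ.filter fun i => c < w i).card < k ∧
      k ≤ (Finset.univ.filter fun i => c ≤ w i).card := by
  have : Nonempty (Fin d) := ⟨⟨0, by omega⟩⟩
  let G : Finset (Fin d) := Finset.univ.filter fun i => k ≤ (Finset.univ.filter fun j => w i ≤ w j).card
  have hG : G.Nonempty := by
    obtain ⟨i, -, hi⟩ := Finset.exists_min_image Finset.univ w Finset.univ_nonempty
    refine ⟨i, Finset.mem_filter.2 ⟨Finset.mem_univ _, ?_⟩⟩
    rw [Finset.filter_true_of_mem fun j _ => hi j (Finset.mem_univ j)]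
    simpa using hkd
  obtain ⟨i, hiG, hi⟩ := Finset.exists_max_image G w hG
  refine ⟨w i, ?_, (Finset.mem_filter.1 hiG).2⟩
  by_contra hcon
  rw [not_lt] at hcon
  obtain ⟨j, hj, hjmin⟩ := Finset.exists_min_image (Finset.univ.filter fun j => w i < w j) w
    (Finset.card_pos.1 (by omega))
  have hij := (Finset.mem_filter.1 hj).2
  refine absurd (hi j (Finset.mem_filter.2 ⟨Finset.mem_univ _, hcon.trans ?_⟩)) hij.not_ge
  exact Finset.card_le_card fun l hl => Finset.mem_filter.2 ⟨Finset.mem_univ _, hjmin l hl⟩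

theorem exists_eq_hypersimplexFace {d k : ℕ} (hk : 1 ≤ k) (hkd : k ≤ d) {F : Set (Fin d → ℝ)}
    (hne : F.Nonempty) (hF : IsExposed ℝ (polytope (hypersimplexMatrix d k)) F) :
    ∃ L U, IsFaceIndex k L U ∧ F = hypersimplexFace d k L U := by
  obtain ⟨l, rfl⟩ := hF hne
  let w : Fin d → ℝ := fun i => l (Pi.single i 1)
  have hl : ∀ x, l x = ∑ i, x i * w i := fun x => by
    conv_lhs => rw [pi_eq_sum_univ' x]
    rw [map_sum]
    refine Finset.sum_congr rfl fun i _ => ?_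
    rw [map_smul, smul_eq_mul]
  obtain ⟨c, hc1, hc2⟩ := exists_threshold hk hkd w
  let L : Finset (Fin d) := Finset.univ.filter fun i => c < w i
  let U : Finset (Fin d) := Finset.univ.filter fun i => c ≤ w i
  have hLU : L ⊆ U := Finset.monotone_filter_right _ fun i _ hi => le_of_lt hi
  have hL : ∀ i, i ∈ L ↔ c < w i := fun i => by simp [L]
  have hU : ∀ i, i ∈ U ↔ c ≤ w i := fun i => by simp [U]
  -- Subtracting the threshold from all weights changes the functional by a constant on the
  -- polytope. Each summand can then be bounded separately by the positive part of its weight, and a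
  -- maximizer attains all these bounds; ties at `c` leave a coordinate free.
  have hl2 : ∀ x ∈ polytope (hypersimplexMatrix d k), l x = ∑ i, x i * (w i - c) + k * c :=
    fun x hx => by
      rw [polytope_hypersimplexMatrix] at hx
      rw [hl, ← hx.2, Finset.sum_mul, ← Finset.sum_add_distrib]
      exact Finset.sum_congr rfl fun i _ => by ring
  have hterm : ∀ x ∈ polytope (hypersimplexMatrix d k), ∀ i ∈ Finset.univ,
      x i * (w i - c) ≤ if i ∈ L then w i - c else 0 := fun x hx i _ => by
    rw [polytope_hypersimplexMatrix] at hx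
    split_ifs with h
    · exact mul_le_of_le_one_left (by linarith [(hL i).1 h]) (hx.1 i).2
    · rw [hL, not_lt] at h
      exact mul_nonpos_of_nonneg_of_nonpos (hx.1 i).1 (by linarith)
  have hface : ∀ x ∈ hypersimplexFace d k L U, ∑ i, x i * (w i - c) =
      ∑ i, if i ∈ L then w i - c else 0 := fun x hx => by
    refine Finset.sum_congr rfl fun i _ => ?_
    split_ifs with h
    · rw [hx.2.1 i h, one_mul]
    · by_cases hi : i ∈ U
      · have : w i = c := le_antisymm (not_lt.1 fun h' => h ((hL i).2 h')) ((hU i).1 hi)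
        rw [this, sub_self, mul_zero]
      · rw [hx.2.2 i hi, zero_mul]
  have heq : {x ∈ polytope (hypersimplexMatrix d k) |
      ∀ y ∈ polytope (hypersimplexMatrix d k), l y ≤ l x} = hypersimplexFace d k L U := by
    ext x
    constructor
    · rintro ⟨hx, hmax⟩
      obtain ⟨y, hy⟩ := (isExposed_hypersimplexFace hLU hc1.le hc2).1
      have h1 := hmax y hy.1
      rw [hl2 y hy.1, hl2 x hx, hface y hy] at h1
      have h2 : ∑ i, x i * (w i - c) = ∑ i, if i ∈ L then w i - c else 0 :=
        le_antisymm (Finset.sum_le_sum (hterm x hx)) (by linarith)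
      have h3 := (Finset.sum_eq_sum_iff_of_le (hterm x hx)).1 h2
      refine ⟨hx, fun i hi => ?_, fun i hi => ?_⟩
      · have := h3 i (Finset.mem_univ i)
        rw [if_pos hi] at this
        have hpos : w i - c ≠ 0 := (sub_pos.2 ((hL i).1 hi)).ne'
        exact (mul_eq_right₀ hpos).1 this
      · have := h3 i (Finset.mem_univ i)
        rw [if_neg fun h => hi (hLU h)] at this
        have hneg : w i - c ≠ 0 := (sub_neg.2 (not_le.1 fun h => hi ((hU i).2 h))).ne
        exact (mul_eq_zero.1 this).resolve_right hneg
    · intro hx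
      refine ⟨hx.1, fun y hy => ?_⟩
      rw [hl2 y hy, hl2 x hx.1, hface x hx]
      linarith [Finset.sum_le_sum (hterm y hy)]
  change ∃ L U, IsFaceIndex k L U ∧ {x ∈ polytope (hypersimplexMatrix d k) |
      ∀ y ∈ polytope (hypersimplexMatrix d k), l y ≤ l x} = hypersimplexFace d k L U
  rw [heq]
  -- The threshold gives `L.card < k`, so the only degenerate case is `U.card = k`, a vertex.
  rcases hc2.eq_or_lt with h | h
  · exact ⟨U, U, ⟨subset_rfl, Or.inl ⟨rfl, h.symm⟩⟩, hypersimplexFace_eq_of_card_eq hLU h.symm⟩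
  · exact ⟨L, U, ⟨hLU, Or.inr ⟨hc1, h⟩⟩, rfl⟩

/-- The face of the hypersimplex with a given index. -/
def faceOfIndex {d k : ℕ} (p : {p : Finset (Fin d) × Finset (Fin d) // IsFaceIndex k p.1 p.2}) :
    Face (hypersimplexMatrix d k) :=
  ⟨hypersimplexFace d k p.1.1 p.1.2, isExposed_hypersimplexFace p.2.1 p.2.card_le p.2.le_card⟩

theorem faceOfIndex_le_iff {d k : ℕ}
    (p q : {p : Finset (Fin d) × Finset (Fin d) // IsFaceIndex k p.1 p.2}) :
    faceOfIndex p ≤ faceOfIndex q ↔ q.1.1 ⊆ p.1.1 ∧ p.1.2 ⊆ q.1.2 :=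
  p.2.hypersimplexFace_subset_iff

theorem faceOfIndex_bijective {d k : ℕ} (hk : 1 ≤ k) (hkd : k ≤ d) :
    Function.Bijective (faceOfIndex (d := d) (k := k)) := by
  constructor
  · intro p q h
    have h1 := (faceOfIndex_le_iff p q).1 h.le
    have h2 := (faceOfIndex_le_iff q p).1 h.ge
    exact Subtype.ext (Prod.ext (h2.1.antisymm h1.1) (h1.2.antisymm h2.2))
  · rintro ⟨F, hne, hF⟩
    obtain ⟨L, U, h, rfl⟩ := exists_eq_hypersimplexFace hk hkd hne hF
    exact ⟨⟨(L, U), h⟩, rfl⟩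

/-! ### Linear spaces and lattices of the faces -/

/-- The vectors with coordinate sum zero that are supported on `F`. -/
def zeroSumSubspace {d : ℕ} (F : Finset (Fin d)) : Submodule ℝ (Fin d → ℝ) where
  carrier := {v | (∀ i, i ∉ F → v i = 0) ∧ ∑ i, v i = 0}
  zero_mem' := by simp
  add_mem' := fun {v w} hv hw => ⟨fun i hi => by simp [hv.1 i hi, hw.1 i hi], by
    simp [Finset.sum_add_distrib, hv.2, hw.2]⟩
  smul_mem' := fun c v hv => ⟨fun i hi => by simp [hv.1 i hi], by
    simp [← Finset.mul_sum, hv.2]⟩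

theorem mem_zeroSumSubspace {d : ℕ} {F : Finset (Fin d)} {v : Fin d → ℝ} :
    v ∈ zeroSumSubspace F ↔ (∀ i, i ∉ F → v i = 0) ∧ ∑ i, v i = 0 := Iff.rfl

/-- The vector `e_i - e_j`. -/
noncomputable def edgeVector {d : ℕ} (j i : Fin d) : Fin d → ℝ :=
  Pi.single i 1 - Pi.single j 1

theorem edgeVector_apply {d : ℕ} (j i l : Fin d) :
    edgeVector j i l = (if l = i then 1 else 0) - (if l = j then 1 else 0) := by
  simp [edgeVector, Pi.single_apply]

theorem edgeVector_self {d : ℕ} (j : Fin d) : edgeVector j j = 0 := sub_self _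

theorem edgeVector_mem_zeroSumSubspace {d : ℕ} {F : Finset (Fin d)} {i j : Fin d} (hi : i ∈ F)
    (hj : j ∈ F) : edgeVector j i ∈ zeroSumSubspace F := by
  refine ⟨fun l hl => ?_, by simp [edgeVector]⟩
  rw [edgeVector_apply, if_neg fun h : l = i => hl (h ▸ hi), if_neg fun h : l = j => hl (h ▸ hj), sub_zero]

/-- The multiples of `e_j` on the right add up to the coordinate sum of `v`, which is zero. -/
theorem eq_sum_smul_edgeVector {d : ℕ} {F : Finset (Fin d)} {v : Fin d → ℝ}
    (hv : v ∈ zeroSumSubspace F) (j : Fin d) : v = ∑ i ∈ F, v i • edgeVector j i := by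
  have hs : ∑ i ∈ F, v i = 0 := by
    rw [← hv.2]
    exact Finset.sum_subset (Finset.subset_univ _) fun i _ hi => hv.1 i hi
  ext l
  have h0 : ∑ i ∈ F, v i * (if l = j then 1 else 0) = 0 := by
    rw [← Finset.sum_mul, hs, zero_mul]
  simp only [Finset.sum_apply, Pi.smul_apply, smul_eq_mul, edgeVector_apply, mul_sub,
    Finset.sum_sub_distrib, h0, sub_zero]
  simp only [mul_ite, mul_one, mul_zero, Finset.sum_ite_eq]
  split_ifs with h
  · rfl
  · exact hv.1 l h

/-- Two points of a hypersimplex that differ by `e_i - e_j`. -/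
theorem exists_indicatorVector_sub_eq {d k : ℕ} {A B : Finset (Fin d)} {i j : Fin d}
    (hAB : A ⊆ B) (hA : A.card + 1 ≤ k) (hB : k ≤ B.card + 1) (hi : i ∉ B) (hj : j ∉ B) :
    ∃ t : Finset (Fin d), A ⊆ t ∧ t ⊆ B ∧ (insert i t).card = k ∧ (insert j t).card = k ∧
      indicatorVector (insert i t) - indicatorVector (insert j t) = edgeVector j i := by
  obtain ⟨t, h1, h2, h3⟩ := Finset.exists_subsuperset_card_eq (n := k - 1) hAB (by omega) (by omega)
  have hit : i ∉ t := fun h => hi (h2 h)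
  have hjt : j ∉ t := fun h => hj (h2 h)
  refine ⟨t, h1, h2, ?_, ?_, ?_⟩
  · rw [Finset.card_insert_of_notMem hit]; omega
  · rw [Finset.card_insert_of_notMem hjt]; omega
  · ext l
    rw [edgeVector_apply]
    simp only [Pi.sub_apply, indicatorVector, Finset.mem_insert]
    by_cases hl : l ∈ t
    · have h4 : l ≠ i := fun h => hit (h ▸ hl)
      have h5 : l ≠ j := fun h => hjt (h ▸ hl)
      simp [hl, h4, h5]
    · simp [hl]

theorem IsFaceIndex.one_lt_card_sdiff {d k : ℕ} {L U : Finset (Fin d)} (h : IsFaceIndex k L U)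
    (hne : L ≠ U) : 1 < (U \ L).card := by
  have := Finset.card_sdiff_add_card_eq_card h.1
  rcases h.2 with h' | h'
  · exact absurd h'.1 hne
  · omega

/-- For distinct free `i` and `j`, the inequalities `L.card ≤ k - 1 ≤ U.card - 2` give a `(k-1)`-set
`t` between `L` and `U \ {i, j}`; the vertices `t ∪ {i}` and `t ∪ {j}` of the face differ by `e_i -
e_j`. -/
theorem IsFaceIndex.vectorSpan_hypersimplexFace {d k : ℕ} {L U : Finset (Fin d)}
    (h : IsFaceIndex k L U) :
    vectorSpan ℝ (hypersimplexFace d k L U) = zeroSumSubspace (U \ L) := by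
  apply le_antisymm
  · rw [vectorSpan_def, Submodule.span_le]
    rintro _ ⟨x, hx, y, hy, rfl⟩
    rw [mem_hypersimplexFace] at hx hy
    refine ⟨fun i hi => ?_, by simp [hx.1.2, hy.1.2]⟩
    rw [Finset.mem_sdiff, not_and, not_not] at hi
    simp only [vsub_eq_sub, Pi.sub_apply]
    by_cases hU : i ∈ U
    · rw [hx.2.1 i (hi hU), hy.2.1 i (hi hU), sub_self]
    · rw [hx.2.2 i hU, hy.2.2 i hU, sub_self]
  · intro v hv
    rcases (U \ L).eq_empty_or_nonempty with he | ⟨j, hj⟩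
    · have : v = 0 := by
        ext i
        exact hv.1 i (by simp [he])
      rw [this]
      exact Submodule.zero_mem _
    · have hjU := (Finset.mem_sdiff.1 hj).1
      have hjL := (Finset.mem_sdiff.1 hj).2
      have hlt : L.card < k ∧ k < U.card := h.2.resolve_left fun h' => hjL (h'.1 ▸ hjU)
      rw [eq_sum_smul_edgeVector hv j]
      refine sum_mem fun i hi => Submodule.smul_mem _ _ ?_
      have hiU := (Finset.mem_sdiff.1 hi).1
      have hiL := (Finset.mem_sdiff.1 hi).2
      by_cases hij : i = j
      · rw [hij, edgeVector_self]
        exact Submodule.zero_mem _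
      have hcard : ((U.erase i).erase j).card + 2 = U.card := by
        rw [Finset.card_erase_of_mem (Finset.mem_erase.2 ⟨Ne.symm hij, hjU⟩),
          Finset.card_erase_of_mem hiU]
        omega
      obtain ⟨t, h1, h2, h3, h4, h5⟩ := exists_indicatorVector_sub_eq (k := k) (i := i) (j := j)
        (A := L) (B := (U.erase i).erase j)
        (Finset.subset_erase.2 ⟨Finset.subset_erase.2 ⟨h.1, hiL⟩, hjL⟩) (by omega) (by omega)
        (by simp) (by simp)
      have h2' : t ⊆ U := h2.trans ((Finset.erase_subset _ _).trans (Finset.erase_subset _ _))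
      rw [← h5]
      exact vsub_mem_vectorSpan ℝ
        ((indicatorVector_mem_hypersimplexFace h3).2
          ⟨h1.trans (Finset.subset_insert _ _), Finset.insert_subset hiU h2'⟩)
        ((indicatorVector_mem_hypersimplexFace h4).2
          ⟨h1.trans (Finset.subset_insert _ _), Finset.insert_subset hjU h2'⟩)

theorem mem_integerLattice {d : ℕ} {v : Fin d → ℝ} :
    v ∈ integerLattice d ↔ ∀ i, ∃ z : ℤ, (z : ℝ) = v i := by
  rw [integerLattice, Module.Basis.mem_span_iff_repr_mem]
  rfl

/-- A basis of the image of the lattice of sum-zero integer vectors supported on `F` under a linear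
map `p` whose kernel is spanned by the vectors `e_i - e_j` with `i ∉ T`. -/
theorem linearIndependent_and_span_edgeVector {d : ℕ} {V : Type*} [AddCommGroup V] [Module ℝ V]
    (p : (Fin d → ℝ) →ₗ[ℝ] V) {F T : Finset (Fin d)} {j : Fin d} (hj : j ∈ F) (hTF : T ⊆ F)
    (hjT : j ∉ T) (hker : ∀ v, p v = 0 → ∀ i ∈ T, v i = 0)
    (hzero : ∀ i ∈ F, i ∉ T → p (edgeVector j i) = 0) (ε : Fin d → ℤ) (hε : ∀ i, ε i * ε i = 1) :
    LinearIndependent ℝ (fun i : T => p ((ε i : ℝ) • edgeVector j i)) ∧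
      Submodule.span ℤ (Set.range fun i : T => p ((ε i : ℝ) • edgeVector j i)) =
        (integerLattice d ⊓ (zeroSumSubspace F).restrictScalars ℤ).map (p.restrictScalars ℤ) := by
  -- The signs are carried along so that the tangent cones below have nonnegative coordinates; they
  -- are units of `ℤ`, so the lattice is unaffected.
  have hε' : ∀ i, (ε i : ℝ) * ε i = 1 := fun i => by exact_mod_cast hε i
  constructor
  · rw [Fintype.linearIndependent_iff]
    intro g hg l
    have h1 : p (∑ i : T, g i • ((ε i : ℝ) • edgeVector j i)) = 0 := by
      rw [map_sum, ← hg]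
      exact Finset.sum_congr rfl fun i _ => map_smul _ _ _
    have h2 := hker _ h1 l l.2
    have hlj : (l : Fin d) ≠ j := fun h => hjT (h ▸ l.2)
    simp only [Finset.sum_apply, Pi.smul_apply, smul_eq_mul, edgeVector_apply, if_neg hlj,
      sub_zero, mul_ite, mul_one, mul_zero, Subtype.coe_inj, Finset.sum_ite_eq, Finset.mem_univ,
      if_true] at h2
    have h3 : (ε l : ℝ) ≠ 0 := fun h => by simpa [h] using hε' l
    exact (mul_eq_zero.1 h2).resolve_right h3
  · apply le_antisymm
    · rw [Submodule.span_le]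
      rintro _ ⟨i, rfl⟩
      refine ⟨(ε i : ℝ) • edgeVector j i, ⟨?_, ?_⟩, rfl⟩
      · refine mem_integerLattice.2 fun l => ⟨ε i * ((if l = i then 1 else 0) - (if l = j then 1 else 0)), ?_⟩
        rw [Pi.smul_apply, edgeVector_apply]
        push_cast
        rfl
      · exact Submodule.smul_mem _ _ (edgeVector_mem_zeroSumSubspace (hTF i.2) hj)
    · rintro _ ⟨v, ⟨hv1, hv2⟩, rfl⟩
      have hv2' : v ∈ zeroSumSubspace F := hv2
      have h1 : p v = ∑ i ∈ T, v i • p (edgeVector j i) := by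
        conv_lhs => rw [eq_sum_smul_edgeVector hv2' j]
        rw [map_sum, ← Finset.sum_subset hTF fun i hi hiT => by
          rw [map_smul, hzero i hi hiT, smul_zero]]
        exact Finset.sum_congr rfl fun i _ => map_smul _ _ _
      change p v ∈ _
      rw [h1]
      refine sum_mem fun i hi => ?_
      obtain ⟨z, hz⟩ := mem_integerLattice.1 hv1 i
      have h2 : v i • p (edgeVector j i) = (z * ε i) • p ((ε i : ℝ) • edgeVector j i) := by
        rw [map_smul, ← Int.cast_smul_eq_zsmul ℝ, smul_smul, ← hz]
        push_cast
        rw [mul_assoc, hε', mul_one]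
      rw [h2]
      exact Submodule.smul_mem _ _ (Submodule.subset_span ⟨⟨i, hi⟩, rfl⟩)

theorem finrank_zeroSumSubspace {d : ℕ} (F : Finset (Fin d)) :
    Module.finrank ℝ (zeroSumSubspace F) = F.card - 1 := by
  rcases F.eq_empty_or_nonempty with rfl | ⟨j, hj⟩
  · have : zeroSumSubspace (∅ : Finset (Fin d)) = ⊥ := by
      rw [eq_bot_iff]
      intro v hv
      rw [Submodule.mem_bot]
      ext i
      exact hv.1 i (by simp)
    rw [this]
    simp
  · have hli := (linearIndependent_and_span_edgeVector (V := Fin d → ℝ) LinearMap.id hj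
      (Finset.erase_subset j F) (Finset.notMem_erase j F) (fun v hv i _ => by
        rw [LinearMap.id_apply] at hv; rw [hv]; rfl) (fun i hi hiT => by
        have : i = j := by
          by_contra h
          exact hiT (Finset.mem_erase.2 ⟨h, hi⟩)
        rw [this, edgeVector_self]; rfl) (fun _ => 1) (fun _ => rfl)).1
    have hspan : Submodule.span ℝ (Set.range fun i : F.erase j =>
        (LinearMap.id : (Fin d → ℝ) →ₗ[ℝ] (Fin d → ℝ)) (((1 : ℤ) : ℝ) • edgeVector j i)) =
        zeroSumSubspace F := by
      apply le_antisymm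
      · rw [Submodule.span_le]
        rintro _ ⟨i, rfl⟩
        simp only [Int.cast_one, one_smul, LinearMap.id_apply]
        exact edgeVector_mem_zeroSumSubspace (Finset.mem_of_mem_erase i.2) hj
      · intro v hv
        rw [eq_sum_smul_edgeVector hv j]
        refine sum_mem fun i hi => ?_
        by_cases hij : i = j
        · rw [hij, edgeVector_self, smul_zero]
          exact Submodule.zero_mem _
        · exact Submodule.smul_mem _ _ (Submodule.subset_span
            ⟨⟨i, Finset.mem_erase.2 ⟨hij, hi⟩⟩, by simp⟩)
    have := finrank_span_eq_card hli
    rw [hspan, Fintype.card_coe, Finset.card_erase_of_mem hj] at this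
    exact this

theorem IsFaceIndex.dimension_hypersimplexFace {d k : ℕ} {L U : Finset (Fin d)}
    (h : IsFaceIndex k L U) : dimension (hypersimplexFace d k L U) = (U \ L).card - 1 := by
  rw [dimension, h.vectorSpan_hypersimplexFace, finrank_zeroSumSubspace]

/-! ### The volume of a face -/

/-- Relative to the basis `e_i - e_j` with `i ≠ j` free, the face is described up to translation by
its free coordinates other than `j`. The bounds `0 ≤ x_j ≤ 1` become the bounds on the sum of the
others, and a slice of the cube results. -/
theorem IsFaceIndex.vol_hypersimplexFace {d k : ℕ} {L U : Finset (Fin d)}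
    (h : IsFaceIndex k L U) (hne : L ≠ U) :
    vol (hypersimplexFace d k L U) =
      (eulerianNumber ((U \ L).card - 1) (k - L.card - 1) : ℝ) := by
  have hcard := h.one_lt_card_sdiff hne
  have hlt : L.card < k ∧ k < U.card := h.2.resolve_left fun h' => hne h'.1
  obtain ⟨j, hj⟩ := Finset.card_pos.1 (zero_lt_one.trans hcard)
  have hnon := (isExposed_hypersimplexFace h.1 h.card_le h.le_card).1
  rw [vol, dif_pos hnon, faceLattice, h.vectorSpan_hypersimplexFace]
  obtain ⟨x0, hx0⟩ : ∃ x0, x0 = hnon.some := ⟨_, rfl⟩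
  have hx0mem : x0 ∈ hypersimplexFace d k L U := hx0 ▸ hnon.some_mem
  rw [← hx0]
  obtain ⟨hli, hspan⟩ := linearIndependent_and_span_edgeVector (V := Fin d → ℝ) LinearMap.id hj
      (Finset.erase_subset j (U \ L)) (Finset.notMem_erase j _) (fun v hv i _ => by
        rw [LinearMap.id_apply] at hv; rw [hv]; rfl) (fun i hi hiT => by
        have : i = j := by
          by_contra h
          exact hiT (Finset.mem_erase.2 ⟨h, hi⟩)
        rw [this, edgeVector_self]; rfl) (fun _ => 1) (fun _ => rfl)
  have hid : (integerLattice d ⊓ (zeroSumSubspace (U \ L)).restrictScalars ℤ).map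
      ((LinearMap.id : (Fin d → ℝ) →ₗ[ℝ] (Fin d → ℝ)).restrictScalars ℤ) =
      integerLattice d ⊓ (zeroSumSubspace (U \ L)).restrictScalars ℤ := Submodule.map_id _
  rw [hid] at hspan
  rw [normalizedVolume_eq hli hspan]
  have hT : Fintype.card ((U \ L).erase j) = (U \ L).card - 1 := by
    rw [Fintype.card_coe, Finset.card_erase_of_mem hj]
  rw [mem_hypersimplexFace] at hx0mem
  -- The free coordinates add up to `k - L.card`, which determines the eliminated one.
  have hsum0 : x0 j = k - L.card - ∑ i : (U \ L).erase j, x0 i := by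
    have h1 : ∑ i, x0 i = ∑ i ∈ U, x0 i :=
      (Finset.sum_subset (Finset.subset_univ _) fun i _ hi => hx0mem.2.2 i hi).symm
    rw [hx0mem.1.2, ← Finset.sum_sdiff h.1, Finset.sum_congr rfl hx0mem.2.1,
      ← Finset.add_sum_erase _ _ hj, ← Finset.sum_coe_sort] at h1
    simp only [Finset.sum_const, nsmul_one] at h1
    linarith
  have hset : {c : (U \ L).erase j → ℝ | ∑ i, c i • (LinearMap.id : (Fin d → ℝ) →ₗ[ℝ] (Fin d → ℝ))
      (((1 : ℤ) : ℝ) • edgeVector j i) ∈ (fun x => x - x0) '' hypersimplexFace d k L U} =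
      (fun c => c + fun i : (U \ L).erase j => x0 i) ⁻¹'
        {x : (U \ L).erase j → ℝ | (∀ i, 0 ≤ x i ∧ x i ≤ 1) ∧
          ((k - L.card - 1 : ℕ) : ℝ) ≤ ∑ i, x i ∧ ∑ i, x i ≤ ((k - L.card - 1 : ℕ) : ℝ) + 1} := by
    have hcast : ((k - L.card - 1 : ℕ) : ℝ) = k - L.card - 1 := by
      rw [Nat.sub_sub, Nat.cast_sub (by omega)]
      push_cast; ring
    ext c
    have hmem : ∀ v : Fin d → ℝ, v ∈ (fun x => x - x0) '' hypersimplexFace d k L U ↔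
        v + x0 ∈ hypersimplexFace d k L U := fun v =>
      ⟨by rintro ⟨x, hx, rfl⟩; simpa using hx, fun hv => ⟨_, hv, by simp⟩⟩
    simp only [Set.mem_ofPred_eq, Set.mem_preimage, hmem, mem_hypersimplexFace, hcast]
    have hv : ∀ l, (∑ i, c i • (LinearMap.id : (Fin d → ℝ) →ₗ[ℝ] (Fin d → ℝ))
        (((1 : ℤ) : ℝ) • edgeVector j i) + x0) l =
        ∑ i : (U \ L).erase j, (if l = i then c i else 0) - (if l = j then ∑ i, c i else 0) + x0 l := by
      intro l
      simp only [LinearMap.id_apply, Int.cast_one, one_smul, Pi.add_apply, Finset.sum_apply,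
        Pi.smul_apply, edgeVector_apply, smul_eq_mul, mul_sub, Finset.sum_sub_distrib,
        mul_ite, mul_one, mul_zero]
      split_ifs <;> simp
    have hvT : ∀ l : (U \ L).erase j, (∑ i, c i • (LinearMap.id : (Fin d → ℝ) →ₗ[ℝ] (Fin d → ℝ))
        (((1 : ℤ) : ℝ) • edgeVector j i) + x0) l = c l + x0 l := fun l => by
      rw [hv, if_neg (Finset.ne_of_mem_erase l.2)]
      simp
    have hvj : (∑ i, c i • (LinearMap.id : (Fin d → ℝ) →ₗ[ℝ] (Fin d → ℝ))
        (((1 : ℤ) : ℝ) • edgeVector j i) + x0) j = x0 j - ∑ i, c i := by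
      rw [hv, if_pos rfl, Finset.sum_eq_zero fun i _ =>
        if_neg fun h => Finset.ne_of_mem_erase i.2 h.symm]
      ring
    have hvo : ∀ l, l ∉ U \ L → (∑ i, c i • (LinearMap.id : (Fin d → ℝ) →ₗ[ℝ] (Fin d → ℝ))
        (((1 : ℤ) : ℝ) • edgeVector j i) + x0) l = x0 l := fun l hl => by
      have h0 : ∑ i : (U \ L).erase j, (if l = i then c i else 0) = 0 :=
        Finset.sum_eq_zero fun i _ =>
          if_neg fun h : l = i.1 => hl (h ▸ Finset.mem_of_mem_erase i.2)
      rw [hv, if_neg fun h : l = j => hl (h ▸ hj), h0]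
      ring
    have hvs : ∑ l, (∑ i, c i • (LinearMap.id : (Fin d → ℝ) →ₗ[ℝ] (Fin d → ℝ))
        (((1 : ℤ) : ℝ) • edgeVector j i) + x0) l = k := by
      simp only [hv, Finset.sum_add_distrib, Finset.sum_sub_distrib, hx0mem.1.2]
      rw [Finset.sum_comm]
      simp
    generalize (∑ i, c i • (LinearMap.id : (Fin d → ℝ) →ₗ[ℝ] (Fin d → ℝ))
        (((1 : ℤ) : ℝ) • edgeVector j i) + x0) = v at *
    have hsumT : ∑ i : (U \ L).erase j, (c + fun i : (U \ L).erase j => x0 i) i =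
        k - L.card - v j := by
      simp only [Pi.add_apply, Finset.sum_add_distrib]
      rw [hvj, hsum0]; ring
    rw [hsumT]
    constructor
    · rintro ⟨⟨h1, -⟩, -, -⟩
      refine ⟨fun i => ?_, by linarith [(h1 j).2], by linarith [(h1 j).1]⟩
      rw [Pi.add_apply, ← hvT]
      exact h1 i
    · rintro ⟨h1, h2, h3⟩
      refine ⟨⟨fun l => ?_, hvs⟩, fun l hl => ?_, fun l hl => ?_⟩
      · by_cases hlj : l = j
        · rw [hlj]; constructor <;> linarith
        · by_cases hl : l ∈ U \ L
          · have := h1 ⟨l, Finset.mem_erase.2 ⟨hlj, hl⟩⟩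
            rw [Pi.add_apply, ← hvT] at this
            exact this
          · rw [hvo l hl]
            exact hx0mem.1.1 l
      · rw [hvo l (by simp [hl])]
        exact hx0mem.2.1 l hl
      · rw [hvo l (by simp [hl])]
        exact hx0mem.2.2 l hl
  rw [hset, measure_preimage_add_right, volume_cube_slice (by rw [hT]; omega), hT,
    ENNReal.toReal_mul, ENNReal.toReal_inv, ENNReal.toReal_natCast, ENNReal.toReal_natCast]
  field_simp

/-- The lattice is zero with empty basis, and the one-point space `ℝ⁰` has volume `1`. -/
theorem IsFaceIndex.vol_hypersimplexFace_vertex {d k : ℕ} {S : Finset (Fin d)} (hS : S.card = k) :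
    vol (hypersimplexFace d k S S) = 1 := by
  have h : IsFaceIndex k S S := ⟨subset_rfl, Or.inl ⟨rfl, hS⟩⟩
  have hnon := (isExposed_hypersimplexFace h.1 h.card_le h.le_card).1
  rw [vol, dif_pos hnon, faceLattice, h.vectorSpan_hypersimplexFace]
  have hbot : zeroSumSubspace (S \ S) = ⊥ := by
    rw [eq_bot_iff]
    intro v hv
    rw [Submodule.mem_bot]
    ext i
    exact hv.1 i (by simp)
  rw [normalizedVolume_eq (ι := Fin 0) (b := fun _ => 0) (linearIndependent_empty_type)]
  · have : {c : Fin 0 → ℝ | ∑ i, c i • (0 : Fin d → ℝ) ∈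
        (fun x => x - hnon.some) '' hypersimplexFace d k S S} = cube 0 := by
      ext c
      simp only [Set.mem_ofPred_eq, Finset.univ_eq_empty, Finset.sum_empty, mem_cube,
        IsEmpty.forall_iff, iff_true]
      exact ⟨_, hnon.some_mem, sub_self _⟩
    rw [this, volume_cube]
    simp
  · rw [hbot]
    ext v
    simp

/-! ### Subdiagram volumes -/

/-- If the cone `K` over a configuration `C` with apex `0` is cut at height `1` inside the convex hull
of the nonzero points of `C`, and these points have height at least `1`, then the subdiagram part
of `C` is the part of `K` below height `1`. -/
theorem convexHull_diff_convexHull_diff_zero {V : Type*} [AddCommGroup V] [Module ℝ V]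
    {C K : Set V} (t : V →ₗ[ℝ] ℝ) (hK : Convex ℝ K) (hsmul : ∀ q ∈ K, ∀ r : ℝ, 0 < r → r • q ∈ K)
    (hCK : C ⊆ K) (h0 : (0 : V) ∈ C) (ht : ∀ c ∈ C, c ≠ 0 → 1 ≤ t c)
    (hpos : ∀ q ∈ K, t q ≤ 0 → q = 0) (hone : ∀ q ∈ K, t q = 1 → q ∈ convexHull ℝ (C \ {0})) :
    convexHull ℝ C \ convexHull ℝ (C \ {0}) = {q | q ∈ K ∧ t q < 1} := by
  have hK0 : (0 : V) ∈ K := hCK h0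
  have hge : ∀ q ∈ convexHull ℝ (C \ {0}), 1 ≤ t q := fun q hq => by
    have : convexHull ℝ (C \ {0}) ⊆ {q | 1 ≤ t q} :=
      convexHull_min (fun c hc => ht c hc.1 hc.2) (convex_halfSpace_ge t.isLinear 1)
    exact this hq
  have hscale : ∀ q ∈ K, 0 < t q → (t q)⁻¹ • q ∈ convexHull ℝ (C \ {0}) := fun q hq hpos =>
    hone _ (hsmul q hq _ (inv_pos.2 hpos)) (by
      rw [map_smul, smul_eq_mul, inv_mul_cancel₀ hpos.ne'])
  have hKC : convexHull ℝ C ⊆ K := convexHull_min hCK hK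
  ext q
  constructor
  · rintro ⟨hq, hnot⟩
    refine ⟨hKC hq, ?_⟩
    by_contra hcon
    rw [not_lt] at hcon
    apply hnot
    -- The hull of `C` is the join of `0` with the hull of its nonzero points, so the given point is
    -- `b • y` with `y` in that hull and `b ≤ 1`.
    have hins : C = insert 0 (C \ {0}) := by
      rw [Set.insert_sdiff_singleton, Set.insert_eq_of_mem h0]
    have hne : (C \ {0}).Nonempty := by
      rw [Set.nonempty_iff_ne_empty]
      intro hemp
      rw [hins, hemp] at hq
      simp at hq
      rw [hq, map_zero] at hcon
      linarith
    rw [hins, convexHull_insert hne, mem_convexJoin] at hq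
    obtain ⟨x, hx, y, hy, hxy⟩ := hq
    rw [Set.mem_singleton_iff.1 hx] at hxy
    obtain ⟨a, b, ha, hb, hab, rfl⟩ := hxy
    rw [smul_zero, zero_add] at hcon ⊢
    rw [map_smul, smul_eq_mul] at hcon
    have h1 := hge y hy
    have hyK : y ∈ K := hKC (convexHull_mono Set.sdiff_subset hy)
    have h2 := hscale y hyK (by linarith)
    -- The point `b • y` has height between `1` and `t y`, so it lies on the segment from `(t y)⁻¹ •
    -- y`, of height `1`, to `y`. Both ends are in the hull; the weights in `h4` are read off from
    -- the heights.
    rcases h1.eq_or_lt with h3 | h3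
    · have : b = 1 := le_antisymm (by linarith) (by rw [← h3] at hcon; linarith)
      rwa [this, one_smul]
    · have hd : 0 < t y - 1 := by linarith
      have h4 : b • y = ((1 - b) * t y / (t y - 1)) • ((t y)⁻¹ • y) +
          ((b * t y - 1) / (t y - 1)) • y := by
        rw [smul_smul, ← add_smul]
        congr 1
        field_simp
        ring
      rw [h4]
      refine (convex_convexHull ℝ _) h2 hy ?_ ?_ ?_
      · have : 0 ≤ 1 - b := by linarith
        positivity
      · exact div_nonneg (by linarith) hd.le
      · field_simp
        ring
  · rintro ⟨hqK, hlt⟩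
    refine ⟨?_, fun h => (hge q h).not_gt hlt⟩
    rcases le_or_gt (t q) 0 with h | h
    · rw [hpos q hqK h]
      exact subset_convexHull ℝ C h0
    · have h2 := convexHull_mono Set.sdiff_subset (hscale q hqK h)
      have h3 : q = (1 - t q) • (0 : V) + t q • ((t q)⁻¹ • q) := by
        rw [smul_zero, zero_add, smul_smul, mul_inv_cancel₀ h.ne', one_smul]
      rw [h3]
      exact (convex_convexHull ℝ C) (subset_convexHull ℝ C h0) h2 (by linarith) h.le (by ring)

/-- The same description for a configuration in a quotient space, in terms of representatives. -/
theorem mkQ_mem_convexHull_diff_iff {E : Type*} [AddCommGroup E] [Module ℝ E] (N : Submodule ℝ E)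
    {C K : Set E} (t : E →ₗ[ℝ] ℝ) (hK : Convex ℝ K) (hsmul : ∀ q ∈ K, ∀ r : ℝ, 0 < r → r • q ∈ K)
    (hadd : ∀ v ∈ K, ∀ w ∈ N, v + w ∈ K) (htN : ∀ w ∈ N, t w = 0)
    (hCK : C ⊆ K) (h0 : (0 : E) ∈ C) (ht : ∀ c ∈ C, c ∉ N → 1 ≤ t c)
    (hpos : ∀ v ∈ K, t v ≤ 0 → v ∈ N)
    (hone : ∀ v ∈ K, t v = 1 → ∃ u ∈ convexHull ℝ {c | c ∈ C ∧ t c = 1}, v - u ∈ N) (v : E) :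
    N.mkQ v ∈ convexHull ℝ (N.mkQ '' C) \ convexHull ℝ (N.mkQ '' C \ {0}) ↔ v ∈ K ∧ t v < 1 := by
  have hker : N ≤ LinearMap.ker t := fun w hw => htN w hw
  have hz : ∀ u, N.mkQ u = 0 ↔ u ∈ N := fun u => by
    rw [Submodule.mkQ_apply, Submodule.Quotient.mk_eq_zero]
  have hlift : ∀ u, N.liftQ t hker (N.mkQ u) = t u := fun u => Submodule.liftQ_apply N t u
  rw [convexHull_diff_convexHull_diff_zero (K := N.mkQ '' K) (N.liftQ t hker)
    (hK.linear_image N.mkQ)]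
  · rw [Set.mem_ofPred_eq, hlift]
    refine and_congr_left fun _ => ⟨?_, fun h => ⟨v, h, rfl⟩⟩
    rintro ⟨u, hu, huv⟩
    have : v - u ∈ N := by rw [← hz, map_sub, huv, sub_self]
    simpa using hadd u hu _ this
  · rintro _ ⟨u, hu, rfl⟩ r hr
    exact ⟨r • u, hsmul u hu r hr, map_smul _ _ _⟩
  · exact Set.image_mono hCK
  · exact ⟨0, h0, map_zero _⟩
  · rintro _ ⟨c, hc, rfl⟩ hne
    rw [hlift]
    exact ht c hc fun h => hne ((hz c).2 h)
  · rintro _ ⟨u, hu, rfl⟩ hle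
    rw [hlift] at hle
    exact (hz u).2 (hpos u hu hle)
  · rintro _ ⟨u, hu, rfl⟩ heq
    rw [hlift] at heq
    obtain ⟨u', hu', hN⟩ := hone u hu heq
    have h1 : N.mkQ u = N.mkQ u' := by rw [← sub_eq_zero, ← map_sub, hz]; exact hN
    rw [h1]
    have h2 : N.mkQ u' ∈ N.mkQ '' convexHull ℝ {c | c ∈ C ∧ t c = 1} := ⟨u', hu', rfl⟩
    rw [LinearMap.image_convexHull] at h2
    refine convexHull_mono ?_ h2
    rintro _ ⟨c, ⟨hc, htc⟩, rfl⟩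
    refine ⟨⟨c, hc, rfl⟩, fun h => ?_⟩
    rw [Set.mem_singleton_iff, hz] at h
    rw [htN c h] at htc
    exact zero_ne_one htc

/-! ### Configurations and tangent cones of pairs of faces. -/

/-- The differences between the vertices of a face and those of a smaller face. -/
def differenceConfiguration {d : ℕ} (k : ℕ) (L' U' L U : Finset (Fin d)) : Set (Fin d → ℝ) :=
  {v | ∃ s s' : Finset (Fin d), (s.card = k ∧ L' ⊆ s ∧ s ⊆ U') ∧
    (s'.card = k ∧ L ⊆ s' ∧ s' ⊆ U) ∧ v = indicatorVector s - indicatorVector s'}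

theorem quotientConfiguration_faceOfIndex {d k : ℕ}
    (p q : {p : Finset (Fin d) × Finset (Fin d) // IsFaceIndex k p.1 p.2}) :
    quotientConfiguration (hypersimplexMatrix d k) (faceOfIndex p) (faceOfIndex q) =
      (vectorSpan ℝ (faceOfIndex q).1).mkQ ''
        differenceConfiguration k p.1.1 p.1.2 q.1.1 q.1.2 := by
  ext x
  constructor
  · rintro ⟨s, s', h1, h2, rfl⟩
    rw [column_hypersimplexMatrix] at h1 h2
    refine ⟨_, ⟨s.1, s'.1, ⟨s.2, ?_⟩, ⟨s'.2, ?_⟩, rfl⟩, ?_⟩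
    · exact (indicatorVector_mem_hypersimplexFace s.2).1 h1
    · exact (indicatorVector_mem_hypersimplexFace s'.2).1 h2
    · rw [column_hypersimplexMatrix, column_hypersimplexMatrix]
  · rintro ⟨_, ⟨s, s', ⟨h1, h2⟩, ⟨h3, h4⟩, rfl⟩, rfl⟩
    refine ⟨⟨s, h1⟩, ⟨s', h3⟩, ?_, ?_, ?_⟩
    · rw [column_hypersimplexMatrix]
      exact (indicatorVector_mem_hypersimplexFace h1).2 h2
    · rw [column_hypersimplexMatrix]
      exact (indicatorVector_mem_hypersimplexFace h3).2 h4
    · rw [column_hypersimplexMatrix, column_hypersimplexMatrix]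

/-- The sign of a coordinate in the tangent cone of a face: `-1` on `L`. -/
def coneSign {d : ℕ} (L : Finset (Fin d)) (i : Fin d) : ℤ := if i ∈ L then -1 else 1

theorem coneSign_mul_self {d : ℕ} (L : Finset (Fin d)) (i : Fin d) :
    coneSign L i * coneSign L i = 1 := by
  unfold coneSign; split_ifs <;> rfl

/-- The tangent cone of the face with index `(L', U')` along the face with index `(L, U)`. -/
def tangentCone {d : ℕ} (L' U' L U : Finset (Fin d)) : Set (Fin d → ℝ) :=
  {v | v ∈ zeroSumSubspace (U' \ L') ∧
    ∀ i ∈ (U' \ L') \ (U \ L), 0 ≤ (coneSign L i : ℝ) * v i}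

theorem convex_tangentCone {d : ℕ} (L' U' L U : Finset (Fin d)) :
    Convex ℝ (tangentCone L' U' L U) := by
  intro x hx y hy a b ha hb _
  refine ⟨Submodule.add_mem _ (Submodule.smul_mem _ _ hx.1) (Submodule.smul_mem _ _ hy.1),
    fun i hi => ?_⟩
  have h1 := mul_nonneg ha (hx.2 i hi)
  have h2 := mul_nonneg hb (hy.2 i hi)
  simp only [Pi.add_apply, Pi.smul_apply, smul_eq_mul]
  linarith

theorem smul_mem_tangentCone {d : ℕ} {L' U' L U : Finset (Fin d)} {v : Fin d → ℝ}
    (hv : v ∈ tangentCone L' U' L U) {r : ℝ} (hr : 0 < r) : r • v ∈ tangentCone L' U' L U := by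
  refine ⟨Submodule.smul_mem _ _ hv.1, fun i hi => ?_⟩
  have h1 := mul_nonneg hr.le (hv.2 i hi)
  simp only [Pi.smul_apply, smul_eq_mul]
  linarith

theorem add_mem_tangentCone {d : ℕ} {L' U' L U : Finset (Fin d)} (hL : L' ⊆ L) (hU : U ⊆ U')
    {v : Fin d → ℝ} (hv : v ∈ tangentCone L' U' L U) {w : Fin d → ℝ}
    (hw : w ∈ zeroSumSubspace (U \ L)) : v + w ∈ tangentCone L' U' L U := by
  refine ⟨Submodule.add_mem _ hv.1
    ⟨fun i hi => hw.1 i fun h => hi (Finset.sdiff_subset_sdiff hU hL h), hw.2⟩, fun i hi => ?_⟩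
  rw [Pi.add_apply, hw.1 i (Finset.mem_sdiff.1 hi).2, add_zero]
  exact hv.2 i hi

/-- A vertex of the smaller face has entry `1` on `L`, where a difference can only be nonpositive,
and `0` outside `U`, where it can only be nonnegative. -/
theorem differenceConfiguration_subset_tangentCone {d k : ℕ} {L' U' L U : Finset (Fin d)}
    (hL : L' ⊆ L) (hU : U ⊆ U') :
    differenceConfiguration k L' U' L U ⊆ tangentCone L' U' L U := by
  rintro _ ⟨s, s', ⟨hs, hs1, hs2⟩, ⟨hs', hs1', hs2'⟩, rfl⟩
  refine ⟨⟨fun i hi => ?_, by simp [sum_indicatorVector, hs, hs']⟩, fun i hi => ?_⟩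
  · by_cases hiU : i ∈ U'
    · have : i ∈ L' := by simpa [hiU] using hi
      simp [indicatorVector, hs1 this, hs1' (hL this)]
    · have h1 : i ∉ s := fun h => hiU (hs2 h)
      have h2 : i ∉ s' := fun h => hiU (hU (hs2' h))
      simp [indicatorVector, h1, h2]
  · have hi2 := (Finset.mem_sdiff.1 hi).2
    by_cases hiL : i ∈ L
    · have h1 := indicatorVector_le_one s i
      have h2 : indicatorVector s' i = 1 := by simp [indicatorVector, hs1' hiL]
      simp only [coneSign, hiL, if_true, Pi.sub_apply, h2]
      push_cast
      linarith
    · have h1 := indicatorVector_nonneg s i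
      have hiU : i ∉ U := fun h => hi2 (Finset.mem_sdiff.2 ⟨h, hiL⟩)
      have h3 : i ∉ s' := fun h => hiU (hs2' h)
      have h2 : indicatorVector s' i = 0 := by simp [indicatorVector, h3]
      simp only [coneSign, hiL, if_false, Pi.sub_apply, h2]
      push_cast
      linarith

theorem zero_mem_differenceConfiguration {d k : ℕ} {L' U' L U : Finset (Fin d)}
    (h : IsFaceIndex k L U) (hL : L' ⊆ L) (hU : U ⊆ U') :
    (0 : Fin d → ℝ) ∈ differenceConfiguration k L' U' L U := by
  obtain ⟨s, h1, h2, h3⟩ := Finset.exists_subsuperset_card_eq h.1 h.card_le h.le_card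
  exact ⟨s, s, ⟨h3, hL.trans h1, h2.trans hU⟩, ⟨h3, h1, h2⟩, (sub_self _).symm⟩

theorem faceLattice_faceOfIndex {d k : ℕ}
    (p : {p : Finset (Fin d) × Finset (Fin d) // IsFaceIndex k p.1 p.2}) :
    faceLattice (faceOfIndex p).1 =
      integerLattice d ⊓ (zeroSumSubspace (p.1.2 \ p.1.1)).restrictScalars ℤ := by
  rw [faceLattice]
  congr 2
  exact p.2.vectorSpan_hypersimplexFace

theorem vectorSpan_faceOfIndex {d k : ℕ}
    (p : {p : Finset (Fin d) × Finset (Fin d) // IsFaceIndex k p.1 p.2}) :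
    vectorSpan ℝ (faceOfIndex p).1 = zeroSumSubspace (p.1.2 \ p.1.1) :=
  p.2.vectorSpan_hypersimplexFace

/-- The subdiagram volume of a pair of faces in coordinates. -/
theorem subdiagramVolume_faceOfIndex {d k : ℕ}
    (p q : {p : Finset (Fin d) × Finset (Fin d) // IsFaceIndex k p.1 p.2})
    (hL : p.1.1 ⊆ q.1.1) (hU : q.1.2 ⊆ p.1.2) (t : (Fin d → ℝ) →ₗ[ℝ] ℝ)
    (htN : ∀ w ∈ zeroSumSubspace (q.1.2 \ q.1.1), t w = 0)
    (ht : ∀ c ∈ differenceConfiguration k p.1.1 p.1.2 q.1.1 q.1.2,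
      c ∉ zeroSumSubspace (q.1.2 \ q.1.1) → 1 ≤ t c)
    (hpos : ∀ v ∈ tangentCone p.1.1 p.1.2 q.1.1 q.1.2, t v ≤ 0 →
      v ∈ zeroSumSubspace (q.1.2 \ q.1.1))
    (hone : ∀ v ∈ tangentCone p.1.1 p.1.2 q.1.1 q.1.2, t v = 1 →
      ∃ u ∈ convexHull ℝ {c | c ∈ differenceConfiguration k p.1.1 p.1.2 q.1.1 q.1.2 ∧ t c = 1},
        v - u ∈ zeroSumSubspace (q.1.2 \ q.1.1))
    {j : Fin d} {T : Finset (Fin d)} (hj : j ∈ p.1.2 \ p.1.1) (hTF : T ⊆ p.1.2 \ p.1.1)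
    (hjT : j ∉ T) (hTq : ∀ i ∈ T, i ∉ q.1.2 \ q.1.1)
    (hzero : ∀ i ∈ p.1.2 \ p.1.1, i ∉ T → edgeVector j i ∈ zeroSumSubspace (q.1.2 \ q.1.1)) :
    subdiagramVolume (hypersimplexMatrix d k) (faceOfIndex p) (faceOfIndex q) =
      (T.card.factorial : ℝ) * (volume {c : T → ℝ |
        (∑ i, c i • ((coneSign q.1.1 i : ℝ) • edgeVector j i)) ∈
            tangentCone p.1.1 p.1.2 q.1.1 q.1.2 ∧
          t (∑ i, c i • ((coneSign q.1.1 i : ℝ) • edgeVector j i)) < 1}).toReal := by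
  have hN := vectorSpan_faceOfIndex q
  have hz : ∀ u, (vectorSpan ℝ (faceOfIndex q).1).mkQ u = 0 ↔
      u ∈ zeroSumSubspace (q.1.2 \ q.1.1) := fun u => by
    rw [Submodule.mkQ_apply, Submodule.Quotient.mk_eq_zero, hN]
  obtain ⟨hli, hspan⟩ := linearIndependent_and_span_edgeVector
    (vectorSpan ℝ (faceOfIndex q).1).mkQ hj hTF hjT
    (fun v hv i hi => ((hz v).1 hv).1 i (hTq i hi)) (fun i hi hiT => (hz _).2 (hzero i hi hiT))
    (coneSign q.1.1) (coneSign_mul_self q.1.1)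
  rw [← faceLattice_faceOfIndex] at hspan
  rw [subdiagramVolume, quotientLattice, normalizedVolume_eq hli hspan, Fintype.card_coe,
    quotientConfiguration_faceOfIndex]
  congr 3
  ext c
  rw [Set.mem_ofPred_eq, Set.mem_ofPred_eq, ← mkQ_mem_convexHull_diff_iff
    (vectorSpan ℝ (faceOfIndex q).1) t (convex_tangentCone p.1.1 p.1.2 q.1.1 q.1.2)
    (fun v hv r hr => smul_mem_tangentCone hv hr)
    (fun v hv w hw => add_mem_tangentCone hL hU hv (hN ▸ hw)) (fun w hw => htN w (hN ▸ hw))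
    (differenceConfiguration_subset_tangentCone (k := k) hL hU)
    (zero_mem_differenceConfiguration q.2 hL hU)
    (fun c hc hcN => ht c hc (hN ▸ hcN)) (fun v hv hle => hN ▸ hpos v hv hle)
    (fun v hv h1 => hN ▸ hone v hv h1)]
  rw [map_sum]
  simp only [map_smul]

theorem sum_smul_edgeVector_apply_of_mem {d : ℕ} {T : Finset (Fin d)} {j : Fin d} (hj : j ∉ T)
    (ε : Fin d → ℤ) (c : T → ℝ) (l : T) :
    (∑ i, c i • ((ε i : ℝ) • edgeVector j (i : Fin d))) l = c l * ε l := by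
  have hlj : (l : Fin d) ≠ j := fun h => hj (h ▸ l.2)
  simp [Finset.sum_apply, edgeVector_apply, if_neg hlj]

theorem sum_smul_edgeVector_apply_self {d : ℕ} {T : Finset (Fin d)} {j : Fin d} (hj : j ∉ T)
    (ε : Fin d → ℤ) (c : T → ℝ) :
    (∑ i, c i • ((ε i : ℝ) • edgeVector j (i : Fin d))) j = -∑ i, c i * ε i := by
  have h : ∀ i : T, ¬ j = (i : Fin d) := fun i h => hj (h ▸ i.2)
  simp [Finset.sum_apply, edgeVector_apply, h]

theorem sum_smul_edgeVector_mem {d : ℕ} {F T : Finset (Fin d)} {j : Fin d} (hj : j ∈ F)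
    (hT : T ⊆ F) (ε : Fin d → ℤ) (c : T → ℝ) :
    ∑ i, c i • ((ε i : ℝ) • edgeVector j (i : Fin d)) ∈ zeroSumSubspace F :=
  sum_mem fun i _ => Submodule.smul_mem _ _ (Submodule.smul_mem _ _
    (edgeVector_mem_zeroSumSubspace (hT i.2) hj))

/-- Entries of a difference of indicator vectors are `-1`, `0` or `1`. This yields the lower bound
`1` on the height of the configuration points outside the smaller face's linear space. -/
theorem coneSign_mul_eq_one {d k : ℕ} {L' U' L U : Finset (Fin d)} {c : Fin d → ℝ}
    (hc : c ∈ differenceConfiguration k L' U' L U) {i : Fin d} (h : 0 ≤ (coneSign L i : ℝ) * c i)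
    (hne : c i ≠ 0) : (coneSign L i : ℝ) * c i = 1 := by
  obtain ⟨s, s', -, -, rfl⟩ := hc
  have h0 : (indicatorVector s - indicatorVector s') i = 1 ∨
      (indicatorVector s - indicatorVector s') i = -1 ∨
      (indicatorVector s - indicatorVector s') i = 0 := by
    simp only [Pi.sub_apply, indicatorVector]
    split_ifs <;> simp
  unfold coneSign at *
  rcases h0 with h0 | h0 | h0
  · rw [h0] at h ⊢
    split_ifs at h ⊢
    · norm_num at h
    · simp
  · rw [h0] at h ⊢
    split_ifs at h ⊢
    · simp
    · norm_num at h
  · exact absurd h0 hne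

/-- These are the generators of the cone modulo the smaller face. An element `i` of `L` is exchanged
for the free `j`, or `j` for an `i` outside `U`; the strict inequalities on cardinalities leave room
for the exchange. -/
theorem coneSign_smul_edgeVector_mem {d k : ℕ} {L' U' L U : Finset (Fin d)}
    (hL : L' ⊆ L) (hLU : L ⊆ U) (hU : U ⊆ U') (hlt : L.card < k ∧ k < U.card) {i j : Fin d}
    (hj : j ∈ U \ L) (hi : i ∈ (U' \ L') \ (U \ L)) :
    (coneSign L i : ℝ) • edgeVector j i ∈ differenceConfiguration k L' U' L U := by
  simp only [Finset.mem_sdiff, not_and, not_not] at hi hj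
  by_cases hiL : i ∈ L
  · have hij : i ≠ j := fun h => hj.2 (h ▸ hiL)
    have hc1 := Finset.card_erase_of_mem hiL
    have hc2 := Finset.card_erase_of_mem (hLU hiL)
    have hc3 := Finset.card_erase_of_mem (Finset.mem_erase.2 ⟨hij.symm, hj.1⟩)
    have hpos : 0 < L.card := Finset.card_pos.2 ⟨i, hiL⟩
    obtain ⟨t, h1, h2, h3, h4, h5⟩ := exists_indicatorVector_sub_eq (k := k) (i := j) (j := i)
      (A := L.erase i) (B := (U.erase i).erase j)
      (Finset.subset_erase.2 ⟨Finset.erase_subset_erase _ hLU, fun h =>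
        hj.2 (Finset.mem_of_mem_erase h)⟩) (by omega) (by omega) (by simp) (by simp)
    have h2' : t ⊆ U := h2.trans ((Finset.erase_subset _ _).trans (Finset.erase_subset _ _))
    refine ⟨insert j t, insert i t, ⟨h3, fun l hl => ?_, ?_⟩, ⟨h4, ?_, ?_⟩, ?_⟩
    · refine Finset.mem_insert_of_mem (h1 (Finset.mem_erase.2 ⟨?_, hL hl⟩))
      exact fun h => hi.1.2 (h ▸ hl)
    · exact Finset.insert_subset (hU hj.1) (h2'.trans hU)
    · rw [← Finset.insert_erase hiL]
      exact Finset.insert_subset_insert _ h1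
    · exact Finset.insert_subset (hLU hiL) h2'
    · rw [h5]
      simp [coneSign, hiL, edgeVector]
  · have hiU : i ∉ U := fun h => hiL (hi.2 h)
    have hc := Finset.card_erase_of_mem hj.1
    obtain ⟨t, h1, h2, h3, h4, h5⟩ := exists_indicatorVector_sub_eq (k := k) (i := i) (j := j)
      (A := L) (B := U.erase j)
      (Finset.subset_erase.2 ⟨hLU, hj.2⟩) (by omega) (by omega)
      (fun h => hiU (Finset.mem_of_mem_erase h)) (by simp)
    have h2' : t ⊆ U := h2.trans (Finset.erase_subset _ _)
    refine ⟨insert i t, insert j t, ⟨h3, (hL.trans h1).trans (Finset.subset_insert _ _), ?_⟩,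
      ⟨h4, h1.trans (Finset.subset_insert _ _), Finset.insert_subset hj.1 h2'⟩, ?_⟩
    · exact Finset.insert_subset hi.1.1 (h2'.trans hU)
    · rw [h5]
      simp [coneSign, hiL]

/-- Modulo the smaller face the cone is an orthant whose generators form a lattice basis and belong
to the configuration. With the sum of the signed coordinates as height, the subdiagram part is a
unimodular simplex. -/
theorem subdiagramVolume_eq_one {d k : ℕ}
    (p q : {p : Finset (Fin d) × Finset (Fin d) // IsFaceIndex k p.1 p.2})
    (hL : p.1.1 ⊆ q.1.1) (hU : q.1.2 ⊆ p.1.2) (hq : q.1.1 ≠ q.1.2) :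
    subdiagramVolume (hypersimplexMatrix d k) (faceOfIndex p) (faceOfIndex q) = 1 := by
  obtain ⟨⟨L', U'⟩, hp'⟩ := p
  obtain ⟨⟨L, U⟩, hq'⟩ := q
  simp only at hL hU hq
  have hlt : L.card < k ∧ k < U.card := hq'.2.resolve_left fun h' => hq h'.1
  obtain ⟨j, hj⟩ := Finset.card_pos.1 (zero_lt_one.trans (hq'.one_lt_card_sdiff hq))
  have hFF : U \ L ⊆ U' \ L' := Finset.sdiff_subset_sdiff hU hL
  have hjT : j ∉ (U' \ L') \ (U \ L) := fun h => (Finset.mem_sdiff.1 h).2 hj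
  let t : (Fin d → ℝ) →ₗ[ℝ] ℝ := ∑ i ∈ (U' \ L') \ (U \ L),
    (coneSign L i : ℝ) • LinearMap.proj (R := ℝ) (φ := fun _ : Fin d => ℝ) i
  have ht : ∀ v, t v = ∑ i ∈ (U' \ L') \ (U \ L), (coneSign L i : ℝ) * v i := fun v => by
    simp [t]
  have hNT : ∀ v ∈ zeroSumSubspace (U' \ L'), (∀ i ∈ (U' \ L') \ (U \ L), v i = 0) →
      v ∈ zeroSumSubspace (U \ L) := fun v hv h => by
    refine ⟨fun i hi => ?_, hv.2⟩
    by_cases hi' : i ∈ U' \ L'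
    · exact h i (Finset.mem_sdiff.2 ⟨hi', hi⟩)
    · exact hv.1 i hi'
  have hε0 : ∀ i, (coneSign L i : ℝ) ≠ 0 := fun i => by unfold coneSign; split_ifs <;> simp
  have hεε : ∀ i, (coneSign L i : ℝ) * coneSign L i = 1 := fun i => by
    exact_mod_cast coneSign_mul_self L i
  rw [subdiagramVolume_faceOfIndex ⟨(L', U'), hp'⟩ ⟨(L, U), hq'⟩ hL hU t (j := j)
    (T := (U' \ L') \ (U \ L))]
  · have hset : {c : ((U' \ L') \ (U \ L) : Finset (Fin d)) → ℝ |
        (∑ i, c i • ((coneSign L i : ℝ) • edgeVector j (i : Fin d))) ∈ tangentCone L' U' L U ∧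
          t (∑ i, c i • ((coneSign L i : ℝ) • edgeVector j (i : Fin d))) < 1} =
        {c | (∀ i, 0 ≤ c i) ∧ ∑ i, c i < 1} := by
      ext c
      have h1 : ∀ l : ((U' \ L') \ (U \ L) : Finset (Fin d)), (coneSign L l : ℝ) *
          (∑ i, c i • ((coneSign L i : ℝ) • edgeVector j (i : Fin d))) l = c l := fun l => by
        rw [sum_smul_edgeVector_apply_of_mem hjT]
        linear_combination c l * hεε l
      have hs : t (∑ i, c i • ((coneSign L i : ℝ) • edgeVector j (i : Fin d))) = ∑ i, c i := by
        rw [ht, ← Finset.sum_congr rfl fun l _ => h1 l]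
        exact (Finset.sum_coe_sort _ fun l => (coneSign L l : ℝ) *
          (∑ i, c i • ((coneSign L i : ℝ) • edgeVector j (i : Fin d))) l).symm
      rw [Set.mem_ofPred_eq, Set.mem_ofPred_eq, hs]
      refine and_congr_left fun _ => ⟨fun h l => ?_, fun h => ⟨?_, fun i hi => ?_⟩⟩
      · rw [← h1 l]
        exact h.2 l l.2
      · exact sum_smul_edgeVector_mem (hFF hj) Finset.sdiff_subset _ _
      · exact (h ⟨i, hi⟩).trans (h1 ⟨i, hi⟩).ge
    simp only
    rw [hset, volume_simplex, Fintype.card_coe, ENNReal.toReal_inv, ENNReal.toReal_natCast]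
    field_simp
  · intro w hw
    rw [ht]
    exact Finset.sum_eq_zero fun i hi => by rw [hw.1 i (Finset.mem_sdiff.1 hi).2, mul_zero]
  · intro c hc hcN
    have hcone := differenceConfiguration_subset_tangentCone hL hU hc
    obtain ⟨i, hi, hne⟩ : ∃ i ∈ (U' \ L') \ (U \ L), c i ≠ 0 := by
      by_contra hcon
      push Not at hcon
      exact hcN (hNT c hcone.1 hcon)
    rw [ht, ← coneSign_mul_eq_one hc (hcone.2 i hi) hne]
    exact Finset.single_le_sum (f := fun i => (coneSign L i : ℝ) * c i)
      (fun i hi => hcone.2 i hi) hi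
  · intro v hv hle
    rw [ht] at hle
    have h0 := (Finset.sum_eq_zero_iff_of_nonneg fun i hi => hv.2 i hi).1
      (le_antisymm hle (Finset.sum_nonneg fun i hi => hv.2 i hi))
    exact hNT v hv.1 fun i hi => (mul_eq_zero.1 (h0 i hi)).resolve_left (hε0 i)
  · intro v hv h1
    rw [ht] at h1
    -- The signed coordinates of `v` are nonnegative and add up to its height `1`, so they serve as
    -- convex weights on the generators; what is left of `v` is supported on `U \ L`.
    refine ⟨∑ i ∈ (U' \ L') \ (U \ L),
      ((coneSign L i : ℝ) * v i) • ((coneSign L i : ℝ) • edgeVector j i), ?_, ?_⟩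
    · refine (convex_convexHull ℝ _).sum_mem (fun i hi => hv.2 i hi) h1 fun i hi =>
        subset_convexHull ℝ _ ⟨coneSign_smul_edgeVector_mem hL hq'.1 hU hlt hj hi, ?_⟩
      rw [ht, Finset.sum_eq_single_of_mem i hi]
      · have : i ≠ j := fun h => hjT (h ▸ hi)
        simp [edgeVector_apply, this, hεε]
      · intro l hl hli
        have : l ≠ j := fun h => hjT (h ▸ hl)
        simp [edgeVector_apply, this, hli]
    · have h2 : ∀ i ∈ (U' \ L') \ (U \ L), ((coneSign L i : ℝ) * v i) •
          ((coneSign L i : ℝ) • edgeVector j i) = v i • edgeVector j i := fun i _ => by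
        rw [smul_smul]
        congr 1
        linear_combination v i * hεε i
      rw [Finset.sum_congr rfl h2]
      have h3 := eq_sum_smul_edgeVector hv.1 j
      rw [← Finset.sum_sdiff hFF] at h3
      nth_rewrite 1 [h3]
      rw [add_sub_cancel_left]
      exact sum_mem fun i hi => Submodule.smul_mem _ _ (edgeVector_mem_zeroSumSubspace hi hj)
  · exact hFF hj
  · exact Finset.sdiff_subset
  · exact hjT
  · exact fun i hi => (Finset.mem_sdiff.1 hi).2
  · intro i hi hiT
    refine edgeVector_mem_zeroSumSubspace ?_ hj
    by_contra h
    exact hiT (Finset.mem_sdiff.2 ⟨hi, h⟩)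

theorem edgeVector_mem_differenceConfiguration {d k : ℕ} {L' U' S : Finset (Fin d)}
    (hS : S.card = k) (hL : L' ⊆ S) (hU : S ⊆ U') {i j : Fin d} (hi : i ∈ U' \ S)
    (hj : j ∈ S \ L') : edgeVector j i ∈ differenceConfiguration k L' U' S S := by
  rw [Finset.mem_sdiff] at hi hj
  have hij : i ∉ S.erase j := fun h => hi.2 (Finset.mem_of_mem_erase h)
  have hcard := Finset.card_erase_add_one hj.1
  refine ⟨insert i (S.erase j), S, ⟨?_, fun l hl => ?_, ?_⟩, ⟨hS, subset_rfl, subset_rfl⟩, ?_⟩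
  · rw [Finset.card_insert_of_notMem hij]; omega
  · exact Finset.mem_insert_of_mem (Finset.mem_erase.2 ⟨fun h => hj.2 (h ▸ hl), hL hl⟩)
  · exact Finset.insert_subset hi.1 ((Finset.erase_subset _ _).trans hU)
  · ext l
    rw [edgeVector_apply]
    simp only [Pi.sub_apply, indicatorVector, Finset.mem_insert, Finset.mem_erase]
    by_cases h1 : l = i
    · have h2 : l ≠ j := fun h => hi.2 (h1 ▸ h ▸ hj.1)
      have h3 : l ∉ S := h1 ▸ hi.2
      simp [h1 ▸ h2, h1 ▸ h3, h1]
    · by_cases h2 : l = j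
      · simp [h2, hj.1, h2 ▸ h1]
      · simp [h1, h2]

-- Nothing is divided out at a vertex. The cone consists of zero-sum vectors that are nonnegative on
-- `U' \ S` and nonpositive on `S \ L'`; with the total positive mass as height, its section at
-- height `1` is a product of two simplices with vertices `e_i - e_j`. Strictness of both inclusions
-- makes both simplices nonempty.
open Pointwise in
theorem subdiagramVolume_vertex {d k : ℕ}
    (p q : {p : Finset (Fin d) × Finset (Fin d) // IsFaceIndex k p.1 p.2})
    (hL : p.1.1 ⊂ q.1.1) (hU : q.1.2 ⊂ p.1.2) (hq : q.1.1 = q.1.2) :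
    subdiagramVolume (hypersimplexMatrix d k) (faceOfIndex p) (faceOfIndex q) =
      (((q.1.1 \ p.1.1).card - 1 + ((p.1.2 \ q.1.1).card - 1)).choose
        ((q.1.1 \ p.1.1).card - 1) : ℝ) := by
  obtain ⟨⟨L', U'⟩, hp'⟩ := p
  obtain ⟨⟨S, U⟩, hq'⟩ := q
  simp only at hL hU hq
  subst hq
  have hS : S.card = k := by
    rcases hq'.2 with h | h
    · exact h.2
    · exact absurd (h.1.trans h.2) (lt_irrefl _)
  simp only
  obtain ⟨j, hjS, hjL⟩ := Finset.exists_of_ssubset hL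
  obtain ⟨m, hmU, hmS⟩ := Finset.exists_of_ssubset hU
  have hj : j ∈ S \ L' := Finset.mem_sdiff.2 ⟨hjS, hjL⟩
  have hjF : j ∈ U' \ L' := Finset.mem_sdiff.2 ⟨hU.subset hjS, hjL⟩
  have hunion : U' \ L' = (U' \ S) ∪ (S \ L') := by
    ext i
    simp only [Finset.mem_sdiff, Finset.mem_union]
    constructor
    · rintro ⟨h1, h2⟩
      by_cases h : i ∈ S
      exacts [Or.inr ⟨h, h2⟩, Or.inl ⟨h1, h⟩]
    · rintro (⟨h1, h2⟩ | ⟨h1, h2⟩)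
      exacts [⟨h1, fun h => h2 (hL.subset h)⟩, ⟨hU.subset h1, h2⟩]
  have hdisj : Disjoint (U' \ S) (S \ L') := by
    rw [Finset.disjoint_left]
    intro i h1 h2
    exact (Finset.mem_sdiff.1 h1).2 (Finset.mem_sdiff.1 h2).1
  have hempty : S \ S = ∅ := Finset.sdiff_self S
  have hN : ∀ v : Fin d → ℝ, v ∈ zeroSumSubspace (S \ S) ↔ v = 0 := fun v => by
    rw [mem_zeroSumSubspace, hempty]
    constructor
    · intro h; ext i; exact h.1 i (by simp)
    · rintro rfl; simp
  let t : (Fin d → ℝ) →ₗ[ℝ] ℝ := ∑ i ∈ U' \ S,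
    LinearMap.proj (R := ℝ) (φ := fun _ : Fin d => ℝ) i
  have ht : ∀ v, t v = ∑ i ∈ U' \ S, v i := fun v => by simp [t]
  have hcone1 : ∀ v ∈ tangentCone L' U' S S, ∀ i ∈ U' \ S, 0 ≤ v i := fun v hv i hi => by
    have := hv.2 i (by rw [hempty, Finset.sdiff_empty, hunion]; exact Finset.mem_union_left _ hi)
    simpa [coneSign, (Finset.mem_sdiff.1 hi).2] using this
  have hcone2 : ∀ v ∈ tangentCone L' U' S S, ∀ i ∈ S \ L', 0 ≤ -v i := fun v hv i hi => by
    have := hv.2 i (by rw [hempty, Finset.sdiff_empty, hunion]; exact Finset.mem_union_right _ hi)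
    simpa [coneSign, (Finset.mem_sdiff.1 hi).1] using this
  have hsum : ∀ v ∈ tangentCone L' U' S S, ∑ i ∈ S \ L', -v i = t v := fun v hv => by
    have h1 : ∑ i ∈ U' \ L', v i = 0 := by
      rw [← hv.1.2]
      exact Finset.sum_subset (Finset.subset_univ _) fun i _ hi => hv.1.1 i hi
    rw [hunion, Finset.sum_union hdisj] at h1
    rw [ht, Finset.sum_neg_distrib]
    linarith
  have hzero : ∀ v ∈ zeroSumSubspace (U' \ L'), (∀ i ∈ U' \ S, v i = 0) →
      (∀ i ∈ S \ L', v i = 0) → v = 0 := fun v hv h1 h2 => by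
    ext i
    by_cases hi : i ∈ U' \ L'
    · rw [hunion, Finset.mem_union] at hi
      rcases hi with hi | hi
      exacts [h1 i hi, h2 i hi]
    · exact hv.1 i hi
  rw [subdiagramVolume_faceOfIndex ⟨(L', U'), hp'⟩ ⟨(S, S), hq'⟩ hL.subset hU.subset t (j := j)
    (T := (U' \ L').erase j)]
  · simp only
    -- The coordinate `j ∈ S \ L'` is eliminated, so `A` has one element fewer than `S \ L'`, while
    -- its complement matches all of `U' \ S`.
    let A : Finset ((U' \ L').erase j : Finset (Fin d)) :=
      Finset.univ.filter fun i => (i : Fin d) ∈ S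
    have hA : A.card = (S \ L').card - 1 := by
      rw [← Finset.card_erase_of_mem hj, ← Finset.card_map (Function.Embedding.subtype _)]
      congr 1
      ext i
      simp only [A, Finset.mem_map, Finset.mem_filter, Finset.mem_univ, true_and,
        Function.Embedding.subtype_apply, Subtype.exists, Finset.mem_erase, Finset.mem_sdiff]
      constructor
      · rintro ⟨l, ⟨h1, h2, h3⟩, h4, rfl⟩
        exact ⟨h1, h4, h3⟩
      · rintro ⟨h1, h2, h3⟩
        exact ⟨i, ⟨h1, hU.subset h2, h3⟩, h2, rfl⟩
    have hAc : Aᶜ.card = (U' \ S).card := by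
      rw [← Finset.card_map (Function.Embedding.subtype _)]
      congr 1
      ext i
      simp only [A, Finset.mem_map, Finset.mem_compl, Finset.mem_filter, Finset.mem_univ, true_and,
        Function.Embedding.subtype_apply, Subtype.exists, Finset.mem_erase, Finset.mem_sdiff]
      constructor
      · rintro ⟨l, ⟨h1, h2, h3⟩, h4, rfl⟩
        exact ⟨h2, h4⟩
      · rintro ⟨h1, h2⟩
        exact ⟨i, ⟨fun h => h2 (h ▸ hjS), h1, fun h => h2 (hL.subset h)⟩, h2, rfl⟩
    have hpos : 0 < (U' \ S).card := Finset.card_pos.2 ⟨m, Finset.mem_sdiff.2 ⟨hmU, hmS⟩⟩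
    have hvol := volume_pyramid A (q := (U' \ S).card - 1) (by omega)
    rw [hA, ← Nat.choose_symm_add, Fintype.card_coe] at hvol
    rw [← hvol]
    congr 3
    ext c
    rw [Set.mem_ofPred_eq, Set.mem_ofPred_eq]
    have hjT : j ∉ (U' \ L').erase j := Finset.notMem_erase j _
    have hFm := sum_smul_edgeVector_mem hjF (Finset.erase_subset j (U' \ L')) (coneSign S) c
    have h1 : ∀ l : ((U' \ L').erase j : Finset (Fin d)), (coneSign S l : ℝ) *
        (∑ i, c i • ((coneSign S i : ℝ) • edgeVector j (i : Fin d))) l = c l := fun l => by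
      rw [sum_smul_edgeVector_apply_of_mem hjT]
      have : (coneSign S l : ℝ) * coneSign S l = 1 := by exact_mod_cast coneSign_mul_self S l
      linear_combination c l * this
    have h2 := sum_smul_edgeVector_apply_self hjT (coneSign S) c
    generalize (∑ i, c i • ((coneSign S i : ℝ) • edgeVector j (i : Fin d))) = v at *
    have h3 : ∑ i, c i * (coneSign S i : ℝ) = ∑ i ∈ Aᶜ, c i - ∑ i ∈ A, c i := by
      rw [← Finset.sum_add_sum_compl A]
      have e1 : ∀ i ∈ A, c i * (coneSign S i : ℝ) = -c i := fun i hi => by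
        simp [coneSign, (Finset.mem_filter.1 hi).2]
      have e2 : ∀ i ∈ Aᶜ, c i * (coneSign S i : ℝ) = c i := fun i hi => by
        have : (i : Fin d) ∉ S := fun h =>
          (Finset.mem_compl.1 hi) (Finset.mem_filter.2 ⟨Finset.mem_univ _, h⟩)
        simp [coneSign, this]
      rw [Finset.sum_congr rfl e1, Finset.sum_congr rfl e2, Finset.sum_neg_distrib]
      ring
    have h4 : t v = ∑ i ∈ Aᶜ, c i := by
      rw [ht]
      refine (Finset.sum_bij (fun (i : ((U' \ L').erase j : Finset (Fin d))) _ => (i : Fin d))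
        ?_ ?_ ?_ ?_).symm
      · intro i hi
        have : (i : Fin d) ∉ S := fun h =>
          (Finset.mem_compl.1 hi) (Finset.mem_filter.2 ⟨Finset.mem_univ _, h⟩)
        exact Finset.mem_sdiff.2 ⟨(Finset.mem_sdiff.1 (Finset.mem_of_mem_erase i.2)).1, this⟩
      · intro a _ b _ h
        exact Subtype.ext h
      · intro i hi
        rw [Finset.mem_sdiff] at hi
        refine ⟨⟨i, Finset.mem_erase.2 ⟨fun h => hi.2 (h ▸ hjS),
          Finset.mem_sdiff.2 ⟨hi.1, fun h => hi.2 (hL.subset h)⟩⟩⟩, ?_, rfl⟩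
        simp [A, hi.2]
      · intro i hi
        have : (i : Fin d) ∉ S := fun h =>
          (Finset.mem_compl.1 hi) (Finset.mem_filter.2 ⟨Finset.mem_univ _, h⟩)
        rw [← h1 i]
        simp [coneSign, this]
    rw [h4, ← and_assoc]
    refine and_congr_left fun _ => ?_
    -- The sign condition at the eliminated coordinate becomes the inequality between the two
    -- partial masses in the pyramid.
    have h5 : (coneSign S j : ℝ) * v j = ∑ i ∈ Aᶜ, c i - ∑ i ∈ A, c i := by
      rw [h2, h3]
      simp [coneSign, hjS]
    constructor
    · intro hv
      refine ⟨fun i => ?_, ?_⟩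
      · rw [← h1 i]
        exact hv.2 i (by
          rw [hempty, Finset.sdiff_empty]
          exact Finset.mem_of_mem_erase i.2)
      · have := hv.2 j (by rw [hempty, Finset.sdiff_empty]; exact hjF)
        rw [h5] at this
        linarith
    · rintro ⟨hc, hle⟩
      refine ⟨hFm, fun i hi => ?_⟩
      rw [hempty, Finset.sdiff_empty] at hi
      by_cases hij : i = j
      · rw [hij, h5]; linarith
      · rw [h1 ⟨i, Finset.mem_erase.2 ⟨hij, hi⟩⟩]
        exact hc _
  · intro w hw
    rw [(hN w).1 hw, map_zero]
  · intro c hc hcN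
    have hcone := differenceConfiguration_subset_tangentCone hL.subset hU.subset hc
    obtain ⟨s, s', ⟨hs, -, hsU⟩, ⟨hs', h1, h2⟩, rfl⟩ := hc
    obtain rfl : s' = S := h2.antisymm h1
    -- Two different `k`-sets are not nested, so `s` has an element outside `S`, and it alone
    -- contributes `1` to the height.
    have hns : ¬ s ⊆ s' := fun h => hcN ((hN _).2 (by
      rw [Finset.eq_of_subset_of_card_le h (by omega), sub_self]))
    obtain ⟨i, his, hiS⟩ := Finset.not_subset.1 hns
    have h3 : (indicatorVector s - indicatorVector s') i = 1 := by
      simp [indicatorVector, his, hiS]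
    rw [ht, ← h3]
    exact Finset.single_le_sum (f := fun i => (indicatorVector s - indicatorVector s') i)
      (fun i hi => hcone1 _ hcone i hi) (Finset.mem_sdiff.2 ⟨hsU his, hiS⟩)
  · intro v hv hle
    have hs := hsum v hv
    have h0 : t v = 0 := le_antisymm hle (by
      rw [ht]; exact Finset.sum_nonneg fun i hi => hcone1 v hv i hi)
    rw [h0] at hs
    rw [ht] at h0
    refine (hN v).2 (hzero v hv.1 ?_ fun i hi => ?_)
    · exact (Finset.sum_eq_zero_iff_of_nonneg fun i hi => hcone1 v hv i hi).1 h0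
    · exact neg_eq_zero.1
        ((Finset.sum_eq_zero_iff_of_nonneg fun i hi => hcone2 v hv i hi).1 hs i hi)
  · intro v hv h1
    refine ⟨v, ?_, by rw [sub_self]; exact Submodule.zero_mem _⟩
    have hs := hsum v hv
    rw [h1] at hs
    have h1' := h1
    rw [ht] at h1'
    -- The positive part of `v` is in the hull of `X` and its negated negative part in the hull of
    -- `Y`. A difference of hulls is the hull of the differences, which are the vectors `e_i - e_l`.
    let X : Set (Fin d → ℝ) := {x | ∃ i ∈ U' \ S, x = Pi.single i 1}
    let Y : Set (Fin d → ℝ) := {x | ∃ i ∈ S \ L', x = Pi.single i 1}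
    have ha : ∑ i ∈ U' \ S, v i • (Pi.single i 1 : Fin d → ℝ) ∈ convexHull ℝ X :=
      (convex_convexHull ℝ X).sum_mem (fun i hi => hcone1 v hv i hi) h1' fun i hi =>
        subset_convexHull ℝ X ⟨i, hi, rfl⟩
    have hb : ∑ i ∈ S \ L', (-v i) • (Pi.single i 1 : Fin d → ℝ) ∈ convexHull ℝ Y :=
      (convex_convexHull ℝ Y).sum_mem (fun i hi => hcone2 v hv i hi) hs fun i hi =>
        subset_convexHull ℝ Y ⟨i, hi, rfl⟩
    have hab := Set.sub_mem_sub ha hb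
    rw [← convexHull_sub] at hab
    have hv2 : ∑ i ∈ U' \ S, v i • (Pi.single i 1 : Fin d → ℝ) -
        ∑ i ∈ S \ L', (-v i) • (Pi.single i 1 : Fin d → ℝ) = v := by
      simp only [neg_smul, Finset.sum_neg_distrib, sub_neg_eq_add]
      rw [← Finset.sum_union hdisj, ← hunion]
      conv_rhs => rw [pi_eq_sum_univ' v]
      exact Finset.sum_subset (Finset.subset_univ _) fun i _ hi => by
        rw [hv.1.1 i hi, zero_smul]
    rw [hv2] at hab
    refine convexHull_mono ?_ hab
    rintro _ ⟨_, ⟨i, hi, rfl⟩, _, ⟨l, hl, rfl⟩, rfl⟩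
    refine ⟨edgeVector_mem_differenceConfiguration hS hL.subset hU.subset hi hl, ?_⟩
    rw [ht]
    have : ∀ a ∈ U' \ S, (Pi.single i (1 : ℝ) - Pi.single l 1 : Fin d → ℝ) a =
        if a = i then 1 else 0 := fun a ha => by
      have : a ≠ l := fun h => (Finset.mem_sdiff.1 ha).2 (h ▸ (Finset.mem_sdiff.1 hl).1)
      simp [Pi.single_apply, this]
    rw [Finset.sum_congr rfl this, Finset.sum_ite_eq', if_pos hi]
  · exact hjF
  · exact Finset.erase_subset _ _
  · exact Finset.notMem_erase _ _
  · intro i _ h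
    simp at h
  · intro i hi hiT
    have : i = j := by
      by_contra h
      exact hiT (Finset.mem_erase.2 ⟨h, hi⟩)
    rw [this, edgeVector_self]
    exact Submodule.zero_mem _

/-! ### Euler obstructions -/

theorem hypersimplexFace_empty_univ (d k : ℕ) :
    hypersimplexFace d k ∅ Finset.univ = polytope (hypersimplexMatrix d k) := by
  ext x
  simp [hypersimplexFace]

theorem faceOfIndex_lt_iff {d k : ℕ} (hk : 1 ≤ k) (hkd : k ≤ d)
    (p q : {p : Finset (Fin d) × Finset (Fin d) // IsFaceIndex k p.1 p.2}) :
    faceOfIndex p < faceOfIndex q ↔ (q.1.1 ⊆ p.1.1 ∧ p.1.2 ⊆ q.1.2) ∧ p ≠ q := by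
  rw [lt_iff_le_and_ne, faceOfIndex_le_iff, (faceOfIndex_bijective hk hkd).1.ne_iff]

open Classical in
/-- Reindexing of a sum over the faces that contain a given face properly. -/
theorem sum_faces_gt {d k : ℕ} (hk : 1 ≤ k) (hkd : k ≤ d)
    (q : {p : Finset (Fin d) × Finset (Fin d) // IsFaceIndex k p.1 p.2})
    (f : Face (hypersimplexMatrix d k) → ℝ) (g : Finset (Fin d) → Finset (Fin d) → ℝ)
    (C : Finset (Fin d) × Finset (Fin d) → Prop)
    (hC : ∀ A ⊆ q.1.1, ∀ B ⊆ q.1.2ᶜ, C (A, B) ↔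
      IsFaceIndex k (q.1.1 \ A) (q.1.2 ∪ B) ∧ ¬ (A = ∅ ∧ B = ∅))
    (hfg : ∀ p, faceOfIndex q < faceOfIndex p →
      f (faceOfIndex p) = g (q.1.1 \ p.1.1) (p.1.2 \ q.1.2)) :
    ∑ α : Face (hypersimplexMatrix d k) with faceOfIndex q < α, f α =
      ∑ x ∈ (q.1.1.powerset ×ˢ q.1.2ᶜ.powerset).filter C, g x.1 x.2 := by
  -- A larger face is recorded by the set removed from `L` and the set added to `U`; the pair of
  -- empty sets is the face itself.
  have hmem : ∀ x ∈ (q.1.1.powerset ×ˢ q.1.2ᶜ.powerset).filter C, x.1 ⊆ q.1.1 ∧ x.2 ⊆ q.1.2ᶜ ∧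
      IsFaceIndex k (q.1.1 \ x.1) (q.1.2 ∪ x.2) ∧ ¬ (x.1 = ∅ ∧ x.2 = ∅) := fun x hx => by
    rw [Finset.mem_filter, Finset.mem_product, Finset.mem_powerset, Finset.mem_powerset] at hx
    exact ⟨hx.1.1, hx.1.2, (hC x.1 hx.1.1 x.2 hx.1.2).1 hx.2⟩
  have h1 : ∀ x ∈ (q.1.1.powerset ×ˢ q.1.2ᶜ.powerset).filter C, q.1.1 \ (q.1.1 \ x.1) = x.1 :=
    fun x hx => Finset.sdiff_sdiff_eq_self (hmem x hx).1
  have h2 : ∀ x ∈ (q.1.1.powerset ×ˢ q.1.2ᶜ.powerset).filter C, (q.1.2 ∪ x.2) \ q.1.2 = x.2 :=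
    fun x hx => Finset.union_sdiff_cancel_left
      (Finset.disjoint_left.2 fun i hi hi' => Finset.mem_compl.1 ((hmem x hx).2.1 hi') hi)
  have hlt : ∀ x (hx : x ∈ (q.1.1.powerset ×ˢ q.1.2ᶜ.powerset).filter C), faceOfIndex q <
      faceOfIndex ⟨(q.1.1 \ x.1, q.1.2 ∪ x.2), (hmem x hx).2.2.1⟩ := fun x hx => by
    rw [faceOfIndex_lt_iff hk hkd]
    refine ⟨⟨Finset.sdiff_subset, Finset.subset_union_left⟩, fun h => (hmem x hx).2.2.2 ?_⟩
    have e1 : q.1.1 = q.1.1 \ x.1 := congrArg (fun r => r.1.1) h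
    have e2 : q.1.2 = q.1.2 ∪ x.2 := congrArg (fun r => r.1.2) h
    rw [← h1 x hx, ← h2 x hx, ← e1, ← e2]
    simp
  symm
  refine Finset.sum_bij (fun x hx => faceOfIndex ⟨(q.1.1 \ x.1, q.1.2 ∪ x.2), (hmem x hx).2.2.1⟩)
    ?_ ?_ ?_ ?_
  · intro x hx
    exact Finset.mem_filter.2 ⟨Finset.mem_univ _, hlt x hx⟩
  · intro x hx y hy h
    have h := (faceOfIndex_bijective hk hkd).1 h
    have e1 : q.1.1 \ x.1 = q.1.1 \ y.1 := congrArg (fun r => r.1.1) h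
    have e2 : q.1.2 ∪ x.2 = q.1.2 ∪ y.2 := congrArg (fun r => r.1.2) h
    exact Prod.ext (by rw [← h1 x hx, e1, h1 y hy]) (by rw [← h2 x hx, e2, h2 y hy])
  · intro α hα
    have hα := (Finset.mem_filter.1 hα).2
    obtain ⟨p, rfl⟩ := (faceOfIndex_bijective hk hkd).2 α
    obtain ⟨⟨hL, hU⟩, hne⟩ := (faceOfIndex_lt_iff hk hkd q p).1 hα
    have e1 : q.1.1 \ (q.1.1 \ p.1.1) = p.1.1 := Finset.sdiff_sdiff_eq_self hL
    have e2 : q.1.2 ∪ (p.1.2 \ q.1.2) = p.1.2 := Finset.union_sdiff_of_subset hU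
    have hB : p.1.2 \ q.1.2 ⊆ q.1.2ᶜ := fun i hi =>
      Finset.mem_compl.2 (Finset.mem_sdiff.1 hi).2
    refine ⟨(q.1.1 \ p.1.1, p.1.2 \ q.1.2), ?_, ?_⟩
    · rw [Finset.mem_filter, Finset.mem_product, Finset.mem_powerset, Finset.mem_powerset]
      refine ⟨⟨Finset.sdiff_subset, hB⟩, (hC _ Finset.sdiff_subset _ hB).2 ⟨?_, ?_⟩⟩
      · rw [e1, e2]
        exact p.2
      · rintro ⟨h3, h4⟩
        rw [h3, Finset.sdiff_empty] at e1
        rw [h4, Finset.union_empty] at e2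
        exact hne (Subtype.ext (Prod.ext e1 e2))
    · congr 1
      exact Subtype.ext (Prod.ext e1 e2)
  · intro x hx
    rw [hfg _ (hlt x hx)]
    simp only
    rw [h1 x hx, h2 x hx]

theorem card_sdiff_eq_add {d : ℕ} {L' U' L U : Finset (Fin d)} (hL : L' ⊆ L) (hLU : L ⊆ U)
    (hU : U ⊆ U') : (U' \ L').card = (L \ L').card + (U' \ U).card + (U \ L).card := by
  have h1 := Finset.card_sdiff_add_card_eq_card hL
  have h2 := Finset.card_sdiff_add_card_eq_card hU
  have h3 := Finset.card_sdiff_add_card_eq_card hLU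
  have h4 := Finset.card_sdiff_add_card_eq_card (hL.trans (hLU.trans hU))
  omega

theorem dimension_faceOfIndex {d k : ℕ}
    (p : {p : Finset (Fin d) × Finset (Fin d) // IsFaceIndex k p.1 p.2}) :
    dimension (faceOfIndex p).1 = (p.1.2 \ p.1.1).card - 1 :=
  p.2.dimension_hypersimplexFace

/-- The full alternating sum factors over `S` and `T` and vanishes because one of them is nonempty.
The pair of empty sets contributes `1`, so the other pairs contribute `-1`, and the shift of the
exponent reverses the sign. -/
theorem sum_neg_one_pow_card_sub_one {d : ℕ} (S T : Finset (Fin d)) (h : ¬ (S = ∅ ∧ T = ∅)) :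
    ∑ x ∈ (S.powerset ×ˢ T.powerset).filter fun x => ¬ (x.1 = ∅ ∧ x.2 = ∅),
      (-1 : ℝ) ^ (x.1.card + x.2.card - 1) = 1 := by
  have h1 : ∑ x ∈ S.powerset ×ˢ T.powerset, (-1 : ℝ) ^ (x.1.card + x.2.card) = 0 := by
    rw [Finset.sum_product]
    simp only [pow_add, ← Finset.mul_sum, ← Finset.sum_mul]
    have key : ∀ S : Finset (Fin d), ∑ A ∈ S.powerset, (-1 : ℝ) ^ A.card =
        if S = ∅ then 1 else 0 := fun S => by
      exact_mod_cast congrArg (Int.cast (R := ℝ)) (Finset.sum_powerset_neg_one_pow_card (x := S))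
    rw [key, key]
    split_ifs with h1 h2
    · exact absurd ⟨h1, h2⟩ h
    all_goals simp
  have h2 : (S.powerset ×ˢ T.powerset).filter (fun x => x.1 = ∅ ∧ x.2 = ∅) = {(∅, ∅)} := by
    ext x
    simp only [Finset.mem_filter, Finset.mem_product, Finset.mem_powerset, Finset.mem_singleton,
      Prod.ext_iff]
    constructor
    · exact fun h => h.2
    · rintro ⟨h1, h2⟩
      rw [h1, h2]
      simp
  rw [← Finset.sum_filter_add_sum_filter_not _ (fun x => x.1 = ∅ ∧ x.2 = ∅), h2,
    Finset.sum_singleton] at h1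
  have h3 : ∀ x ∈ (S.powerset ×ˢ T.powerset).filter (fun x => ¬ (x.1 = ∅ ∧ x.2 = ∅)),
      (-1 : ℝ) ^ (x.1.card + x.2.card) = -(-1 : ℝ) ^ (x.1.card + x.2.card - 1) := fun x hx => by
    have : 0 < x.1.card + x.2.card := by
      by_contra hcon
      have h0 := (Finset.mem_filter.1 hx).2
      rw [← Finset.card_eq_zero, ← Finset.card_eq_zero] at h0
      omega
    obtain ⟨n, hn⟩ := Nat.exists_eq_succ_of_ne_zero this.ne'
    rw [hn, Nat.succ_eq_add_one, pow_succ, Nat.add_sub_cancel]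
    ring
  rw [Finset.sum_congr rfl h3, Finset.sum_neg_distrib] at h1
  simp only [Finset.card_empty, add_zero, pow_zero] at h1
  linarith

/-- Induction from larger to smaller faces. The inequalities `L.card < k < U.card` survive any
shrinking of `L` and enlarging of `U`, so all pairs of subsets occur, with `μ = Eu = 1`. -/
theorem eulerObstruction_eq_one {d k : ℕ} (hk : 1 ≤ k) (hkd : k ≤ d)
    (q : {p : Finset (Fin d) × Finset (Fin d) // IsFaceIndex k p.1 p.2}) (hq : q.1.1 ≠ q.1.2) :
    eulerObstruction (hypersimplexMatrix d k) (faceOfIndex q) = 1 := by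
  classical
  generalize hβ : faceOfIndex q = β
  induction β using (wellFounded_gt (α := Face (hypersimplexMatrix d k))).induction generalizing q with
  | _ β ih =>
  subst hβ
  rw [eulerObstruction_eq]
  split_ifs with hP
  · rfl
  have hlt : q.1.1.card < k ∧ k < q.1.2.card := q.2.2.resolve_left fun h' => hq h'.1
  rw [sum_faces_gt hk hkd q _ (fun A B => (-1) ^ (A.card + B.card - 1))
    (fun x => ¬ (x.1 = ∅ ∧ x.2 = ∅))]
  · convert sum_neg_one_pow_card_sub_one q.1.1 q.1.2ᶜ ?_
    rintro ⟨h1, h2⟩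
    apply hP
    have h3 : (faceOfIndex q).1 = hypersimplexFace d k q.1.1 q.1.2 := rfl
    rw [h3, h1, (Finset.compl_eq_empty_iff _).1 h2, hypersimplexFace_empty_univ]
  · intro A hA B hB
    refine (and_iff_right ⟨?_, Or.inr ⟨?_, ?_⟩⟩).symm
    · exact Finset.sdiff_subset.trans (q.2.1.trans Finset.subset_union_left)
    · exact (Finset.card_le_card Finset.sdiff_subset).trans_lt hlt.1
    · exact hlt.2.trans_le (Finset.card_le_card Finset.subset_union_left)
  · intro p hp
    obtain ⟨⟨hL, hU⟩, hne⟩ := (faceOfIndex_lt_iff hk hkd q p).1 hp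
    have hp' : p.1.1 ≠ p.1.2 := fun h => by
      have := Finset.card_le_card hL
      have := Finset.card_le_card hU
      rw [h] at *
      omega
    rw [ih _ hp p hp' rfl, subdiagramVolume_eq_one p q hL hU hq, dimension_faceOfIndex,
      dimension_faceOfIndex, mul_one, mul_one]
    have h1 := card_sdiff_eq_add hL q.2.1 hU
    have h2 := q.2.one_lt_card_sdiff hq
    congr 1
    omega

/-- The faces above the vertex are not vertices, so their obstructions are `1` and only the binomial
subdiagram volumes remain. The exponent is `A.card + B.card - 2` because the larger face has
dimension `A.card + B.card - 1`. -/
theorem eulerObstruction_vertex {d k : ℕ} (hk : 1 ≤ k) (hkd : k < d)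
    (q : {p : Finset (Fin d) × Finset (Fin d) // IsFaceIndex k p.1 p.2}) (hq : q.1.1 = q.1.2) :
    eulerObstruction (hypersimplexMatrix d k) (faceOfIndex q) = (min k (d - k) : ℕ) := by
  classical
  have hcard : q.1.1.card = k := by
    rcases q.2.2 with h | h
    · exact h.2
    · rw [hq] at h
      exact absurd (h.1.trans h.2) (lt_irrefl _)
  have hP : (faceOfIndex q).1 ≠ polytope (hypersimplexMatrix d k) := fun hP => by
    replace hP := hP.trans (hypersimplexFace_empty_univ d k).symm
    have h1 := (q.2.hypersimplexFace_subset_iff (L' := ∅) (U' := Finset.univ)).1 hP.le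
    have hi : IsFaceIndex k (∅ : Finset (Fin d)) Finset.univ :=
      ⟨by simp, Or.inr ⟨hk, by simpa using hkd⟩⟩
    have h2 := (hi.hypersimplexFace_subset_iff (L' := q.1.1) (U' := q.1.2)).1 hP.ge
    have := Finset.card_le_card h2.1
    rw [hcard, Finset.card_empty] at this
    omega
  rw [eulerObstruction_eq, if_neg hP, sum_faces_gt hk hkd.le q _
    (fun A B => (-1) ^ (A.card + B.card - 2) * ((A.card - 1 + (B.card - 1)).choose (A.card - 1) : ℝ))
    (fun x => x.1.Nonempty ∧ x.2.Nonempty)]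
  · have h2 := sum_powerset_powerset_choose q.1.1 q.1.2ᶜ
    rw [Finset.card_compl, ← hq, hcard, Fintype.card_fin] at h2
    rw [← h2]
    convert Finset.sum_product _ _ _ using 2
    ext x
    simp only [Finset.mem_filter, Finset.mem_product, Finset.mem_powerset, hq]
    tauto
  -- Starting from `L = U` of size `k`, the pair becomes the index of a strictly larger face exactly
  -- when something is removed from `L` and something is added to `U`.
  · intro A hA B hB
    rw [← hq] at hB ⊢
    constructor
    · rintro ⟨hA', hB'⟩
      refine ⟨⟨Finset.sdiff_subset.trans Finset.subset_union_left, Or.inr ⟨?_, ?_⟩⟩,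
        fun h => hA'.ne_empty h.1⟩
      · have := Finset.card_sdiff_add_card_eq_card hA
        have : 0 < A.card := Finset.card_pos.2 hA'
        omega
      · rw [Finset.card_union_of_disjoint (Finset.disjoint_left.2 fun i hi hi' =>
          Finset.mem_compl.1 (hB hi') hi)]
        have : 0 < B.card := Finset.card_pos.2 hB'
        omega
    · rintro ⟨⟨-, h | h⟩, hne⟩
      · exfalso
        apply hne
        constructor
        · rw [← Finset.sdiff_sdiff_eq_self hA, h.1]
          simp
        · rw [Finset.eq_empty_iff_forall_notMem]
          intro i hi
          have : i ∈ q.1.1 \ A := h.1 ▸ Finset.mem_union_right _ hi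
          exact Finset.mem_compl.1 (hB hi) (Finset.mem_sdiff.1 this).1
      · constructor
        · rw [Finset.nonempty_iff_ne_empty]
          rintro rfl
          rw [Finset.sdiff_empty] at h
          omega
        · rw [Finset.nonempty_iff_ne_empty]
          rintro rfl
          rw [Finset.union_empty] at h
          omega
  · intro p hp
    obtain ⟨⟨hL, hU⟩, hne⟩ := (faceOfIndex_lt_iff hk hkd.le q p).1 hp
    have hp' : p.1.1 ≠ p.1.2 := fun h => by
      apply hne
      refine Subtype.ext (Prod.ext (subset_antisymm ?_ hL) (subset_antisymm hU ?_))
      · rw [h, hq]; exact hU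
      · rw [← h, ← hq]; exact hL
    have hlt : p.1.1.card < k ∧ k < p.1.2.card := p.2.2.resolve_left fun h' => hp' h'.1
    have hL' : p.1.1 ⊂ q.1.1 := hL.ssubset_of_ne fun h => by
      rw [h] at hlt; omega
    have hU' : q.1.2 ⊂ p.1.2 := hU.ssubset_of_ne fun h => by
      rw [← h, ← hq] at hlt; omega
    rw [eulerObstruction_eq_one hk hkd.le p hp', subdiagramVolume_vertex p q hL' hU' hq,
      dimension_faceOfIndex, dimension_faceOfIndex, mul_one]
    have h1 := card_sdiff_eq_add hL q.2.1 hU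
    have h2 : (q.1.2 \ q.1.1).card = 0 := by rw [hq]; simp
    rw [h1, h2, ← hq]
    congr 2

/-! ### Chern-Mather volumes -/

theorem chernMatherVolume_zero {d k : ℕ} (hk : 1 ≤ k) (hkd : k < d) :
    chernMatherVolume (hypersimplexMatrix d k) 0 = (d.choose k : ℝ) * (min k (d - k) : ℕ) := by
  classical
  have hidx : ∀ S ∈ Finset.powersetCard k (Finset.univ : Finset (Fin d)), IsFaceIndex k S S :=
    fun S hS => ⟨subset_rfl, Or.inl ⟨rfl, (Finset.mem_powersetCard.1 hS).2⟩⟩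
  have h1 : ∑ S ∈ Finset.powersetCard k (Finset.univ : Finset (Fin d)), ((min k (d - k) : ℕ) : ℝ) =
      (d.choose k : ℝ) * (min k (d - k) : ℕ) := by
    rw [Finset.sum_const, Finset.card_powersetCard, Finset.card_univ, Fintype.card_fin,
      nsmul_eq_mul]
  rw [← h1, chernMatherVolume]
  symm
  refine Finset.sum_bij (fun S hS => faceOfIndex ⟨(S, S), hidx S hS⟩) ?_ ?_ ?_ ?_
  · intro S hS
    rw [Finset.mem_filter, dimension_faceOfIndex]
    simp
  · intro S hS S' hS' h
    exact congrArg (fun r => r.1.1) ((faceOfIndex_bijective hk hkd.le).1 h)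
  · intro β hβ
    obtain ⟨⟨⟨L, U⟩, hq⟩, rfl⟩ := (faceOfIndex_bijective hk hkd.le).2 β
    have hdim := (Finset.mem_filter.1 hβ).2
    rw [dimension_faceOfIndex] at hdim
    have hLU : L = U := by
      by_contra hne
      have := hq.one_lt_card_sdiff hne
      simp only at hdim this
      omega
    subst hLU
    refine ⟨L, Finset.mem_powersetCard.2 ⟨Finset.subset_univ _, ?_⟩, rfl⟩
    rcases hq.2 with h | h
    · exact h.2
    · exact absurd (h.1.trans h.2) (lt_irrefl _)
  · intro S hS
    rw [eulerObstruction_vertex hk hkd _ rfl]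
    have : vol (faceOfIndex ⟨(S, S), hidx S hS⟩).1 = 1 :=
      IsFaceIndex.vol_hypersimplexFace_vertex (Finset.mem_powersetCard.1 hS).2
    rw [this, one_mul]

/-- A face is given by its free set `F = U \ L`, of size `ℓ + 1`, and by a set `L` disjoint from
`F`. With `i = k - L.card`, the condition `L.card < k` reads `i ≥ 1` and `k < U.card` reads `i ≤ ℓ`;
the volume is the Eulerian number for `i - 1`, and the obstruction is `1`. -/
theorem chernMatherVolume_of_one_le {d k ℓ : ℕ} (hk : 1 ≤ k) (hkd : k < d) (hℓ : 1 ≤ ℓ) :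
    chernMatherVolume (hypersimplexMatrix d k) ℓ =
      ∑ i ∈ Finset.Icc 1 (min k ℓ), (d.choose (ℓ + 1) : ℝ) * ((d - ℓ - 1).choose (k - i) : ℝ) *
        (eulerianNumber ℓ (i - 1) : ℝ) := by
  classical
  -- An element of `X` stores `i` and `F` in its first component and `L` in its second; `i` is
  -- determined by `L` but labels the terms of the formula.
  let X : Finset (Σ _ : ℕ × Finset (Fin d), Finset (Fin d)) :=
    (Finset.Icc 1 (min k ℓ) ×ˢ Finset.powersetCard (ℓ + 1) Finset.univ).sigma
      fun x => Finset.powersetCard (k - x.1) x.2ᶜ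
  have hX : ∀ x ∈ X, (1 ≤ x.1.1 ∧ x.1.1 ≤ k ∧ x.1.1 ≤ ℓ) ∧ x.1.2.card = ℓ + 1 ∧
      x.2.card = k - x.1.1 ∧ Disjoint x.2 x.1.2 := fun x hx => by
    simp only [X, Finset.mem_sigma, Finset.mem_product, Finset.mem_Icc, Finset.mem_powersetCard,
      le_min_iff] at hx
    refine ⟨hx.1.1, hx.1.2.2, hx.2.2, Finset.disjoint_left.2 fun i hi hi' => ?_⟩
    exact Finset.mem_compl.1 (hx.2.1 hi) hi'
  have hidx : ∀ x ∈ X, IsFaceIndex k x.2 (x.2 ∪ x.1.2) := fun x hx => by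
    obtain ⟨h1, h2, h3, h4⟩ := hX x hx
    refine ⟨Finset.subset_union_left, Or.inr ⟨by omega, ?_⟩⟩
    rw [Finset.card_union_of_disjoint h4]
    omega
  have hsd : ∀ x ∈ X, (x.2 ∪ x.1.2) \ x.2 = x.1.2 := fun x hx =>
    Finset.union_sdiff_cancel_left (hX x hx).2.2.2
  have hsum : ∑ x ∈ X, (eulerianNumber ℓ (x.1.1 - 1) : ℝ) =
      ∑ i ∈ Finset.Icc 1 (min k ℓ), (d.choose (ℓ + 1) : ℝ) * ((d - ℓ - 1).choose (k - i) : ℝ) *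
        (eulerianNumber ℓ (i - 1) : ℝ) := by
    rw [Finset.sum_sigma, Finset.sum_product]
    refine Finset.sum_congr rfl fun i _ => ?_
    have h1 : ∀ F ∈ Finset.powersetCard (ℓ + 1) (Finset.univ : Finset (Fin d)),
        ∑ _L ∈ Finset.powersetCard (k - i) Fᶜ, (eulerianNumber ℓ (i - 1) : ℝ) =
        ((d - ℓ - 1).choose (k - i) : ℝ) * (eulerianNumber ℓ (i - 1) : ℝ) := fun F hF => by
      rw [Finset.sum_const, Finset.card_powersetCard, Finset.card_compl, Fintype.card_fin,
        (Finset.mem_powersetCard.1 hF).2, nsmul_eq_mul, Nat.sub_sub]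
    rw [Finset.sum_congr rfl h1, Finset.sum_const, Finset.card_powersetCard, Finset.card_univ,
      Fintype.card_fin, nsmul_eq_mul, mul_assoc]
  rw [← hsum, chernMatherVolume]
  symm
  refine Finset.sum_bij (fun x hx => faceOfIndex ⟨(x.2, x.2 ∪ x.1.2), hidx x hx⟩) ?_ ?_ ?_ ?_
  · intro x hx
    rw [Finset.mem_filter, dimension_faceOfIndex]
    simp only
    rw [hsd x hx, (hX x hx).2.1]
    simp
  · intro x hx y hy h
    have h := (faceOfIndex_bijective hk hkd.le).1 h
    have e1 : x.2 = y.2 := congrArg (fun r => r.1.1) h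
    have e2 : x.2 ∪ x.1.2 = y.2 ∪ y.1.2 := congrArg (fun r => r.1.2) h
    have e3 : x.1.2 = y.1.2 := by rw [← hsd x hx, ← hsd y hy, e2, e1]
    have e4 : x.1.1 = y.1.1 := by
      have h1 := hX x hx
      have h2 := hX y hy
      rw [e1] at h1
      omega
    exact Sigma.ext (Prod.ext e4 e3) (heq_of_eq e1)
  · intro β hβ
    obtain ⟨⟨⟨L, U⟩, hq⟩, rfl⟩ := (faceOfIndex_bijective hk hkd.le).2 β
    have hdim := (Finset.mem_filter.1 hβ).2
    rw [dimension_faceOfIndex] at hdim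
    simp only at hdim
    have hLU : L ⊆ U := hq.1
    have hc := Finset.card_sdiff_add_card_eq_card hLU
    have hlt : L.card < k ∧ k < U.card := hq.2.resolve_left fun h => by
      have h1 : L = U := h.1
      rw [h1, Finset.sdiff_self, Finset.card_empty] at hdim
      omega
    have hu : L ∪ U \ L = U := Finset.union_sdiff_of_subset hLU
    refine ⟨⟨(k - L.card, U \ L), L⟩, ?_, ?_⟩
    · simp only [X, Finset.mem_sigma, Finset.mem_product, Finset.mem_Icc, Finset.mem_powersetCard,
        le_min_iff]
      refine ⟨⟨⟨by omega, by omega, by omega⟩, Finset.subset_univ _, by omega⟩, fun i hi => ?_,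
        by omega⟩
      exact Finset.mem_compl.2 fun h => (Finset.mem_sdiff.1 h).2 hi
    · congr 1
      exact Subtype.ext (Prod.ext rfl hu)
  · intro x hx
    obtain ⟨h1, h2, h3, h4⟩ := hX x hx
    have hne : x.2 ≠ x.2 ∪ x.1.2 := fun h => by
      have := hsd x hx
      rw [← h, Finset.sdiff_self] at this
      rw [← this, Finset.card_empty] at h2
      omega
    have hvol : vol (faceOfIndex ⟨(x.2, x.2 ∪ x.1.2), hidx x hx⟩).1 =
        (eulerianNumber (((x.2 ∪ x.1.2) \ x.2).card - 1) (k - x.2.card - 1) : ℝ) :=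
      (hidx x hx).vol_hypersimplexFace hne
    rw [eulerObstruction_eq_one hk hkd.le _ hne, mul_one, hvol, hsd x hx, h2, h3,
      Nat.add_sub_cancel, Nat.sub_sub_self h1.2.1]

end ChernMather

/-! ### The formulas together, and the top-dimensional case. -/

theorem proposition4p7 (d k : ℕ) (hk : 1 ≤ k) (hkd : k < d) :
    ChernMather.chernMatherVolume (ChernMather.hypersimplexMatrix d k) 0 =
        (d.choose k : ℝ) * (min k (d - k) : ℕ) ∧
      (∀ ℓ : ℕ, 1 ≤ ℓ → ℓ ≤ d - 1 →
        ChernMather.chernMatherVolume (ChernMather.hypersimplexMatrix d k) ℓ =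
          ∑ i ∈ Finset.Icc 1 (min k ℓ),
            (d.choose (ℓ + 1) : ℝ) * ((d - ℓ - 1).choose (k - i) : ℝ) *
              (ChernMather.eulerianNumber ℓ (i - 1) : ℝ)) ∧
      ChernMather.chernMatherVolume (ChernMather.hypersimplexMatrix d k) (d - 1) =
        (ChernMather.eulerianNumber (d - 1) (k - 1) : ℝ) ∧
      (ChernMather.eulerianNumber (d - 1) (k - 1) : ℝ) =
        ChernMather.vol (ChernMather.polytope (ChernMather.hypersimplexMatrix d k)) := by
  have h2 : ∀ ℓ : ℕ, 1 ≤ ℓ → ℓ ≤ d - 1 →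
        ChernMather.chernMatherVolume (ChernMather.hypersimplexMatrix d k) ℓ =
          ∑ i ∈ Finset.Icc 1 (min k ℓ),
            (d.choose (ℓ + 1) : ℝ) * ((d - ℓ - 1).choose (k - i) : ℝ) *
              (ChernMather.eulerianNumber ℓ (i - 1) : ℝ) := fun ℓ hℓ _ =>
    ChernMather.chernMatherVolume_of_one_le hk hkd hℓ
  refine ⟨ChernMather.chernMatherVolume_zero hk hkd, h2, ?_, ?_⟩
  -- For `ℓ = d - 1` no coordinates are left for `L`, so `(0).choose (k - i)` leaves only `i = k`.
  · rw [h2 (d - 1) (by omega) le_rfl, Finset.sum_eq_single k]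
    · rw [show d - 1 + 1 = d by omega]
      simp
    · intro i hi hne
      have := Finset.mem_Icc.1 hi
      rw [show d - (d - 1) - 1 = 0 by omega, Nat.choose_eq_zero_of_lt (n := 0) (by omega)]
      simp
    · intro h
      exact absurd (Finset.mem_Icc.2 ⟨hk, by omega⟩) h
  -- The polytope itself is the face with all coordinates free.
  · have hidx : ChernMather.IsFaceIndex k (∅ : Finset (Fin d)) Finset.univ :=
      ⟨by simp, Or.inr ⟨hk, by simpa using hkd⟩⟩
    rw [← ChernMather.hypersimplexFace_empty_univ, hidx.vol_hypersimplexFace]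
    · simp
    · intro h
      have := congrArg Finset.card h
      simp at this
      omega
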